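/- **Setting.** Let $g_0=e^{2\sigma_0}|dz|^2$ be a smooth Riemannian metric on the sphere $\widehat{\mathbb C}=\mathbb C\cup\{\infty\}$ with $\sigma_0\equiv 0$ in a neighborhood of $\mathbb S=[0,1]^2$, and let $K_0$ be its Gaussian curvature. Let $H^1_0$ be the Sobolev space of functions on $\widehat{\mathbb C}$ with $\int f\,d\mathrm{Vol}_{g_0}=0$ and inner product $(f_1,f_2)_\nabla=\frac1{2\pi}\int\nabla f_1\cdot\nabla f_2\,dz$. Let $\widetilde h$ be the Gaussian free field modulo additive constant, i.e. $((\widetilde h,f)_\nabla)_{f\in H^1_0}$ is a centered Gaussian family with covariance $(\cdot,\cdot)_\nabla$. For mean-zero $\phi\in L^2$ put $(\widetilde h,\phi)=-2\pi(\widetilde h,\Delta_{g_0}^{-1}\phi)_\nabla$. Let $h$ be the field normalized by $(h,K_0)=0$: $(h,\phi)=(\widetilde h,\tilde\phi)$, where $\tilde\phi=\phi-aK_0$ and the number $a$ is chosen so that $\tilde\phi$ has mean zero. For $c<25$ let $Q=Q(c)=\sqrt{(25-c)/6}$. For a dyadic square $S\subset\mathbb S$ (side length $|S|=2^{-k}$,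 vertices in $2^{-k}\mathbb Z^2$, $k\ge0$) let $h_S=(h,|S|^{-2}\mathbb 1_S)$ and $A_h(S)=e^{h_S/Q}|S|$. For $\epsilon>0$ let $\mathcal P^\epsilon$ be the set of dyadic squares $S\subset\mathbb S$ with $A_h(S)\le\epsilon$ and $A_h(S')>\epsilon$ for every dyadic square $S'\subset\mathbb S$ with $S'\supsetneq S$. When $\mathcal P^\epsilon$ is finite, let $h^\epsilon$ be the continuous function on $\widehat{\mathbb C}$ that is the sum of * the function $f\in H^1_0$ of minimal Dirichlet energy with $\int f\,\tilde{\mathbb 1}_S\,d\mathrm{Vol}_{g_0}=(h,\tilde{\mathbb 1}_S)$ for all $S\in\mathcal P^\epsilon$, and * the constant that makes $\int h^\epsilon K_0\,d\mathrm{Vol}_{g_0}=0$. With $n=\#\mathcal P^\epsilon$ put $$g=e^{2(h^\epsilon/Q+C)}g_0,\qquad C=\tfrac14\log n-\tfrac34\log\mathrm{Vol}_{e^{2h^\epsilon/Q}g_0}(\widehat{\mathbb C}).$$ For $g=e^{2s}g_0$ define the Laplacian determinant of $g$ relative to $g_0$ by the Polyakov–Alvarez formula: $$D(g)=\exp\Big(-\frac1{12\pi}\int|\nabla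 s|^2\,dz-\frac1{6\pi}\int K_0\,s\,d\mathrm{Vol}_{g_0}+\log\mathrm{Vol}_g(\widehat{\mathbb C})-\log\mathrm{Vol}_{g_0}(\widehat{\mathbb C})\Big).$$ **Theorem.** Fix $\epsilon>0$, a positive integer $n$, and $c,c'\in\mathbb R$ with $c<25$ and $c+c'<25$, such that the event $\#\mathcal P^\epsilon=n$ has positive probability for central charge $c$. Then this event also has positive probability for central charge $c+c'$. Write $\mu_{c,n}$ for the law of $g$ for central charge $c$ conditioned on $\#\mathcal P^\epsilon=n$, and let $$W=\exp\Big(-\frac1{12\pi}\int_{\mathbb C}|\nabla(h^\epsilon/Q)|^2\,dz\Big).$$ On the event $\#\mathcal P^\epsilon=n$, almost surely $D(g)$ is a positive deterministic constant times $W$. Moreover $W^{-c'/2}$ is integrable under the conditioned law, and weighting $\mu_{c,n}$ by $W^{-c'/2}$ (and normalizing to total mass one) gives exactly $\mu_{c+c',n}$. -/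

import Mathlib

open MeasureTheory ProbabilityTheory Topology
open scoped ENNReal

noncomputable section

namespace LQG

/-! ## The sphere and its background metric

The Riemann sphere is `OnePoint ℂ`. The point at infinity is null for every measure below, so
integrals over the sphere are written in the coordinate `z ∈ ℂ`. -/

/-- `g₀ = e^{2σ₀} |dz|²` is a smooth Riemannian metric on the Riemann sphere: `σ₀` is smooth on `ℂ`,
and in the chart `w = 1/z`, where `g₀ = e^{2τ} |dw|²` with `τ(w) = σ₀(1/w) - 2 log |w|`, the
function `τ` extends smoothly to `w = 0`. -/
def IsSmoothSphereMetric (σ₀ : ℂ → ℝ) : Prop :=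
  ContDiff ℝ (⊤ : ℕ∞) σ₀ ∧
    ∃ τ : ℂ → ℝ, ContDiff ℝ (⊤ : ℕ∞) τ ∧ ∀ w : ℂ, w ≠ 0 → τ w = σ₀ w⁻¹ - 2 * Real.log ‖w‖

/-- The area measure of `g₀ = e^{2σ₀} |dz|²`. -/
def vol (σ₀ : ℂ → ℝ) : Measure ℂ :=
  volume.withDensity fun z => ENNReal.ofReal (Real.exp (2 * σ₀ z))

/-- The Gaussian curvature `K₀ = - e^{-2σ₀} Δ σ₀` of `g₀ = e^{2σ₀} |dz|²`. -/
def gaussCurv (σ₀ : ℂ → ℝ) (z : ℂ) : ℝ :=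
  -(Real.exp (-2 * σ₀ z) * Laplacian.laplacian σ₀ z)

/-! ## The Sobolev space `H¹₀` of the sphere -/

/-- An element of the Sobolev space `H¹₀(M)` of mean-zero functions on the sphere
`M = (ℂ ∪ {∞}, g₀)`: a mean-zero function in `L²(M)` together with its weak gradient, which is
required to be square integrable. The gradient is taken in the Euclidean coordinate; by conformal
invariance `|∇_{g₀} f|² dVol_{g₀} = |∇ f|² dz`. Elements stand for their almost-everywhere
classes. -/
structure H10 (σ₀ : ℂ → ℝ) where
  toFun : ℂ → ℝ
  grad : ℂ → ℂ
  memLp_toFun : MemLp toFun 2 (vol σ₀)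
  memLp_grad : MemLp grad 2 (volume : Measure ℂ)
  isWeakGrad : ∀ ψ : ℂ → ℝ, ContDiff ℝ (⊤ : ℕ∞) ψ → HasCompactSupport ψ → ∀ v : ℂ,
    ∫ z, toFun z * fderiv ℝ ψ z v = -∫ z, ψ z * inner ℝ (grad z) v
  mean_zero : ∫ z, toFun z ∂(vol σ₀) = 0

instance (σ₀ : ℂ → ℝ) : Inhabited (H10 σ₀) :=
  ⟨{ toFun := 0
     grad := 0
     memLp_toFun := MemLp.zero
     memLp_grad := MemLp.zero
     isWeakGrad := by intros; simp
     mean_zero := by simp }⟩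

/-- The Dirichlet inner product `(f₁, f₂)_∇ = (2π)⁻¹ ∫ ∇f₁ · ∇f₂`. -/
def dirichlet {σ₀ : ℂ → ℝ} (f₁ f₂ : H10 σ₀) : ℝ :=
  (2 * Real.pi)⁻¹ * ∫ z, inner ℝ (f₁.grad z) (f₂.grad z)

/-- `u = Δ_{g₀}⁻¹ φ` in the weak sense, for a mean-zero function `φ ∈ L²(M)`:
`∫ ∇u · ∇f = - ∫ φ f dVol_{g₀}` for all `f ∈ H¹₀(M)`. -/
def IsInvLaplacian {σ₀ : ℂ → ℝ} (φ : ℂ → ℝ) (u : H10 σ₀) : Prop :=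
  ∀ f : H10 σ₀, ∫ z, inner ℝ (u.grad z) (f.grad z) = -∫ z, φ z * f.toFun z ∂(vol σ₀)

/-- The inverse Laplacian `Δ_{g₀}⁻¹ φ ∈ H¹₀(M)` of a mean-zero function `φ ∈ L²(M)`
(the weak solution is unique up to almost-everywhere equality). -/
def invLaplacian (σ₀ : ℂ → ℝ) (φ : ℂ → ℝ) : H10 σ₀ :=
  Classical.epsilon fun u => IsInvLaplacian φ u

/-! ## The Gaussian free field -/

/-- `X f = (h̃, f)_∇`, `f ∈ H¹₀(M)`, is the Gaussian free field `h̃` on `M` modulo additive constant: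
a centred Gaussian family whose covariance is the Dirichlet inner product. -/
structure IsGFF {Ω : Type*} [MeasurableSpace Ω] {σ₀ : ℂ → ℝ} (X : H10 σ₀ → Ω → ℝ)
    (P : Measure Ω) : Prop where
  measurable : ∀ f, Measurable (X f)
  gaussian : IsGaussianProcess X P
  centered : ∀ f, ∫ ω, X f ω ∂P = 0
  covariance_eq : ∀ f₁ f₂, covariance (X f₁) (X f₂) P = dirichlet f₁ f₂

/-- The function `φ - c K₀` with `c` chosen so that it has mean zero. -/
def centerFun (σ₀ : ℂ → ℝ) (φ : ℂ → ℝ) (z : ℂ) : ℝ :=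
  φ z - (∫ w, φ w ∂(vol σ₀)) / (∫ w, gaussCurv σ₀ w ∂(vol σ₀)) * gaussCurv σ₀ z

/-- The `L²` pairing `(h̃, φ) = - 2π (h̃, Δ⁻¹ φ)_∇` of the field modulo constants with a mean-zero
function `φ ∈ L²(M)`. The factor `2π` compensates the one in the Dirichlet inner product:
`∫ f φ dVol_{g₀} = - ∫ ∇f · ∇(Δ⁻¹ φ) = - 2π (f, Δ⁻¹ φ)_∇`. -/
def pairMod {Ω : Type*} {σ₀ : ℂ → ℝ} (X : H10 σ₀ → Ω → ℝ) (φ : ℂ → ℝ) (ω : Ω) : ℝ :=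
  -(2 * Real.pi) * X (invLaplacian σ₀ φ) ω

/-- The `L²` pairing `(h, φ) = (h̃, φ - c K₀)` of `φ ∈ L²(M)` with the Gaussian free field `h`
normalized by `(h, K₀) = 0`. -/
def pairGFF {Ω : Type*} {σ₀ : ℂ → ℝ} (X : H10 σ₀ → Ω → ℝ) (φ : ℂ → ℝ) (ω : Ω) : ℝ :=
  pairMod X (centerFun σ₀ φ) ω

/-! ## Dyadic squares and the `ε`-square subdivision -/

/-- The closed unit square `𝕊 = [0,1]²`. -/
def unitSquare : Set ℂ := {z | z.re ∈ Set.Icc 0 1 ∧ z.im ∈ Set.Icc 0 1}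

/-- The dyadic squares in `𝕊`: `⟨k, i, j⟩` is the closed square of side length `2⁻ᵏ` with lower left
corner `2⁻ᵏ (i + j √-1)`. -/
abbrev DyadicSquare : Type := Σ k : ℕ, Fin (2 ^ k) × Fin (2 ^ k)

/-- The side length `|S|`. -/
def DyadicSquare.side (S : DyadicSquare) : ℝ := ((2 : ℝ) ^ S.1)⁻¹

/-- The points of a dyadic square. -/
def DyadicSquare.carrier (S : DyadicSquare) : Set ℂ :=
  {z | z.re ∈ Set.Icc ((S.2.1 : ℕ) * S.side) (((S.2.1 : ℕ) + 1) * S.side) ∧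
    z.im ∈ Set.Icc ((S.2.2 : ℕ) * S.side) (((S.2.2 : ℕ) + 1) * S.side)}

/-- The indicator function `𝟙_S`. -/
def DyadicSquare.ind (S : DyadicSquare) : ℂ → ℝ := S.carrier.indicator 1

/-- The mean-zero function obtained from `𝟙_S` by subtracting a multiple of `K₀`. -/
def DyadicSquare.indTilde (σ₀ : ℂ → ℝ) (S : DyadicSquare) : ℂ → ℝ := centerFun σ₀ S.ind

/-- The average `h_S = (h, |S|⁻² 𝟙_S)` of the field on `S`. -/
def squareAverage {Ω : Type*} {σ₀ : ℂ → ℝ} (X : H10 σ₀ → Ω → ℝ) (S : DyadicSquare) (ω : Ω) : ℝ :=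
  pairGFF X (fun z => (S.side ^ 2)⁻¹ * S.ind z) ω

/-- The background charge: the positive `Q` with `c = 25 - 6 Q²`, for `c < 25`. -/
def backgroundCharge (c : ℝ) : ℝ := Real.sqrt ((25 - c) / 6)

/-- The size `A_h(S) = e^{h_S / Q} |S|` of a dyadic square. -/
def squareSize {Ω : Type*} {σ₀ : ℂ → ℝ} (X : H10 σ₀ → Ω → ℝ) (c : ℝ) (S : DyadicSquare)
    (ω : Ω) : ℝ :=
  Real.exp (squareAverage X S ω / backgroundCharge c) * S.side

/-- The `ε`-square subdivision: the dyadic squares `S` with `A_h(S) ≤ ε` all of whose strict dyadic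
ancestors `T` satisfy `A_h(T) > ε`. -/
def subdivision {Ω : Type*} {σ₀ : ℂ → ℝ} (X : H10 σ₀ → Ω → ℝ) (c ε : ℝ) (ω : Ω) :
    Set DyadicSquare :=
  {S | squareSize X c S ω ≤ ε ∧
    ∀ T : DyadicSquare, S.carrier ⊂ T.carrier → ε < squareSize X c T ω}

/-- The event that the `ε`-square subdivision consists of exactly `n` squares. -/
def countEvent {Ω : Type*} {σ₀ : ℂ → ℝ} (X : H10 σ₀ → Ω → ℝ) (c ε : ℝ) (n : ℕ) : Set Ω :=
  {ω | (subdivision X c ε ω).encard = n}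

/-! ## The regularized field -/

/-- `f` has minimal Dirichlet energy among all functions in `H¹₀(M)` whose `L²` inner product with
the centred indicator of `S` equals `a S` for each `S` in the collection `Ps`. -/
def IsMinimalEnergy {σ₀ : ℂ → ℝ} (Ps : Set DyadicSquare) (a : DyadicSquare → ℝ)
    (f : H10 σ₀) : Prop :=
  (∀ S ∈ Ps, ∫ z, f.toFun z * S.indTilde σ₀ z ∂(vol σ₀) = a S) ∧
    ∀ f' : H10 σ₀, (∀ S ∈ Ps, ∫ z, f'.toFun z * S.indTilde σ₀ z ∂(vol σ₀) = a S) →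
      dirichlet f f ≤ dirichlet f' f'

/-- The continuous function `k` on the sphere is the sum of the minimal energy function for the data
`a` on `Ps` and a constant, with the constant chosen so that `(k, K₀) = 0`. -/
def IsRegularization (σ₀ : ℂ → ℝ) (Ps : Set DyadicSquare) (a : DyadicSquare → ℝ)
    (k : C(OnePoint ℂ, ℝ)) : Prop :=
  (∃ f : H10 σ₀, IsMinimalEnergy Ps a f ∧
    ∃ b : ℝ, ∀ᵐ z : ℂ, k (z : OnePoint ℂ) = f.toFun z + b) ∧
  ∫ z : ℂ, k (z : OnePoint ℂ) * gaussCurv σ₀ z ∂(vol σ₀) = 0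

/-- The regularization for the data `a` on a finite collection `Ps` of squares; it is unique. -/
def regularization (σ₀ : ℂ → ℝ) (Ps : Set DyadicSquare) (a : DyadicSquare → ℝ) :
    C(OnePoint ℂ, ℝ) :=
  Classical.epsilon fun k => IsRegularization σ₀ Ps a k

/-- The regularized field `h^ε = h^{P^ε}`, with data `a S = (h, 𝟙̃_S)` (meaningful on the event that
the subdivision `P^ε` is finite). -/
def regField {Ω : Type*} {σ₀ : ℂ → ℝ} (X : H10 σ₀ → Ω → ℝ) (c ε : ℝ) (ω : Ω) :
    C(OnePoint ℂ, ℝ) :=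
  regularization σ₀ (subdivision X c ε ω) fun S => pairGFF X (S.indTilde σ₀) ω

/-! ## The quantum-regularized metric and its law -/

/-- The area of the sphere for the metric `e^{2s} g₀`. -/
def sphereArea (σ₀ : ℂ → ℝ) (s : C(OnePoint ℂ, ℝ)) : ℝ :=
  ∫ z : ℂ, Real.exp (2 * s (z : OnePoint ℂ)) ∂(vol σ₀)

/-- The function `h^ε / Q`. -/
def scaledField {Ω : Type*} {σ₀ : ℂ → ℝ} (X : H10 σ₀ → Ω → ℝ) (c ε : ℝ) (ω : Ω) :
    C(OnePoint ℂ, ℝ) :=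
  (backgroundCharge c)⁻¹ • regField X c ε ω

/-- The constant `C = (1/4) log n - (3/4) log Vol_{e^{2 h^ε / Q} g₀}`, with `n` the number of squares
in the subdivision. -/
def normConst {Ω : Type*} {σ₀ : ℂ → ℝ} (X : H10 σ₀ → Ω → ℝ) (c ε : ℝ) (ω : Ω) : ℝ :=
  1 / 4 * Real.log ((subdivision X c ε ω).ncard : ℝ) -
    3 / 4 * Real.log (sphereArea σ₀ (scaledField X c ε ω))

/-- The function `h^ε / Q + C`, half the logarithm of the conformal factor of `g` relative to
`g₀`. -/
def logFactor {Ω : Type*} {σ₀ : ℂ → ℝ} (X : H10 σ₀ → Ω → ℝ) (c ε : ℝ) (ω : Ω) :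
    C(OnePoint ℂ, ℝ) :=
  scaledField X c ε ω + ContinuousMap.const (OnePoint ℂ) (normConst X c ε ω)

/-- The quantum-regularized metric `g = e^{2 (h^ε / Q + C)} g₀`. A continuous metric conformal to the
fixed metric `g₀` is identified with its conformal factor relative to `g₀`, a continuous function on
the sphere. -/
def regMetric {Ω : Type*} {σ₀ : ℂ → ℝ} (X : H10 σ₀ → Ω → ℝ) (c ε : ℝ) (ω : Ω) :
    C(OnePoint ℂ, ℝ) where
  toFun p := Real.exp (2 * logFactor X c ε ω p)
  continuous_toFun := by fun_prop

/-- The space of conformal factors carries the Borel σ-algebra of uniform convergence. -/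
instance : MeasurableSpace C(OnePoint ℂ, ℝ) := borel _

instance : BorelSpace C(OnePoint ℂ, ℝ) := ⟨rfl⟩

/-- The law `μ_{c,n}` of `g` conditioned on the subdivision having exactly `n` squares. -/
def regLaw {Ω : Type*} [MeasurableSpace Ω] {σ₀ : ℂ → ℝ} (P : Measure Ω) (X : H10 σ₀ → Ω → ℝ)
    (c ε : ℝ) (n : ℕ) : Measure C(OnePoint ℂ, ℝ) :=
  (ProbabilityTheory.cond P (countEvent X c ε n)).map (regMetric X c ε)

/-- The measure `μ` weighted by `W ≥ 0`, normalized to be a probability measure: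
`dν = W dμ / ∫ W dμ`. -/
def weighted {Ω : Type*} [MeasurableSpace Ω] (μ : Measure Ω) (W : Ω → ℝ) : Measure Ω :=
  (∫⁻ ω, ENNReal.ofReal (W ω) ∂μ)⁻¹ • μ.withDensity fun ω => ENNReal.ofReal (W ω)

/-! ## The determinant of the Laplacian -/

/-- `∫ |∇s|² dz`, which is `∫ |∇_{g₀} s|² dVol_{g₀}` by conformal invariance. -/
def dirichletEnergy (s : C(OnePoint ℂ, ℝ)) : ℝ :=
  ∫ z : ℂ, ‖gradient (fun w : ℂ => s (w : OnePoint ℂ)) z‖ ^ 2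

/-- The determinant of the Laplacian of `g = e^{2s} g₀` relative to the one of `g₀`, as defined by the
Polyakov–Alvarez formula on a closed surface. -/
def polyakovAlvarezDet (σ₀ : ℂ → ℝ) (s : C(OnePoint ℂ, ℝ)) : ℝ :=
  Real.exp (-(1 / (12 * Real.pi)) * dirichletEnergy s
    - 1 / (6 * Real.pi) * ∫ z : ℂ, gaussCurv σ₀ z * s (z : OnePoint ℂ) ∂(vol σ₀)
    + Real.log (sphereArea σ₀ s) - Real.log (sphereArea σ₀ 0))

/-- The reduced determinant `exp (-(1/(12π)) ∫ |∇(h^ε / Q)|² dz)` of the regularized metric. -/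
def reducedDet {Ω : Type*} {σ₀ : ℂ → ℝ} (X : H10 σ₀ → Ω → ℝ) (c ε : ℝ) (ω : Ω) : ℝ :=
  Real.exp (-(1 / (12 * Real.pi)) * dirichletEnergy (scaledField X c ε ω))

end LQG

end

/-! Split the event `#P^ε = n` according to the finite collection F of squares that the subdivision
equals. Write u_S = Δ⁻¹𝟙̃_S, let G be the Gram matrix ∫ ∇u_S · ∇u_T over S, T in F, and let m_S =
(h, 𝟙̃_S). Outside a null set, the event and the metric on it depend only on the vector a = (m_S /
Q), S ∈ F, through functions that do not involve the central charge. Indeed masses are additive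
under splitting a square into its four children, and F covers all small squares, so the masses on F
determine the averages on all ancestors of its members; and h^ε / Q is linear in a
(`exists_isMassParametrization`).

The vector m is a centred Gaussian with covariance 2πG, so a has density proportional to Qⁿ exp(-(Q²
/ 4π) aᵀG⁻¹a). The minimal energy function with data a is a linear combination of the u_S, and its
energy ∫ |∇f|² is aᵀG⁻¹a (`exists_regularization`). Passing from c to c + c' lowers Q² by c'/6; with
Q' the new background charge, the density at a given a is multiplied by (Q'/Q)ⁿ exp((c' / 24π)
aᵀG⁻¹a) = (Q'/Q)ⁿ W^(-c'/2). This is `lintegral_gaussian_scaling`, applied in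
`IsGFF.setLIntegral_subdivisionEvent`. The prefactor depends on F only through n, so it survives
summation over F and cancels on normalizing. Applied to the whole space, the same identity gives the
integrability of the weight and the positivity of the event for c + c'.

For the determinant, adding a constant C to the field leaves the energy alone, changes the curvature
term by -2C/3 (Gauss–Bonnet) and the log-area by 2C. The given C makes 4C/3 cancel the log-area,
leaving n^(1/3) W / Vol(g₀) (`polyakovAlvarezDet_normalizedField`).

The analytic input is that G is invertible and that the u_S exist with continuous representatives.
For a density m of total mass M, the explicit solution is (2π)⁻¹ log|·| * m + (M / 4π) σ₀: since
e^(2σ₀) K₀ = -Δσ₀, the second term produces the multiple of K₀ that has to be subtracted, and it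
cancels the logarithmic growth of the first. The weak equation is proved by smoothing the
logarithmic kernel and then removing cutoffs at infinity (`WeakPair.integral_potField`,
`WeakPair.integral_of_cutoff`). -/

noncomputable section

namespace LQG

/-! ## Weak gradients and integration by parts -/

/-- `g` is a square integrable weak gradient of the locally integrable function `f`. -/
structure WeakPair (f : ℂ → ℝ) (g : ℂ → ℂ) : Prop where
  locInt : LocallyIntegrable f
  memLp_grad : MemLp g 2 (volume : Measure ℂ)
  weak : ∀ ψ : ℂ → ℝ, ContDiff ℝ (⊤ : ℕ∞) ψ → HasCompactSupport ψ → ∀ v : ℂ,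
    ∫ z, f z * fderiv ℝ ψ z v = -∫ z, ψ z * inner ℝ (g z) v

/-- The divergence of a planar vector field. -/
def divergence (V : ℂ → ℂ) (z : ℂ) : ℝ :=
  (fderiv ℝ V z 1).re + (fderiv ℝ V z Complex.I).im

lemma inner_re_im (z w : ℂ) : inner ℝ z w = z.re * w.re + z.im * w.im := by
  simp [Complex.inner, mul_comm]

lemma fderiv_apply_re_im (L : ℂ →L[ℝ] ℝ) (v : ℂ) :
    L v = v.re * L 1 + v.im * L Complex.I := by
  conv_lhs => rw [← Complex.re_add_im v]
  have h1 : (v.re : ℂ) + v.im * Complex.I = v.re • (1 : ℂ) + v.im • Complex.I := by simp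
  rw [h1, map_add, map_smul, map_smul, smul_eq_mul, smul_eq_mul]

lemma integrable_mul_of_hasCompactSupport {f χ : ℂ → ℝ} (hf : LocallyIntegrable f)
    (hχ : Continuous χ) (hc : HasCompactSupport χ) : Integrable fun z => f z * χ z := by
  simpa [mul_comm] using hf.integrable_smul_left_of_hasCompactSupport hχ hc

lemma WeakPair.locInt_grad {f : ℂ → ℝ} {g : ℂ → ℂ} (h : WeakPair f g) : LocallyIntegrable g :=
  h.memLp_grad.locallyIntegrable (by norm_num)

lemma locallyIntegrable_re {g : ℂ → ℂ} (h : LocallyIntegrable g) :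
    LocallyIntegrable fun z => (g z).re := by
  intro x
  obtain ⟨s, hs, hi⟩ := h x
  exact ⟨s, hs, hi.re⟩

lemma locallyIntegrable_im {g : ℂ → ℂ} (h : LocallyIntegrable g) :
    LocallyIntegrable fun z => (g z).im := by
  intro x
  obtain ⟨s, hs, hi⟩ := h x
  exact ⟨s, hs, hi.im⟩

lemma contDiff_re {V : ℂ → ℂ} {n : WithTop ℕ∞} (h : ContDiff ℝ n V) :
    ContDiff ℝ n fun z => (V z).re := Complex.reCLM.contDiff.comp h

lemma contDiff_im {V : ℂ → ℂ} {n : WithTop ℕ∞} (h : ContDiff ℝ n V) :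
    ContDiff ℝ n fun z => (V z).im := Complex.imCLM.contDiff.comp h

lemma fderiv_re {V : ℂ → ℂ} {z : ℂ} (h : DifferentiableAt ℝ V z) (v : ℂ) :
    fderiv ℝ (fun z => (V z).re) z v = (fderiv ℝ V z v).re := by
  have := (Complex.reCLM.hasFDerivAt.comp z h.hasFDerivAt).fderiv
  change fderiv ℝ (Complex.reCLM ∘ V) z v = _
  rw [this]; rfl

lemma fderiv_im {V : ℂ → ℂ} {z : ℂ} (h : DifferentiableAt ℝ V z) (v : ℂ) :
    fderiv ℝ (fun z => (V z).im) z v = (fderiv ℝ V z v).im := by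
  have := (Complex.imCLM.hasFDerivAt.comp z h.hasFDerivAt).fderiv
  change fderiv ℝ (Complex.imCLM ∘ V) z v = _
  rw [this]; rfl

/-- Integration by parts against a smooth vector field with a smooth cutoff. -/
theorem WeakPair.integral_smooth {f : ℂ → ℝ} {g : ℂ → ℂ} (h : WeakPair f g) {χ : ℂ → ℝ}
    (hχ : ContDiff ℝ (⊤ : ℕ∞) χ) (hc : HasCompactSupport χ) {V : ℂ → ℂ}
    (hV : ContDiff ℝ (⊤ : ℕ∞) V) :
    ∫ z, χ z * inner ℝ (V z) (g z) =
      -∫ z, f z * (χ z * divergence V z + fderiv ℝ χ z (V z)) := by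
  -- Each component of χV is a test function, used in its own coordinate direction; the two
  -- identities sum to the divergence form.
  have h1 := h.weak (fun z => χ z * (V z).re) (hχ.mul (contDiff_re hV)) hc.mul_right 1
  have h2 := h.weak (fun z => χ z * (V z).im) (hχ.mul (contDiff_im hV)) hc.mul_right Complex.I
  have hdχ : Differentiable ℝ χ := hχ.differentiable (by simp)
  have hdV : Differentiable ℝ V := hV.differentiable (by simp)
  have hcV : Continuous V := hV.continuous
  have i1 : Integrable fun z => f z * fderiv ℝ (fun z => χ z * (V z).re) z 1 := by
    refine integrable_mul_of_hasCompactSupport h.locInt ?_ ?_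
    · exact ((hχ.mul (contDiff_re hV)).continuous_fderiv (by simp)).clm_apply continuous_const
    · exact (hc.mul_right (f' := fun z => (V z).re)).fderiv_apply ℝ 1
  have i2 : Integrable fun z => f z * fderiv ℝ (fun z => χ z * (V z).im) z Complex.I := by
    refine integrable_mul_of_hasCompactSupport h.locInt ?_ ?_
    · exact ((hχ.mul (contDiff_im hV)).continuous_fderiv (by simp)).clm_apply continuous_const
    · exact (hc.mul_right (f' := fun z => (V z).im)).fderiv_apply ℝ _
  have i3 : Integrable fun z => χ z * (V z).re * inner ℝ (g z) 1 := by
    have := integrable_mul_of_hasCompactSupport (locallyIntegrable_re h.locInt_grad)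
      (hχ.continuous.mul (Complex.continuous_re.comp hcV)) (hc.mul_right (f' := fun z => (V z).re))
    refine this.congr (ae_of_all _ fun z => ?_)
    simp; ring
  have i4 : Integrable fun z => χ z * (V z).im * inner ℝ (g z) Complex.I := by
    have := integrable_mul_of_hasCompactSupport (locallyIntegrable_im h.locInt_grad)
      (hχ.continuous.mul (Complex.continuous_im.comp hcV)) (hc.mul_right (f' := fun z => (V z).im))
    refine this.congr (ae_of_all _ fun z => ?_)
    simp; ring
  have e1 : ∫ z, χ z * inner ℝ (V z) (g z) =
      (∫ z, χ z * (V z).re * inner ℝ (g z) 1) + ∫ z, χ z * (V z).im * inner ℝ (g z) Complex.I := by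
    rw [← integral_add i3 i4]
    refine integral_congr_ae (ae_of_all _ fun z => ?_)
    simp; ring
  have e2 : ∫ z, f z * (χ z * divergence V z + fderiv ℝ χ z (V z)) =
      (∫ z, f z * fderiv ℝ (fun z => χ z * (V z).re) z 1) +
        ∫ z, f z * fderiv ℝ (fun z => χ z * (V z).im) z Complex.I := by
    rw [← integral_add i1 i2]
    refine integral_congr_ae (ae_of_all _ fun z => ?_)
    have dre : DifferentiableAt ℝ (fun z => (V z).re) z :=
      Complex.reCLM.differentiableAt.comp z (hdV z)
    have dim : DifferentiableAt ℝ (fun z => (V z).im) z :=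
      Complex.imCLM.differentiableAt.comp z (hdV z)
    simp only
    rw [fderiv_fun_mul (hdχ z) dre, fderiv_fun_mul (hdχ z) dim]
    simp only [add_apply, smul_apply, smul_eq_mul]
    rw [fderiv_re (hdV z), fderiv_im (hdV z), divergence, fderiv_apply_re_im (fderiv ℝ χ z) (V z)]
    ring
  linarith

/-- Testing against the constant 1 turns integration by parts into the divergence theorem; this is
how Gauss–Bonnet is obtained. -/
lemma weakPair_one : WeakPair (fun _ => 1) (fun _ => 0) where
  locInt := continuous_const.locallyIntegrable
  memLp_grad := MemLp.zero
  weak ψ hψ hc v := by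
    have := integral_mul_fderiv_eq_neg_fderiv_mul_of_integrable (μ := (volume : Measure ℂ))
      (f := fun _ : ℂ => (1 : ℝ)) (g := ψ) (v := v) (by simp)
      (by simpa using ((hψ.continuous_fderiv (by simp)).clm_apply
        continuous_const).integrable_of_hasCompactSupport (hc.fderiv_apply ℝ v))
      (by simpa using hψ.continuous.integrable_of_hasCompactSupport hc)
      (fun x _ => by fun_prop) (fun x _ => (hψ.differentiable (by simp)) x)
    simpa using this

/-! ## The regularized logarithmic kernel -/

/-- The field `z / (|z|² + δ²)`, the gradient of `½ log (|z|² + δ²)`. For `δ = 0` it is the gradient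
of `log |z|`. -/
def kernelField (δ : ℝ) (z : ℂ) : ℂ := (‖z‖ ^ 2 + δ ^ 2)⁻¹ • z

lemma contDiff_norm_sq_add (δ : ℝ) : ContDiff ℝ (⊤ : ℕ∞) fun z : ℂ => ‖z‖ ^ 2 + δ ^ 2 :=
  (contDiff_norm_sq ℝ).add contDiff_const

lemma contDiff_kernelField {δ : ℝ} (hδ : 0 < δ) : ContDiff ℝ (⊤ : ℕ∞) (kernelField δ) :=
  ((contDiff_norm_sq_add δ).inv fun z => by positivity).smul contDiff_id

lemma hasFDerivAt_norm_sq_add (δ : ℝ) (z : ℂ) :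
    HasFDerivAt (fun z : ℂ => ‖z‖ ^ 2 + δ ^ 2) (2 • innerSL ℝ z) z :=
  (hasStrictFDerivAt_norm_sq z).hasFDerivAt.add_const _

lemma hasGradientAt_half_log {δ : ℝ} {z : ℂ} (h : ‖z‖ ^ 2 + δ ^ 2 ≠ 0) :
    HasFDerivAt (fun z : ℂ => 1 / 2 * Real.log (‖z‖ ^ 2 + δ ^ 2))
      (innerSL ℝ (kernelField δ z)) z := by
  refine (((hasFDerivAt_norm_sq_add δ z).log h).const_mul (1 / 2)).congr_fderiv ?_
  refine ContinuousLinearMap.ext fun v => ?_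
  simp only [kernelField, smul_apply, innerSL_apply_apply, real_inner_smul_left, smul_eq_mul,
    nsmul_eq_mul]
  push_cast
  ring

/-- The divergence is a smooth approximation, at scale δ, of 2π times the Dirac mass; at δ = 0 it
would vanish away from the origin. -/
lemma divergence_kernelField {δ : ℝ} (hδ : 0 < δ) (z : ℂ) :
    divergence (kernelField δ) z = 2 * δ ^ 2 / (‖z‖ ^ 2 + δ ^ 2) ^ 2 := by
  have h0 : ‖z‖ ^ 2 + δ ^ 2 ≠ 0 := by positivity
  have h := ((hasDerivAt_inv h0).comp_hasFDerivAt z (hasFDerivAt_norm_sq_add δ z)).smul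
    (hasFDerivAt_id z)
  have h' : fderiv ℝ (kernelField δ) z = _ := h.fderiv
  have hz : ‖z‖ ^ 2 = z.re * z.re + z.im * z.im := by
    rw [← Complex.normSq_eq_norm_sq, Complex.normSq_apply]
  rw [divergence, h']
  simp only [add_apply, smul_apply, ContinuousLinearMap.smulRight_apply, Complex.add_re,
    Complex.add_im, Complex.smul_re, Complex.smul_im, Function.comp_apply, innerSL_apply_apply,
    inner_re_im, ContinuousLinearMap.id_apply, Complex.one_re, Complex.one_im, Complex.I_re,
    Complex.I_im, smul_eq_mul, nsmul_eq_mul, id]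
  field_simp
  push_cast
  rw [hz]
  ring

lemma norm_kernelField (δ : ℝ) (z : ℂ) : ‖kernelField δ z‖ = ‖z‖ / (‖z‖ ^ 2 + δ ^ 2) := by
  rw [kernelField, norm_smul, norm_inv, Real.norm_of_nonneg (by positivity)]
  ring

lemma norm_kernelField_le (δ : ℝ) (z : ℂ) : ‖kernelField δ z‖ ≤ ‖z‖⁻¹ := by
  rw [norm_kernelField]
  rcases eq_or_ne z 0 with rfl | hz
  · simp
  have : 0 < ‖z‖ := norm_pos_iff.2 hz
  rw [div_le_iff₀ (by positivity)]
  field_simp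
  nlinarith [sq_nonneg δ]

lemma norm_kernelField_le_const {δ : ℝ} (hδ : 0 < δ) (z : ℂ) : ‖kernelField δ z‖ ≤ δ⁻¹ := by
  rw [norm_kernelField, div_le_iff₀ (by positivity)]
  field_simp
  nlinarith [sq_nonneg (δ - ‖z‖), norm_nonneg z]

lemma measurable_kernelField (δ : ℝ) : Measurable (kernelField δ) := by
  unfold kernelField
  fun_prop

/-- The uniform comparison of the regularized and the singular kernel. -/
lemma norm_kernelField_sub_le {δ : ℝ} (hδ : 0 ≤ δ) (z : ℂ) :
    ‖kernelField δ z - kernelField 0 z‖ ≤ δ ^ (1 / 2 : ℝ) * ‖z‖ ^ (-(3 / 2) : ℝ) := by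
  rcases eq_or_ne z 0 with rfl | hz
  · simp [kernelField]
  have hr : 0 < ‖z‖ := norm_pos_iff.2 hz
  rcases hδ.eq_or_lt with rfl | hδ
  · simp
  have e : kernelField δ z - kernelField 0 z
      = (-(δ ^ 2 / (‖z‖ ^ 2 * (‖z‖ ^ 2 + δ ^ 2)))) • z := by
    rw [kernelField, kernelField, ← sub_smul]
    congr 1
    field_simp
    ring
  rw [e, norm_smul, norm_neg, Real.norm_of_nonneg (by positivity)]
  have h1 : δ ^ 2 / (‖z‖ ^ 2 * (‖z‖ ^ 2 + δ ^ 2)) * ‖z‖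
      = δ ^ 2 / (‖z‖ ^ 2 + δ ^ 2) * ‖z‖⁻¹ := by
    field_simp
  -- The left side is at most min(1, (δ/|z|)²), and any power (δ/|z|)^p with 0 < p < 2 dominates
  -- this. Taking p = 1/2 leaves the total singularity |z|^(-3/2), still locally integrable in the
  -- plane, and a positive rate in δ.
  have h2 : δ ^ 2 / (‖z‖ ^ 2 + δ ^ 2) ≤ (δ / ‖z‖) ^ (1 / 2 : ℝ) := by
    rcases le_total δ ‖z‖ with h | h
    · have : (δ / ‖z‖) ^ (2 : ℝ) ≤ (δ / ‖z‖) ^ (1 / 2 : ℝ) :=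
        Real.rpow_le_rpow_of_exponent_ge (by positivity) ((div_le_one hr).2 h) (by norm_num)
      refine le_trans ?_ this
      rw [Real.rpow_two, div_pow]
      gcongr
      nlinarith [sq_nonneg δ]
    · refine le_trans ?_ (Real.one_le_rpow ((one_le_div hr).2 h) (by norm_num))
      rw [div_le_one (by positivity)]
      nlinarith [sq_nonneg ‖z‖]
  rw [h1]
  calc δ ^ 2 / (‖z‖ ^ 2 + δ ^ 2) * ‖z‖⁻¹ ≤ (δ / ‖z‖) ^ (1 / 2 : ℝ) * ‖z‖⁻¹ := by gcongr
    _ = δ ^ (1 / 2 : ℝ) * ‖z‖ ^ (-(3 / 2) : ℝ) := by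
      rw [Real.div_rpow hδ.le hr.le, div_eq_mul_inv, mul_assoc, ← Real.rpow_neg hr.le,
        ← Real.rpow_neg_one ‖z‖, ← Real.rpow_add hr]
      norm_num

end LQG

end

/-! ### Newtonian potentials in the plane: uniform bounds, limit δ → 0, differentiability. -/

noncomputable section

namespace LQG

/-! ## Logarithmic potentials of bounded densities -/

/-- A bounded, compactly supported and almost everywhere continuous density. -/
structure IsNiceDensity (m : ℂ → ℝ) (B R : ℝ) : Prop where
  meas : Measurable m
  bound : ∀ z, |m z| ≤ B
  supp : ∀ z, R < ‖z‖ → m z = 0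
  cont : ∀ᵐ z, ContinuousAt m z
  R_pos : 0 < R

variable {m : ℂ → ℝ} {B R : ℝ}

lemma IsNiceDensity.integrable_mul_continuous (hm : IsNiceDensity m B R) {k : ℂ → ℝ}
    (hk : Continuous k) : Integrable fun w => m w * k w := by
  have h1 : IntegrableOn m (Metric.closedBall 0 R) := by
    refine Measure.integrableOn_of_bounded (M := B) ?_ hm.meas.aestronglyMeasurable
      (ae_of_all _ hm.bound)
    exact (isCompact_closedBall 0 R).measure_lt_top.ne
  have h2 : IntegrableOn (fun w => m w * k w) (Metric.closedBall 0 R) :=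
    h1.mul_continuousOn hk.continuousOn (isCompact_closedBall 0 R)
  refine (integrableOn_iff_integrable_of_support_subset ?_).1 h2
  intro w hw
  simp only [Metric.mem_closedBall, dist_zero_right]
  by_contra! h
  exact hw (by simp [hm.supp w h])

lemma IsNiceDensity.integrable (hm : IsNiceDensity m B R) : Integrable m := by
  simpa using hm.integrable_mul_continuous (k := fun _ => 1) continuous_const

/-- In polar coordinates the integrand becomes r · r^(-3/2) = r^(-1/2), which is integrable at 0. -/
lemma integrable_singular :
    Integrable fun w : ℂ => (Set.Iio (1 : ℝ)).indicator (fun r => r ^ (-(3 / 2) : ℝ)) ‖w‖ := by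
  rw [integrable_fun_norm_addHaar volume
    (f := (Set.Iio (1 : ℝ)).indicator fun r => r ^ (-(3 / 2) : ℝ))]
  have h1 : IntegrableOn (fun r : ℝ => r ^ (-(1 / 2) : ℝ)) (Set.Ioo 0 1) :=
    (intervalIntegral.integrableOn_Ioo_rpow_iff one_pos).2 (by norm_num)
  have h2 : Integrable ((Set.Ioo (0 : ℝ) 1).indicator fun r => r ^ (-(1 / 2) : ℝ)) :=
    h1.integrable_indicator measurableSet_Ioo
  refine h2.integrableOn.congr_fun (fun r hr => ?_) measurableSet_Ioi
  have hr : 0 < r := hr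
  rcases lt_or_ge r 1 with h | h
  · rw [Set.indicator_of_mem (show r ∈ Set.Ioo (0 : ℝ) 1 from ⟨hr, h⟩)]
    simp only [Set.indicator_of_mem (show r ∈ Set.Iio (1 : ℝ) from h), Complex.finrank_real_complex,
      smul_eq_mul]
    norm_num
    rw [← Real.rpow_one_add' hr.le (by norm_num)]
    norm_num
  · rw [Set.indicator_of_notMem (by simp [h]), Set.indicator_of_notMem (by simpa using h)]
    simp

/-- Within distance 1 of z the density is at most B and the integral of the truncated kernel is
translation invariant; farther away the kernel is at most 1. Hence the bound is uniform in z. -/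
lemma IsNiceDensity.exists_singular_bound (hm : IsNiceDensity m B R) :
    ∃ C : ℝ, 0 ≤ C ∧ ∀ z, Integrable (fun w => |m w| * ‖z - w‖ ^ (-(3 / 2) : ℝ)) ∧
      ∫ w, |m w| * ‖z - w‖ ^ (-(3 / 2) : ℝ) ≤ C := by
  set k : ℂ → ℝ := fun w => (Set.Iio (1 : ℝ)).indicator (fun r => r ^ (-(3 / 2) : ℝ)) ‖w‖
  have hk : Integrable k := integrable_singular
  have hbound : ∀ z w, |m w| * ‖z - w‖ ^ (-(3 / 2) : ℝ) ≤ B * k (z - w) + |m w| := by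
    intro z w
    rcases lt_or_ge ‖z - w‖ 1 with h | h
    · simp only [k, Set.indicator_of_mem (show ‖z - w‖ ∈ Set.Iio (1 : ℝ) from h)]
      have h1 := hm.bound w
      have h2 : 0 ≤ ‖z - w‖ ^ (-(3 / 2) : ℝ) := by positivity
      nlinarith [abs_nonneg (m w)]
    · simp only [k, Set.indicator_of_notMem (show ‖z - w‖ ∉ Set.Iio (1 : ℝ) by simpa using h)]
      have : ‖z - w‖ ^ (-(3 / 2) : ℝ) ≤ 1 := Real.rpow_le_one_of_one_le_of_nonpos h (by norm_num)
      nlinarith [abs_nonneg (m w)]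
  have hi : ∀ z, Integrable fun w => B * k (z - w) + |m w| := fun z =>
    ((hk.comp_sub_left z).const_mul B).add hm.integrable.abs
  have hi' : ∀ z, Integrable (fun w => |m w| * ‖z - w‖ ^ (-(3 / 2) : ℝ)) := fun z => by
    refine (hi z).mono' ?_ (ae_of_all _ fun w => ?_)
    · exact (hm.meas.abs.mul (by fun_prop)).aestronglyMeasurable
    · rw [Real.norm_of_nonneg (by positivity)]
      exact hbound z w
  refine ⟨max 0 (B * (∫ w, k w) + ∫ w, |m w|), le_max_left _ _, fun z => ⟨hi' z, ?_⟩⟩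
  refine (integral_mono (hi' z) (hi z) (hbound z)).trans ?_
  rw [integral_add ((hk.comp_sub_left z).const_mul B) hm.integrable.abs, integral_const_mul,
    integral_sub_left_eq_self k volume z]
  exact le_max_right _ _

lemma inv_le_one_add_rpow (r : ℝ) (hr : 0 ≤ r) : r⁻¹ ≤ 1 + r ^ (-(3 / 2) : ℝ) := by
  rcases hr.eq_or_lt with rfl | hr
  · simp
  have h0 : 0 ≤ r ^ (-(3 / 2) : ℝ) := by positivity
  rcases le_total 1 r with h | h
  · linarith [inv_le_one_of_one_le₀ h]
  · rw [← Real.rpow_neg_one]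
    linarith [Real.rpow_le_rpow_of_exponent_ge hr h (show (-(3 / 2) : ℝ) ≤ -1 by norm_num)]

lemma IsNiceDensity.exists_inv_bound (hm : IsNiceDensity m B R) :
    ∃ C : ℝ, 0 ≤ C ∧ ∀ z, Integrable (fun w => |m w| * ‖z - w‖⁻¹) ∧
      ∫ w, |m w| * ‖z - w‖⁻¹ ≤ C := by
  obtain ⟨C, hC, h⟩ := hm.exists_singular_bound
  have hi : ∀ z, Integrable fun w => |m w| + |m w| * ‖z - w‖ ^ (-(3 / 2) : ℝ) := fun z =>
    hm.integrable.abs.add (h z).1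
  have hb : ∀ z w, |m w| * ‖z - w‖⁻¹ ≤ |m w| + |m w| * ‖z - w‖ ^ (-(3 / 2) : ℝ) := fun z w => by
    have := inv_le_one_add_rpow ‖z - w‖ (norm_nonneg _)
    nlinarith [abs_nonneg (m w)]
  have hi' : ∀ z, Integrable (fun w => |m w| * ‖z - w‖⁻¹) := fun z => by
    refine (hi z).mono' ?_ (ae_of_all _ fun w => ?_)
    · exact (hm.meas.abs.mul (by fun_prop)).aestronglyMeasurable
    · rw [Real.norm_of_nonneg (by positivity)]
      exact hb z w
  refine ⟨(∫ w, |m w|) + C, by positivity, fun z => ⟨hi' z, ?_⟩⟩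
  refine (integral_mono (hi' z) (hi z) (hb z)).trans ?_
  rw [integral_add hm.integrable.abs (h z).1]
  linarith [(h z).2]

/-- The field `∫ K_δ(z - w) m(w) dw` for the regularized kernel `K_δ`. -/
def potField (δ : ℝ) (m : ℂ → ℝ) (z : ℂ) : ℂ := ∫ w, m w • kernelField δ (z - w)

/-- The regularized logarithmic potential of `m`. -/
def logPot (δ : ℝ) (m : ℂ → ℝ) (z : ℂ) : ℝ :=
  ∫ w, m w * (1 / 2 * Real.log (‖z - w‖ ^ 2 + δ ^ 2))

lemma IsNiceDensity.integrable_kernel (hm : IsNiceDensity m B R) (δ : ℝ) (z : ℂ) :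
    Integrable fun w => m w • kernelField δ (z - w) := by
  obtain ⟨C, hC, h⟩ := hm.exists_inv_bound
  refine (h z).1.mono' ?_ (ae_of_all _ fun w => ?_)
  · exact (hm.meas.smul ((measurable_kernelField δ).comp
      (measurable_const.sub measurable_id))).aestronglyMeasurable
  · rw [norm_smul, Real.norm_eq_abs]
    gcongr
    exact norm_kernelField_le δ _

lemma IsNiceDensity.exists_potField_bound (hm : IsNiceDensity m B R) :
    ∃ C : ℝ, 0 ≤ C ∧ ∀ δ z, ‖potField δ m z‖ ≤ C := by
  obtain ⟨C, hC, h⟩ := hm.exists_inv_bound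
  refine ⟨C, hC, fun δ z => (norm_integral_le_of_norm_le (h z).1 (ae_of_all _ fun w => ?_)).trans
    (h z).2⟩
  rw [norm_smul, Real.norm_eq_abs]
  gcongr
  exact norm_kernelField_le δ _

/-- The rate δ^(1/2) is uniform in z, which is what allows the limit to be exchanged with
differentiation of the potential. -/
lemma IsNiceDensity.exists_potField_sub_bound (hm : IsNiceDensity m B R) :
    ∃ C : ℝ, 0 ≤ C ∧ ∀ δ, 0 ≤ δ → ∀ z,
      ‖potField δ m z - potField 0 m z‖ ≤ C * δ ^ (1 / 2 : ℝ) := by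
  obtain ⟨C, hC, h⟩ := hm.exists_singular_bound
  refine ⟨C, hC, fun δ hδ z => ?_⟩
  rw [potField, potField, ← integral_sub (hm.integrable_kernel δ z) (hm.integrable_kernel 0 z)]
  refine (norm_integral_le_of_norm_le ((h z).1.mul_const (δ ^ (1 / 2 : ℝ)))
    (ae_of_all _ fun w => ?_)).trans ?_
  · rw [← smul_sub, norm_smul, Real.norm_eq_abs, mul_assoc]
    gcongr
    rw [mul_comm]
    exact norm_kernelField_sub_le hδ _
  · rw [integral_mul_const]
    have := (h z).2
    gcongr

lemma tendsto_sqrt_pos : Filter.Tendsto (fun δ : ℝ => δ ^ (1 / 2 : ℝ)) (𝓝[>] 0) (𝓝 0) := by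
  have : ContinuousAt (fun δ : ℝ => δ ^ (1 / 2 : ℝ)) 0 :=
    Real.continuousAt_rpow_const 0 _ (Or.inr (by norm_num))
  simpa using this.tendsto.mono_left nhdsWithin_le_nhds

lemma IsNiceDensity.tendsto_potField (hm : IsNiceDensity m B R) (z : ℂ) :
    Filter.Tendsto (fun δ => potField δ m z) (𝓝[>] 0) (𝓝 (potField 0 m z)) := by
  obtain ⟨C, hC, h⟩ := hm.exists_potField_sub_bound
  rw [tendsto_iff_norm_sub_tendsto_zero]
  refine squeeze_zero' (Filter.Eventually.of_forall fun _ => norm_nonneg _)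
    (g := fun δ => C * δ ^ (1 / 2 : ℝ)) ?_ (by simpa using tendsto_sqrt_pos.const_mul C)
  filter_upwards [self_mem_nhdsWithin] with δ hδ
  exact h δ (le_of_lt hδ) z

/-- For δ > 0 the kernel field is bounded by δ⁻¹, so one may differentiate under the integral sign.
-/
lemma IsNiceDensity.hasFDerivAt_logPot_pos (hm : IsNiceDensity m B R) {δ : ℝ} (hδ : 0 < δ) (z : ℂ) :
    HasFDerivAt (logPot δ m) (innerSL ℝ (potField δ m z)) z := by
  have hc : ∀ x, Continuous fun w : ℂ => 1 / 2 * Real.log (‖x - w‖ ^ 2 + δ ^ 2) := fun x =>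
    continuous_const.mul (Continuous.log (by fun_prop) fun w => by positivity)
  have hi : ∀ x, Integrable fun w => m w * (1 / 2 * Real.log (‖x - w‖ ^ 2 + δ ^ 2)) := fun x =>
    hm.integrable_mul_continuous (hc x)
  have key := hasFDerivAt_integral_of_dominated_of_fderiv_le (μ := (volume : Measure ℂ)) (𝕜 := ℝ)
    (F := fun x w => m w * (1 / 2 * Real.log (‖x - w‖ ^ 2 + δ ^ 2)))
    (F' := fun x w => innerSL ℝ (m w • kernelField δ (x - w))) (x₀ := z) (s := Set.univ)
    (bound := fun w => |m w| * δ⁻¹) Filter.univ_mem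
    (Filter.Eventually.of_forall fun x => (hi x).aestronglyMeasurable) (hi z)
    ((innerSL ℝ).continuous.comp_aestronglyMeasurable (hm.integrable_kernel δ z).1)
    (ae_of_all _ fun w x _ => by
      rw [innerSL_apply_norm, norm_smul, Real.norm_eq_abs]
      gcongr
      exact norm_kernelField_le_const hδ _)
    (hm.integrable.abs.mul_const _)
    (ae_of_all _ fun w x _ => by
      have h1 := hasGradientAt_half_log (δ := δ) (z := x - w) (by positivity)
      have h2 := (h1.comp x ((hasFDerivAt_id x).sub_const w)).const_mul (m w)
      refine h2.congr_fderiv ?_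
      refine ContinuousLinearMap.ext fun v => ?_
      simp
      ring)
  refine key.congr_fderiv ?_
  exact (innerSL ℝ).integral_comp_comm (hm.integrable_kernel δ z)

lemma abs_log_le_add_inv {r : ℝ} (hr : 0 ≤ r) : |Real.log r| ≤ r + r⁻¹ := by
  rcases hr.eq_or_lt with rfl | hr
  · simp
  rw [abs_le]
  have h1 := Real.log_le_sub_one_of_pos hr
  have h2 := Real.log_le_sub_one_of_pos (inv_pos.2 hr)
  rw [Real.log_inv] at h2
  have := inv_pos.2 hr
  constructor <;> linarith

lemma IsNiceDensity.integrable_log (hm : IsNiceDensity m B R) (z : ℂ) :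
    Integrable fun w => m w * Real.log ‖z - w‖ := by
  obtain ⟨C, hC, h⟩ := hm.exists_inv_bound
  have h1 : Integrable fun w => m w * ‖z - w‖ := hm.integrable_mul_continuous (by fun_prop)
  refine (h1.abs.add (h z).1).mono' ?_ (ae_of_all _ fun w => ?_)
  · exact (hm.meas.mul (by fun_prop)).aestronglyMeasurable
  · simp only [norm_mul, Real.norm_eq_abs, Pi.add_apply, abs_mul, abs_norm]
    rw [← mul_add]
    gcongr
    exact abs_log_le_add_inv (norm_nonneg _)

/-- Compare r² ≤ r² + δ² ≤ (r + δ)² and use log(1 + δ/r) ≤ δ/r. -/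
lemma half_log_sub_log_le {r δ : ℝ} (hr : 0 < r) (hδ : 0 < δ) :
    |1 / 2 * Real.log (r ^ 2 + δ ^ 2) - Real.log r| ≤ δ * r⁻¹ := by
  have e : 1 / 2 * Real.log (r ^ 2) = Real.log r := by
    rw [Real.log_pow]; push_cast; ring
  have h1 : Real.log (r ^ 2) ≤ Real.log (r ^ 2 + δ ^ 2) :=
    Real.log_le_log (by positivity) (by nlinarith [sq_nonneg δ])
  have h2 : Real.log (r ^ 2 + δ ^ 2) ≤ Real.log ((r + δ) ^ 2) :=
    Real.log_le_log (by positivity) (by nlinarith [mul_pos hr hδ])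
  rw [Real.log_pow] at h2
  have h3 : Real.log (r + δ) - Real.log r ≤ δ * r⁻¹ := by
    rw [← Real.log_div (by positivity) hr.ne']
    refine (Real.log_le_sub_one_of_pos (by positivity)).trans (le_of_eq ?_)
    field_simp
    ring
  push_cast at h2
  rw [abs_of_nonneg (by linarith)]
  linarith

lemma logPot_zero (m : ℂ → ℝ) (z : ℂ) : logPot 0 m z = ∫ w, m w * Real.log ‖z - w‖ := by
  rw [logPot]
  congr 1 with w
  simp [Real.log_pow]

lemma IsNiceDensity.tendsto_logPot (hm : IsNiceDensity m B R) (z : ℂ) :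
    Filter.Tendsto (fun δ => logPot δ m z) (𝓝[>] 0) (𝓝 (logPot 0 m z)) := by
  obtain ⟨C, hC, h⟩ := hm.exists_inv_bound
  rw [tendsto_iff_norm_sub_tendsto_zero]
  have h0 : Filter.Tendsto (fun δ : ℝ => δ * C) (𝓝[>] 0) (𝓝 0) := by
    have : Filter.Tendsto (fun δ : ℝ => δ * C) (𝓝 0) (𝓝 (0 * C)) := (by fun_prop :
      Continuous fun δ : ℝ => δ * C).tendsto 0
    simpa using this.mono_left nhdsWithin_le_nhds
  refine squeeze_zero' (Filter.Eventually.of_forall fun _ => norm_nonneg _) ?_ h0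
  filter_upwards [self_mem_nhdsWithin] with δ hδ
  have hδ : 0 < δ := hδ
  have hc : Continuous fun w : ℂ => 1 / 2 * Real.log (‖z - w‖ ^ 2 + δ ^ 2) :=
    continuous_const.mul (Continuous.log (by fun_prop) fun w => by positivity)
  rw [logPot_zero, logPot, ← integral_sub (hm.integrable_mul_continuous hc) (hm.integrable_log z)]
  refine (norm_integral_le_of_norm_le ((h z).1.const_mul δ) ?_).trans ?_
  · have : ∀ᵐ w : ℂ, w ≠ z := by
      simp [ae_iff]
    filter_upwards [this] with w hw
    rw [← mul_sub, norm_mul, Real.norm_eq_abs, Real.norm_eq_abs]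
    have := half_log_sub_log_le (norm_pos_iff.2 (sub_ne_zero.2 hw.symm)) hδ
    calc |m w| * _ ≤ |m w| * (δ * ‖z - w‖⁻¹) := by gcongr
      _ = _ := by ring
  · rw [integral_const_mul]
    have := (h z).2
    gcongr

/-- The logarithmic potential of a bounded density is differentiable, with the expected gradient. -/
theorem IsNiceDensity.hasFDerivAt_logPot (hm : IsNiceDensity m B R) (z : ℂ) :
    HasFDerivAt (logPot 0 m) (innerSL ℝ (potField 0 m z)) z := by
  obtain ⟨C, hC, h⟩ := hm.exists_potField_sub_bound
  have hlim : Filter.Tendsto (fun n : ℕ => 1 / ((n : ℝ) + 1)) Filter.atTop (𝓝[>] 0) :=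
    tendsto_nhdsWithin_iff.2 ⟨tendsto_one_div_add_atTop_nhds_zero_nat,
      Filter.Eventually.of_forall fun n => by
        have : (0 : ℝ) < 1 / ((n : ℝ) + 1) := by positivity
        exact this⟩
  -- The potentials converge pointwise and their gradients converge uniformly.
  refine hasFDerivAt_of_tendstoUniformly (l := Filter.atTop)
    (f := fun n : ℕ => logPot (1 / ((n : ℝ) + 1)) m)
    (f' := fun n x => innerSL ℝ (potField (1 / ((n : ℝ) + 1)) m x))
    (g' := fun x => innerSL ℝ (potField 0 m x)) ?_
    (fun n x => hm.hasFDerivAt_logPot_pos (by positivity) x)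
    (fun x => (hm.tendsto_logPot x).comp hlim) z
  rw [Metric.tendstoUniformly_iff]
  intro ε hε
  have h1 : Filter.Tendsto (fun n : ℕ => C * (1 / ((n : ℝ) + 1)) ^ (1 / 2 : ℝ)) Filter.atTop
      (𝓝 0) := by
    simpa using (tendsto_sqrt_pos.comp hlim).const_mul C
  filter_upwards [h1.eventually_lt_const hε] with n hn x
  rw [dist_comm, dist_eq_norm, ← map_sub, innerSL_apply_norm]
  exact (h _ (by positivity) x).trans_lt hn

lemma IsNiceDensity.measurable_potField (hm : IsNiceDensity m B R) (δ : ℝ) :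
    Measurable (potField δ m) := by
  refine (StronglyMeasurable.integral_prod_right (f := fun z w => m w • kernelField δ (z - w))
    ?_).measurable
  refine Measurable.stronglyMeasurable ?_
  exact (hm.meas.comp measurable_snd).smul
    ((measurable_kernelField δ).comp (measurable_fst.sub measurable_snd))

end LQG

end

/-! ### Decay of potentials at infinity and the Poisson equation in weak form. -/

noncomputable section

namespace LQG

variable {m : ℂ → ℝ} {B R : ℝ}

/-! ## Behaviour of potentials at infinity -/

/-- The unregularized kernel is conjugate inversion, so the difference of two of its values can be
computed exactly. -/
lemma kernelField_zero_eq (z : ℂ) : kernelField 0 z = (starRingEnd ℂ) z⁻¹ := by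
  rw [Complex.inv_def, map_mul, Complex.conj_conj, Complex.conj_ofReal, kernelField,
    Complex.real_smul, Complex.normSq_eq_norm_sq]
  push_cast
  ring

lemma norm_kernelField_zero_sub {a b : ℂ} (ha : a ≠ 0) (hb : b ≠ 0) :
    ‖kernelField 0 a - kernelField 0 b‖ = ‖a - b‖ / (‖a‖ * ‖b‖) := by
  rw [kernelField_zero_eq, kernelField_zero_eq, ← map_sub, RCLike.norm_conj, inv_sub_inv ha hb,
    norm_div, norm_mul, norm_sub_rev]

lemma IsNiceDensity.norm_sub_ge (hm : IsNiceDensity m B R) {z w : ℂ} (hz : 2 * R ≤ ‖z‖)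
    (hw : m w ≠ 0) : ‖w‖ ≤ R ∧ ‖z‖ / 2 ≤ ‖z - w‖ := by
  have h1 : ‖w‖ ≤ R := by
    by_contra! h
    exact hw (hm.supp w h)
  refine ⟨h1, ?_⟩
  have := norm_sub_norm_le z w
  linarith

/-- Far away the density acts as a point mass at the origin. The error involves |w| / (|z - w| |z|)
with |w| ≤ R and |z - w| ≥ |z|/2 on the support, one order better than the main term. -/
lemma IsNiceDensity.exists_potField_asymp (hm : IsNiceDensity m B R) :
    ∃ C : ℝ, ∀ z, 2 * R ≤ ‖z‖ →
      ‖potField 0 m z - (∫ w, m w) • kernelField 0 z‖ ≤ C / ‖z‖ ^ 2 := by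
  refine ⟨(∫ w, |m w|) * (2 * R), fun z hz => ?_⟩
  have hzpos : 0 < ‖z‖ := by linarith [hm.R_pos]
  rw [potField, ← integral_smul_const, ← integral_sub (hm.integrable_kernel 0 z)
    (hm.integrable.smul_const _)]
  refine (norm_integral_le_of_norm_le (hm.integrable.abs.mul_const (2 * R / ‖z‖ ^ 2))
    (ae_of_all _ fun w => ?_)).trans ?_
  · rw [← smul_sub, norm_smul, Real.norm_eq_abs]
    by_cases hw : m w = 0
    · simp [hw]
    obtain ⟨h1, h2⟩ := hm.norm_sub_ge hz hw
    gcongr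
    have h3 : z - w ≠ 0 := norm_pos_iff.1 (by linarith)
    rw [norm_kernelField_zero_sub h3 (norm_pos_iff.1 hzpos)]
    have : z - w - z = -w := by ring
    rw [this, norm_neg]
    calc ‖w‖ / (‖z - w‖ * ‖z‖) ≤ R / (‖z‖ / 2 * ‖z‖) := by
          have := hm.R_pos
          gcongr
      _ = 2 * R / ‖z‖ ^ 2 := by field_simp
  · rw [integral_mul_const]
    exact le_of_eq (by ring)

lemma abs_log_sub_log_le {a b c : ℝ} (hc : 0 < c) (ha : c ≤ a) (hb : c ≤ b) :
    |Real.log a - Real.log b| ≤ |a - b| / c := by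
  wlog h : b ≤ a generalizing a b
  · rw [abs_sub_comm, abs_sub_comm a]
    exact this hb ha (le_of_not_ge h)
  have hb0 : 0 < b := hc.trans_le hb
  have ha0 : 0 < a := hc.trans_le ha
  rw [abs_of_nonneg (sub_nonneg.2 (Real.log_le_log hb0 h)), abs_of_nonneg (sub_nonneg.2 h),
    ← Real.log_div ha0.ne' hb0.ne']
  refine (Real.log_le_sub_one_of_pos (by positivity)).trans ?_
  have : a / b - 1 = (a - b) / b := by field_simp
  rw [this]
  have : 0 ≤ a - b := sub_nonneg.2 h
  gcongr

lemma IsNiceDensity.exists_logPot_asymp (hm : IsNiceDensity m B R) :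
    ∃ C : ℝ, ∀ z, 2 * R ≤ ‖z‖ → |logPot 0 m z - (∫ w, m w) * Real.log ‖z‖| ≤ C / ‖z‖ := by
  refine ⟨(∫ w, |m w|) * (2 * R), fun z hz => ?_⟩
  have hzpos : 0 < ‖z‖ := by linarith [hm.R_pos]
  rw [logPot_zero, ← integral_mul_const, ← integral_sub (hm.integrable_log z)
    (hm.integrable.mul_const _), ← Real.norm_eq_abs]
  refine (norm_integral_le_of_norm_le (hm.integrable.abs.mul_const (2 * R / ‖z‖))
    (ae_of_all _ fun w => ?_)).trans ?_
  · rw [← mul_sub, norm_mul, Real.norm_eq_abs, Real.norm_eq_abs]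
    by_cases hw : m w = 0
    · simp [hw]
    obtain ⟨h1, h2⟩ := hm.norm_sub_ge hz hw
    gcongr
    refine (abs_log_sub_log_le (half_pos hzpos) h2 (by linarith)).trans ?_
    have h3 : |‖z - w‖ - ‖z‖| ≤ R := by
      refine (abs_norm_sub_norm_le _ _).trans ?_
      have : z - w - z = -w := by ring
      rw [this, norm_neg]
      exact h1
    calc |‖z - w‖ - ‖z‖| / (‖z‖ / 2) ≤ R / (‖z‖ / 2) := by gcongr
      _ = _ := by field_simp
  · rw [integral_mul_const]
    exact le_of_eq (by ring)

/-! ## The weak equation for potentials -/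

/-- This is the total mass 2π of the approximate identity at δ = 1: in polar coordinates the radial
integrand has the primitive -1/(r² + 1). -/
lemma integral_div_one_add_norm_sq :
    Integrable (fun z : ℂ => 2 / (‖z‖ ^ 2 + 1) ^ 2) ∧
      ∫ z : ℂ, 2 / (‖z‖ ^ 2 + 1) ^ 2 = 2 * Real.pi := by
  have hd : ∀ x ∈ Set.Ioi (0 : ℝ), HasDerivAt (fun r : ℝ => -(r ^ 2 + 1)⁻¹)
      (x * (2 / (x ^ 2 + 1) ^ 2)) x := by
    intro x _
    have h1 : HasDerivAt (fun r : ℝ => r ^ 2 + 1) (2 * x) x := by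
      simpa using (hasDerivAt_pow 2 x).add_const 1
    have h0 : x ^ 2 + 1 ≠ 0 := by positivity
    refine ((h1.fun_inv h0).neg).congr_deriv ?_
    field_simp
  have hpos : ∀ x ∈ Set.Ioi (0 : ℝ), 0 ≤ x * (2 / (x ^ 2 + 1) ^ 2) := fun x hx => by
    have : (0 : ℝ) < x := hx
    positivity
  have hcont : ContinuousWithinAt (fun r : ℝ => -(r ^ 2 + 1)⁻¹) (Set.Ici 0) 0 :=
    (ContinuousAt.neg (ContinuousAt.inv₀ (by fun_prop) (by norm_num))).continuousWithinAt
  have hlim : Filter.Tendsto (fun r : ℝ => -(r ^ 2 + 1)⁻¹) Filter.atTop (𝓝 0) := by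
    have h2 : Filter.Tendsto (fun r : ℝ => r ^ 2 + 1) Filter.atTop Filter.atTop :=
      Filter.tendsto_atTop_add_const_right _ _ (Filter.tendsto_pow_atTop (by norm_num))
    simpa using h2.inv_tendsto_atTop.neg
  have h1 := integrableOn_Ioi_deriv_of_nonneg hcont hd hpos hlim
  have h2 := integral_Ioi_of_hasDerivAt_of_nonneg hcont hd hpos hlim
  constructor
  · rw [integrable_fun_norm_addHaar volume (f := fun r => 2 / (r ^ 2 + 1) ^ 2)]
    simpa [Complex.finrank_real_complex] using h1
  · rw [integral_fun_norm_addHaar volume (fun r => 2 / (r ^ 2 + 1) ^ 2)]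
    simp only [Complex.finrank_real_complex, Nat.add_one_sub_one, pow_one, smul_eq_mul, h2]
    simp [Measure.real, NNReal.pi]
    rfl

lemma integral_add_add {a b c : ℂ → ℝ} (ha : Integrable a) (hb : Integrable b)
    (hc : Integrable c) :
    ∫ z, (a z + b z + c z) = (∫ z, a z) + (∫ z, b z) + ∫ z, c z := by
  rw [← integral_add ha hb]
  exact integral_add (ha.add hb) hc

lemma integral_mul_convolution (hm : IsNiceDensity m B R) {a κ : ℂ → ℝ} (ha : Integrable a)
    (hκ : Continuous κ) {c : ℝ} (hc : ∀ z, |κ z| ≤ c) :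
    ∫ w, m w * ∫ z, a z * κ (z - w) = ∫ z, a z * ∫ w, m w * κ (z - w) := by
  have key := integral_integral_swap (μ := (volume : Measure ℂ)) (ν := (volume : Measure ℂ))
    (f := fun w z => m w * (a z * κ (z - w))) (by
      have h1 := ((hm.integrable).mul_prod ha).mul_const c
      refine h1.mono ?_ (ae_of_all _ fun p => ?_)
      · have h2 : AEStronglyMeasurable (fun p : ℂ × ℂ => m p.1 * a p.2 * κ (p.2 - p.1))
            (volume.prod volume) :=
          ((hm.integrable).mul_prod ha).1.mul (by fun_prop)
        refine h2.congr (ae_of_all _ fun p => ?_)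
        simp [Function.uncurry]
        ring
      · have hc0 : |c| = c := abs_of_nonneg ((abs_nonneg _).trans (hc 0))
        simp only [Function.uncurry, norm_mul, Real.norm_eq_abs, hc0]
        rw [mul_assoc]
        have := hc (p.2 - p.1)
        gcongr)
  simp only [integral_const_mul] at key
  rw [key]
  refine integral_congr_ae (ae_of_all _ fun z => ?_)
  simp only
  rw [← integral_const_mul]
  congr 1 with w
  ring

lemma divergence_comp_sub {V : ℂ → ℂ} (w z : ℂ) :
    divergence (fun z => V (z - w)) z = divergence V (z - w) := by
  rw [divergence, divergence, fderiv_comp_sub]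

/-- The regularization `∫ m(w) (div K_δ)(z - w) dw` of the density `2 π m`. -/
def smoothedDensity (δ : ℝ) (m : ℂ → ℝ) (z : ℂ) : ℝ :=
  ∫ w, m w * (2 * δ ^ 2 / (‖z - w‖ ^ 2 + δ ^ 2) ^ 2)

lemma potField_re (hm : IsNiceDensity m B R) (δ : ℝ) (z : ℂ) :
    (potField δ m z).re = ∫ w, m w * (kernelField δ (z - w)).re := by
  have := Complex.reCLM.integral_comp_comm (hm.integrable_kernel δ z)
  simpa [potField] using this.symm

lemma potField_im (hm : IsNiceDensity m B R) (δ : ℝ) (z : ℂ) :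
    (potField δ m z).im = ∫ w, m w * (kernelField δ (z - w)).im := by
  have := Complex.imCLM.integral_comp_comm (hm.integrable_kernel δ z)
  simpa [potField] using this.symm

/-- For each w the field K_δ(z - w) is smooth in z, so `WeakPair.integral_smooth` applies.
Integrating against m(w) dw and exchanging the order of integration, term by term, gives the
identity for the potential. -/
lemma WeakPair.integral_potField_pos {f : ℂ → ℝ} {g : ℂ → ℂ} (h : WeakPair f g) {χ : ℂ → ℝ}
    (hχ : ContDiff ℝ (⊤ : ℕ∞) χ) (hc : HasCompactSupport χ) (hm : IsNiceDensity m B R)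
    {δ : ℝ} (hδ : 0 < δ) :
    ∫ z, χ z * inner ℝ (potField δ m z) (g z) =
      -∫ z, f z * (χ z * smoothedDensity δ m z + fderiv ℝ χ z (potField δ m z)) := by
  have hK := contDiff_kernelField hδ
  have hKc := hK.continuous
  have hre : Continuous fun z => (kernelField δ z).re := Complex.continuous_re.comp hKc
  have him : Continuous fun z => (kernelField δ z).im := Complex.continuous_im.comp hKc
  have bre : ∀ z, |(kernelField δ z).re| ≤ δ⁻¹ := fun z =>
    (Complex.abs_re_le_norm _).trans (norm_kernelField_le_const hδ z)
  have bim : ∀ z, |(kernelField δ z).im| ≤ δ⁻¹ := fun z =>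
    (Complex.abs_im_le_norm _).trans (norm_kernelField_le_const hδ z)
  set D : ℂ → ℝ := fun z => 2 * δ ^ 2 / (‖z‖ ^ 2 + δ ^ 2) ^ 2 with hD
  have hDc : Continuous D := Continuous.div (by fun_prop) (by fun_prop) fun z => by positivity
  have bD : ∀ z, |D z| ≤ 2 * δ ^ 2 / (δ ^ 2) ^ 2 := fun z => by
    rw [abs_of_nonneg (by positivity)]
    simp only [hD]
    gcongr
    nlinarith [sq_nonneg ‖z‖]
  have h1 := integrable_mul_of_hasCompactSupport (locallyIntegrable_re h.locInt_grad)
    hχ.continuous hc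
  have h2 := integrable_mul_of_hasCompactSupport (locallyIntegrable_im h.locInt_grad)
    hχ.continuous hc
  have h3 := integrable_mul_of_hasCompactSupport h.locInt hχ.continuous hc
  have hdc : ∀ v, Continuous fun z => fderiv ℝ χ z v := fun v =>
    (hχ.continuous_fderiv (by simp)).clm_apply continuous_const
  have h4 := integrable_mul_of_hasCompactSupport h.locInt (hdc 1) (hc.fderiv_apply ℝ 1)
  have h5 := integrable_mul_of_hasCompactSupport h.locInt (hdc Complex.I)
    (hc.fderiv_apply ℝ Complex.I)
  have bdd : ∀ {a κ : ℂ → ℝ} {c : ℝ}, Integrable a → Continuous κ → (∀ z, |κ z| ≤ c) → ∀ w,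
      Integrable fun z => a z * κ (z - w) := fun {a κ c} ha hκ hcc w =>
    ha.mul_bdd (c := c) (by fun_prop) (ae_of_all _ fun z => hcc _)
  have bdd' : ∀ {a κ : ℂ → ℝ} {c : ℝ}, Integrable a → Continuous κ → (∀ z, |κ z| ≤ c) →
      Integrable fun w => m w * ∫ z, a z * κ (z - w) := fun {a κ c} ha hκ hcc => by
    refine hm.integrable.mul_bdd (c := ∫ z, |a z| * c) ?_ (ae_of_all _ fun w => ?_)
    · refine (Continuous.aestronglyMeasurable ?_)
      refine continuous_of_dominated (F := fun w z => a z * κ (z - w))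
        (bound := fun z => |a z| * c) (fun w => (bdd ha hκ hcc w).1)
        (fun w => ae_of_all _ fun z => ?_) (ha.abs.mul_const c) (ae_of_all _ fun z => ?_)
      · rw [norm_mul, Real.norm_eq_abs, Real.norm_eq_abs]
        have := hcc (z - w)
        gcongr
      · fun_prop
    · refine norm_integral_le_of_norm_le (ha.abs.mul_const c) (ae_of_all _ fun z => ?_)
      rw [norm_mul, Real.norm_eq_abs, Real.norm_eq_abs]
      have := hcc (z - w)
      gcongr
  have bdd'' : ∀ {a κ : ℂ → ℝ} {c : ℝ}, Integrable a → Continuous κ → (∀ z, |κ z| ≤ c) →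
      Integrable fun z => a z * ∫ w, m w * κ (z - w) := fun {a κ c} ha hκ hcc => by
    refine ha.mul_bdd (c := ∫ w, |m w| * c) ?_ (ae_of_all _ fun z => ?_)
    · refine (Continuous.aestronglyMeasurable ?_)
      refine continuous_of_dominated (F := fun z w => m w * κ (z - w))
        (bound := fun w => |m w| * c) (fun z => (hm.meas.mul (by fun_prop)).aestronglyMeasurable)
        (fun z => ae_of_all _ fun w => ?_) (hm.integrable.abs.mul_const c)
        (ae_of_all _ fun w => ?_)
      · rw [norm_mul, Real.norm_eq_abs, Real.norm_eq_abs]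
        have := hcc (z - w)
        gcongr
      · fun_prop
    · refine norm_integral_le_of_norm_le (hm.integrable.abs.mul_const c) (ae_of_all _ fun w => ?_)
      rw [norm_mul, Real.norm_eq_abs, Real.norm_eq_abs]
      have := hcc (z - w)
      gcongr
  have step : ∀ w, (∫ z, (g z).re * χ z * (kernelField δ (z - w)).re) +
      (∫ z, (g z).im * χ z * (kernelField δ (z - w)).im) =
      -((∫ z, f z * χ z * D (z - w)) + (∫ z, f z * fderiv ℝ χ z 1 * (kernelField δ (z - w)).re) +
        ∫ z, f z * fderiv ℝ χ z Complex.I * (kernelField δ (z - w)).im) := by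
    intro w
    have := h.integral_smooth hχ hc (V := fun z => kernelField δ (z - w))
      (hK.comp (contDiff_id.sub contDiff_const))
    rw [← integral_add (bdd h1 hre bre w) (bdd h2 him bim w),
      ← integral_add_add (bdd h3 hDc bD w) (bdd h4 hre bre w) (bdd h5 him bim w)]
    convert this using 1
    · refine integral_congr_ae (ae_of_all _ fun z => ?_)
      simp only [inner_re_im]
      ring
    · congr 1
      refine integral_congr_ae (ae_of_all _ fun z => ?_)
      simp only [divergence_comp_sub, divergence_kernelField hδ,
        fderiv_apply_re_im (fderiv ℝ χ z) (kernelField δ (z - w)), hD]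
      ring
  have total : (∫ w, m w * ∫ z, (g z).re * χ z * (kernelField δ (z - w)).re) +
      (∫ w, m w * ∫ z, (g z).im * χ z * (kernelField δ (z - w)).im) =
      -((∫ w, m w * ∫ z, f z * χ z * D (z - w)) +
        (∫ w, m w * ∫ z, f z * fderiv ℝ χ z 1 * (kernelField δ (z - w)).re) +
        ∫ w, m w * ∫ z, f z * fderiv ℝ χ z Complex.I * (kernelField δ (z - w)).im) := by
    rw [← integral_add (bdd' h1 hre bre) (bdd' h2 him bim),
      ← integral_add_add (bdd' h3 hDc bD) (bdd' h4 hre bre) (bdd' h5 him bim), ← integral_neg]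
    refine integral_congr_ae (ae_of_all _ fun w => ?_)
    linear_combination (m w) * step w
  rw [integral_mul_convolution hm h1 hre bre, integral_mul_convolution hm h2 him bim,
    integral_mul_convolution hm h3 hDc bD, integral_mul_convolution hm h4 hre bre,
    integral_mul_convolution hm h5 him bim,
    ← integral_add (bdd'' h1 hre bre) (bdd'' h2 him bim),
    ← integral_add_add (bdd'' h3 hDc bD) (bdd'' h4 hre bre) (bdd'' h5 him bim)] at total
  convert total using 1
  · refine integral_congr_ae (ae_of_all _ fun z => ?_)
    simp only [inner_re_im, potField_re hm, potField_im hm]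
    ring
  · congr 1
    refine integral_congr_ae (ae_of_all _ fun z => ?_)
    simp only [fderiv_apply_re_im (fderiv ℝ χ z) (potField δ m z), potField_re hm, potField_im hm,
      smoothedDensity, hD]
    ring

/-- Substitute w = z - δv; the Jacobian δ² absorbs the scale and leaves a kernel independent of δ.
-/
lemma IsNiceDensity.smoothedDensity_eq {δ : ℝ} (hδ : 0 < δ) (z : ℂ) :
    smoothedDensity δ m z = ∫ v, m (z - δ • v) * (2 / (‖v‖ ^ 2 + 1) ^ 2) := by
  have h1 : smoothedDensity δ m z = ∫ w, m (z - w) * (2 * δ ^ 2 / (‖w‖ ^ 2 + δ ^ 2) ^ 2) := by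
    rw [smoothedDensity, ← integral_sub_left_eq_self _ volume z]
    simp
  have h2 := Measure.integral_comp_smul (volume : Measure ℂ)
    (fun w => m (z - w) * (2 * δ ^ 2 / (‖w‖ ^ 2 + δ ^ 2) ^ 2)) δ
  rw [← h1, Complex.finrank_real_complex, abs_of_nonneg (by positivity), smul_eq_mul] at h2
  have h3 : smoothedDensity δ m z = δ ^ 2 * ((δ ^ 2)⁻¹ * smoothedDensity δ m z) := by
    field_simp
  rw [h3, ← h2, ← integral_const_mul]
  congr 1 with v
  rw [norm_smul, Real.norm_of_nonneg hδ.le]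
  field_simp

lemma IsNiceDensity.abs_smoothedDensity_le (hm : IsNiceDensity m B R) {δ : ℝ} (hδ : 0 < δ) (z : ℂ) :
    |smoothedDensity δ m z| ≤ 2 * Real.pi * B := by
  rw [IsNiceDensity.smoothedDensity_eq hδ, ← integral_div_one_add_norm_sq.2, ← integral_mul_const,
    ← Real.norm_eq_abs]
  refine norm_integral_le_of_norm_le (integral_div_one_add_norm_sq.1.mul_const B)
    (ae_of_all _ fun v => ?_)
  rw [norm_mul, Real.norm_eq_abs, Real.norm_of_nonneg (by positivity), mul_comm]
  have := hm.bound (z - δ • v)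
  gcongr

/-- Dominated convergence after rescaling. Continuity at z is all that is needed, which is why
indicator functions with null boundary are admissible densities. -/
lemma IsNiceDensity.tendsto_smoothedDensity (hm : IsNiceDensity m B R) {z : ℂ}
    (hz : ContinuousAt m z) :
    Filter.Tendsto (fun δ => smoothedDensity δ m z) (𝓝[>] 0) (𝓝 (2 * Real.pi * m z)) := by
  have e : 2 * Real.pi * m z = ∫ v : ℂ, m z * (2 / (‖v‖ ^ 2 + 1) ^ 2) := by
    rw [integral_const_mul, integral_div_one_add_norm_sq.2, mul_comm]
  rw [e]
  have h1 : Filter.Tendsto (fun δ : ℝ => ∫ v : ℂ, m (z - δ • v) * (2 / (‖v‖ ^ 2 + 1) ^ 2)) (𝓝[>] 0)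
      (𝓝 (∫ v : ℂ, m z * (2 / (‖v‖ ^ 2 + 1) ^ 2))) := by
    refine tendsto_integral_filter_of_dominated_convergence
      (fun v => B * (2 / (‖v‖ ^ 2 + 1) ^ 2)) (Filter.Eventually.of_forall fun δ => ?_)
      (Filter.Eventually.of_forall fun δ => ae_of_all _ fun v => ?_)
      (integral_div_one_add_norm_sq.1.const_mul B) (ae_of_all _ fun v => ?_)
    · exact ((hm.meas.comp (by fun_prop)).mul (by fun_prop)).aestronglyMeasurable
    · rw [norm_mul, Real.norm_eq_abs, Real.norm_of_nonneg (by positivity)]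
      have := hm.bound (z - δ • v)
      gcongr
    · refine Filter.Tendsto.mul_const _ ?_
      have h2 : Filter.Tendsto (fun δ : ℝ => z - δ • v) (𝓝[>] 0) (𝓝 z) := by
        have : Filter.Tendsto (fun δ : ℝ => z - δ • v) (𝓝 0) (𝓝 (z - (0 : ℝ) • v)) :=
          (by fun_prop : Continuous fun δ : ℝ => z - δ • v).tendsto 0
        rw [zero_smul, sub_zero] at this
        exact this.mono_left nhdsWithin_le_nhds
      exact hz.tendsto.comp h2
  refine h1.congr' ?_
  filter_upwards [self_mem_nhdsWithin] with δ hδ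
  exact (IsNiceDensity.smoothedDensity_eq hδ z).symm

/-- The potential of `m` solves `Δ u = 2 π m` in the weak sense. -/
theorem WeakPair.integral_potField {f : ℂ → ℝ} {g : ℂ → ℂ} (h : WeakPair f g) {χ : ℂ → ℝ}
    (hχ : ContDiff ℝ (⊤ : ℕ∞) χ) (hc : HasCompactSupport χ) (hm : IsNiceDensity m B R) :
    ∫ z, χ z * inner ℝ (potField 0 m z) (g z) =
      -∫ z, f z * (χ z * (2 * Real.pi * m z) + fderiv ℝ χ z (potField 0 m z)) := by
  obtain ⟨C, hC, hb⟩ := hm.exists_potField_bound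
  have hg1 := h.locInt_grad.integrable_smul_left_of_hasCompactSupport hχ.continuous hc
  have hf1 := integrable_mul_of_hasCompactSupport h.locInt hχ.continuous hc
  have hdχ : Continuous fun z => ‖fderiv ℝ χ z‖ := (hχ.continuous_fderiv (by simp)).norm
  have hf2 := integrable_mul_of_hasCompactSupport h.locInt hdχ
    (hc.fderiv ℝ).norm
  have l1 : Filter.Tendsto (fun δ => ∫ z, χ z * inner ℝ (potField δ m z) (g z)) (𝓝[>] 0)
      (𝓝 (∫ z, χ z * inner ℝ (potField 0 m z) (g z))) := by
    refine tendsto_integral_filter_of_dominated_convergence (fun z => C * ‖χ z • g z‖)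
      (Filter.Eventually.of_forall fun δ => ?_)
      (Filter.Eventually.of_forall fun δ => ae_of_all _ fun z => ?_)
      (hg1.norm.const_mul C) (ae_of_all _ fun z => ?_)
    · exact hχ.continuous.aestronglyMeasurable.mul
        ((hm.measurable_potField δ).aestronglyMeasurable.inner h.memLp_grad.1)
    · rw [norm_mul, norm_smul]
      have h1 := norm_inner_le_norm (𝕜 := ℝ) (potField δ m z) (g z)
      have h2 := hb δ z
      calc ‖χ z‖ * ‖inner ℝ (potField δ m z) (g z)‖ ≤ ‖χ z‖ * (C * ‖g z‖) := by
            gcongr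
            exact h1.trans (by gcongr)
        _ = _ := by ring
    · exact ((hm.tendsto_potField z).inner tendsto_const_nhds).const_mul _
  have l2 : Filter.Tendsto (fun δ => ∫ z, f z * (χ z * smoothedDensity δ m z +
      fderiv ℝ χ z (potField δ m z))) (𝓝[>] 0)
      (𝓝 (∫ z, f z * (χ z * (2 * Real.pi * m z) + fderiv ℝ χ z (potField 0 m z)))) := by
    refine tendsto_integral_filter_of_dominated_convergence
      (fun z => |f z * χ z| * (2 * Real.pi * B) + |f z * ‖fderiv ℝ χ z‖| * C)
      (Filter.Eventually.of_forall fun δ => ?_) ?_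
      ((hf1.abs.mul_const _).add (hf2.abs.mul_const _)) ?_
    · refine h.locInt.aestronglyMeasurable.mul (Measurable.aestronglyMeasurable ?_)
      refine (hχ.continuous.measurable.mul ?_).add ?_
      · refine (StronglyMeasurable.integral_prod_right (f := fun z w => m w *
          (2 * δ ^ 2 / (‖z - w‖ ^ 2 + δ ^ 2) ^ 2)) ?_).measurable
        refine Measurable.stronglyMeasurable ?_
        exact (hm.meas.comp measurable_snd).mul (by fun_prop)
      · have e : (fun z => fderiv ℝ χ z (potField δ m z)) = fun z =>
            (potField δ m z).re * fderiv ℝ χ z 1 + (potField δ m z).im * fderiv ℝ χ z Complex.I :=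
          funext fun z => fderiv_apply_re_im _ _
        rw [e]
        have := hm.measurable_potField δ
        have h1 : Measurable fun z => fderiv ℝ χ z 1 := measurable_fderiv_apply_const ℝ χ 1
        have h2 : Measurable fun z => fderiv ℝ χ z Complex.I := measurable_fderiv_apply_const ℝ χ _
        fun_prop
    · filter_upwards [self_mem_nhdsWithin] with δ hδ
      refine ae_of_all _ fun z => ?_
      have h1 := hm.abs_smoothedDensity_le hδ z
      have h2 : |fderiv ℝ χ z (potField δ m z)| ≤ ‖fderiv ℝ χ z‖ * C :=
        ((fderiv ℝ χ z).le_opNorm _).trans (by gcongr; exact hb δ z)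
      rw [Real.norm_eq_abs, abs_mul, abs_mul, abs_mul, abs_norm]
      calc |f z| * |χ z * smoothedDensity δ m z + fderiv ℝ χ z (potField δ m z)|
          ≤ |f z| * (|χ z| * (2 * Real.pi * B) + ‖fderiv ℝ χ z‖ * C) := by
            gcongr
            refine (abs_add_le _ _).trans (add_le_add ?_ h2)
            rw [abs_mul]
            gcongr
        _ = _ := by ring
    · filter_upwards [hm.cont] with z hz
      refine Filter.Tendsto.const_mul _ (((hm.tendsto_smoothedDensity hz).const_mul _).add ?_)
      exact ((fderiv ℝ χ z).continuous.tendsto _).comp (hm.tendsto_potField z)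
  refine tendsto_nhds_unique l1 ((l2.neg).congr' ?_)
  filter_upwards [self_mem_nhdsWithin] with δ hδ
  exact (h.integral_potField_pos hχ hc hm hδ).symm

end LQG

end

/-! ### The area measure of the sphere, and integration by parts up to infinity. -/

noncomputable section

namespace LQG

variable {σ₀ : ℂ → ℝ}

/-! ## The area measure -/

lemma IsSmoothSphereMetric.continuous (hσ : IsSmoothSphereMetric σ₀) : Continuous σ₀ :=
  hσ.1.continuous

lemma integral_vol (hσ : IsSmoothSphereMetric σ₀) (F : ℂ → ℝ) :
    ∫ z, F z ∂(vol σ₀) = ∫ z, Real.exp (2 * σ₀ z) * F z := by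
  have hc := hσ.continuous
  rw [vol, integral_withDensity_eq_integral_toReal_smul (by fun_prop) (by simp)]
  simp [ENNReal.toReal_ofReal (Real.exp_pos _).le]

lemma integrable_vol_iff (hσ : IsSmoothSphereMetric σ₀) (F : ℂ → ℝ) :
    Integrable F (vol σ₀) ↔ Integrable fun z => Real.exp (2 * σ₀ z) * F z := by
  have hc := hσ.continuous
  rw [vol, integrable_withDensity_iff_integrable_smul' (by fun_prop) (by simp)]
  simp [ENNReal.toReal_ofReal (Real.exp_pos _).le]

lemma vol_absolutelyContinuous (σ₀ : ℂ → ℝ) : vol σ₀ ≪ volume :=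
  withDensity_absolutelyContinuous _ _

lemma absolutelyContinuous_vol (hσ : IsSmoothSphereMetric σ₀) : volume ≪ vol σ₀ := by
  have hc := hσ.continuous
  refine withDensity_absolutelyContinuous' (by fun_prop) (ae_of_all _ fun z => ?_)
  simp [Real.exp_pos]

/-- Smoothness at infinity means σ₀(z) + 2 log|z| = τ(1/z), and τ is bounded on the closed unit
disc; σ₀ itself is bounded there too. -/
lemma IsSmoothSphereMetric.exists_log_bound (hσ : IsSmoothSphereMetric σ₀) :
    ∃ A : ℝ, ∀ z, |σ₀ z + 2 * Real.log (1 + ‖z‖)| ≤ A := by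
  obtain ⟨h1, τ, hτ, h2⟩ := hσ
  obtain ⟨A1, hA1⟩ := (isCompact_closedBall (0 : ℂ) 1).exists_bound_of_continuousOn
    (h1.continuous.continuousOn)
  obtain ⟨A2, hA2⟩ := (isCompact_closedBall (0 : ℂ) 1).exists_bound_of_continuousOn
    (hτ.continuous.continuousOn)
  refine ⟨max A1 A2 + 2 * Real.log 2, fun z => ?_⟩
  rcases le_total ‖z‖ 1 with hz | hz
  · have h3 := hA1 z (by simpa using hz)
    have h4 : Real.log (1 + ‖z‖) ≤ Real.log 2 := Real.log_le_log (by positivity) (by linarith)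
    have h5 : 0 ≤ Real.log (1 + ‖z‖) := Real.log_nonneg (by linarith [norm_nonneg z])
    refine (abs_add_le _ _).trans ?_
    rw [abs_of_nonneg (by positivity : 0 ≤ 2 * Real.log (1 + ‖z‖))]
    have := le_max_left A1 A2
    rw [Real.norm_eq_abs] at h3
    linarith
  · have hz0 : 0 < ‖z‖ := by linarith
    have h3 := hA2 z⁻¹ (by simpa using inv_le_one_of_one_le₀ hz)
    have h4 := h2 z⁻¹ (inv_ne_zero (norm_pos_iff.1 hz0))
    rw [inv_inv, norm_inv, Real.log_inv] at h4
    have h5 : Real.log (1 + ‖z‖) ≤ Real.log (2 * ‖z‖) :=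
      Real.log_le_log (by positivity) (by linarith)
    rw [Real.log_mul (by norm_num) hz0.ne'] at h5
    have h6 : Real.log ‖z‖ ≤ Real.log (1 + ‖z‖) := Real.log_le_log hz0 (by linarith)
    have := le_max_right A1 A2
    rw [Real.norm_eq_abs, h4] at h3
    rw [abs_le] at h3 ⊢
    have := Real.log_nonneg (show (1 : ℝ) ≤ 2 by norm_num)
    constructor <;> linarith

/-- The density of the area measure is comparable to `(1 + |z|)⁻⁴`. -/
lemma IsSmoothSphereMetric.exists_density_bounds (hσ : IsSmoothSphereMetric σ₀) :
    ∃ C : ℝ, 0 < C ∧ ∀ z, Real.exp (2 * σ₀ z) ≤ C * ((1 + ‖z‖) ^ 4)⁻¹ ∧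
      ((1 + ‖z‖) ^ 4)⁻¹ ≤ C * Real.exp (2 * σ₀ z) := by
  obtain ⟨A, hA⟩ := hσ.exists_log_bound
  refine ⟨Real.exp (2 * A), Real.exp_pos _, fun z => ?_⟩
  have e : ((1 + ‖z‖) ^ 4)⁻¹ = Real.exp (-(4 * Real.log (1 + ‖z‖))) := by
    rw [Real.exp_neg, ← Real.exp_log (show 0 < (1 + ‖z‖) ^ 4 by positivity), Real.log_pow]
    norm_num
  rw [e, ← Real.exp_add, ← Real.exp_add]
  have := abs_le.1 (hA z)
  constructor <;> apply Real.exp_le_exp.2 <;> linarith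

lemma integrable_one_add_norm_pow : Integrable fun z : ℂ => ((1 + ‖z‖) ^ 4)⁻¹ := by
  have h := integrable_one_add_norm (E := ℂ) (μ := volume) (r := 4)
    (by rw [Complex.finrank_real_complex]; norm_num)
  refine h.congr (ae_of_all _ fun z => ?_)
  simp only
  rw [Real.rpow_neg (by positivity)]
  norm_cast

lemma isFiniteMeasure_vol (hσ : IsSmoothSphereMetric σ₀) : IsFiniteMeasure (vol σ₀) := by
  obtain ⟨C, hC, h⟩ := hσ.exists_density_bounds
  have hc := hσ.continuous
  have : Integrable fun z : ℂ => Real.exp (2 * σ₀ z) := by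
    refine (integrable_one_add_norm_pow.const_mul C).mono' (by fun_prop) (ae_of_all _ fun z => ?_)
    rw [Real.norm_of_nonneg (Real.exp_pos _).le]
    exact (h z).1
  exact isFiniteMeasure_withDensity_ofReal this.2

/-- Square integrability for the area measure in terms of Lebesgue measure. -/
lemma integrable_sq_mul_weight (hσ : IsSmoothSphereMetric σ₀) {f : ℂ → ℝ}
    (hf : MemLp f 2 (vol σ₀)) : Integrable fun z => f z ^ 2 * ((1 + ‖z‖) ^ 4)⁻¹ := by
  obtain ⟨C, hC, h⟩ := hσ.exists_density_bounds
  have h1 := (integrable_vol_iff hσ _).1 hf.integrable_sq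
  have hfm : AEStronglyMeasurable f volume := hf.1.mono_ac (absolutelyContinuous_vol hσ)
  refine (h1.const_mul C).mono' ((hfm.pow 2).mul (by fun_prop)) (ae_of_all _ fun z => ?_)
  rw [Real.norm_of_nonneg (by positivity)]
  have := (h z).2
  have h3 : 0 ≤ f z ^ 2 := sq_nonneg _
  nlinarith

/-- With w = (1 + |z|)⁴, either |f| ≤ w or |f| ≤ f²/w; both bounds are integrable on compact sets.
-/
lemma locallyIntegrable_of_memLp_vol (hσ : IsSmoothSphereMetric σ₀) {f : ℂ → ℝ}
    (hf : MemLp f 2 (vol σ₀)) : LocallyIntegrable f := by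
  have hfm : AEStronglyMeasurable f volume := hf.1.mono_ac (absolutelyContinuous_vol hσ)
  rw [locallyIntegrable_iff]
  intro k hk
  obtain ⟨r, hr⟩ := hk.isBounded.subset_closedBall 0
  have h1 := (integrable_sq_mul_weight hσ hf).integrableOn (s := k)
  have h2 : IntegrableOn (fun _ : ℂ => (1 + |r|) ^ 4) k := integrableOn_const hk.measure_lt_top.ne
  refine (h1.add h2).mono' hfm.restrict ((ae_restrict_mem hk.measurableSet).mono fun z hz => ?_)
  have hzr : ‖z‖ ≤ |r| := (by simpa using hr hz : ‖z‖ ≤ r).trans (le_abs_self r)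
  simp only [Pi.add_apply, Real.norm_eq_abs]
  have hw : (0 : ℝ) < (1 + ‖z‖) ^ 4 := by positivity
  have hle : (1 + ‖z‖) ^ 4 ≤ (1 + |r|) ^ 4 := by gcongr
  refine le_trans ?_ (add_le_add_right hle _)
  rw [← div_eq_mul_inv]
  rcases le_total |f z| ((1 + ‖z‖) ^ 4) with hle' | hle'
  · have : 0 ≤ f z ^ 2 / (1 + ‖z‖) ^ 4 := by positivity
    linarith
  · have : |f z| ≤ f z ^ 2 / (1 + ‖z‖) ^ 4 := by
      rw [le_div_iff₀ hw, ← sq_abs]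
      nlinarith [abs_nonneg (f z)]
    linarith

/-- An element of `H¹₀` together with its gradient is a weak pair. -/
lemma H10.weakPair (hσ : IsSmoothSphereMetric σ₀) (f : H10 σ₀) : WeakPair f.toFun f.grad where
  locInt := locallyIntegrable_of_memLp_vol hσ f.memLp_toFun
  memLp_grad := f.memLp_grad
  weak := f.isWeakGrad

lemma integrable_inner_of_memLp {V g : ℂ → ℂ} (hV : MemLp V 2 (volume : Measure ℂ))
    (hg : MemLp g 2 (volume : Measure ℂ)) : Integrable fun z => inner ℝ (V z) (g z) := by
  refine (hV.norm.integrable_mul hg.norm).mono' (hV.1.inner hg.1) (ae_of_all _ fun z => ?_)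
  exact norm_inner_le_norm _ _

/-! ## Cutoffs at infinity -/

/-- Rescalings of one bump. Their gradients have size 1/n on an annulus of area comparable to n², so
in two dimensions their Dirichlet energy stays bounded but need not tend to zero. -/
lemma exists_cutoff : ∃ (χ : ℕ → ℂ → ℝ) (A : ℝ), 0 ≤ A ∧ ∀ n,
    ContDiff ℝ (⊤ : ℕ∞) (χ n) ∧ HasCompactSupport (χ n) ∧ (∀ z, |χ n z| ≤ 1) ∧
    (∀ z, ‖z‖ ≤ n + 1 → χ n z = 1) ∧
    ∀ z, ‖fderiv ℝ (χ n) z‖ ≤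
      (Metric.closedBall (0 : ℂ) (2 * (n + 1)) \ Metric.ball 0 (n + 1)).indicator
        (fun _ => A / (n + 1)) z := by
  let b : ContDiffBump (0 : ℂ) := ⟨1, 2, one_pos, one_lt_two⟩
  have hb : ContDiff ℝ (⊤ : ℕ∞) b := b.contDiff
  obtain ⟨A, hA⟩ := (b.hasCompactSupport.fderiv ℝ).exists_bound_of_continuous
    (hb.continuous_fderiv (by simp))
  have hA0 : 0 ≤ A := (norm_nonneg _).trans (hA 0)
  refine ⟨fun n z => b (((n : ℝ) + 1)⁻¹ • z), A, hA0, fun n => ?_⟩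
  have hn : (0 : ℝ) < (n : ℝ) + 1 := by positivity
  have hnorm : ∀ z : ℂ, ‖((n : ℝ) + 1)⁻¹ • z‖ = ‖z‖ / (n + 1) := fun z => by
    rw [norm_smul, norm_inv, Real.norm_of_nonneg hn.le]
    ring
  have hder : ∀ z, fderiv ℝ (fun z => b (((n : ℝ) + 1)⁻¹ • z)) z =
      ((n : ℝ) + 1)⁻¹ • fderiv ℝ b (((n : ℝ) + 1)⁻¹ • z) := fun z => fderiv_comp_smul _
  refine ⟨hb.comp (contDiff_const_smul _), ?_, fun z => ?_, fun z hz => ?_, fun z => ?_⟩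
  · exact b.hasCompactSupport.comp_smul (inv_ne_zero hn.ne')
  · rw [abs_of_nonneg b.nonneg]
    exact b.le_one
  · refine b.one_of_mem_closedBall ?_
    simp only [Metric.mem_closedBall, dist_zero_right, hnorm]
    exact (div_le_one hn).2 hz
  · rw [hder]
    by_cases hz : z ∈ Metric.closedBall (0 : ℂ) (2 * (n + 1)) \ Metric.ball 0 (n + 1)
    · rw [Set.indicator_of_mem hz, norm_smul, norm_inv, Real.norm_of_nonneg hn.le, div_eq_inv_mul]
      gcongr
      exact hA _
    · rw [Set.indicator_of_notMem hz]
      suffices fderiv ℝ b (((n : ℝ) + 1)⁻¹ • z) = 0 by rw [this, smul_zero, norm_zero]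
      simp only [Set.mem_sdiff, Metric.mem_closedBall, dist_zero_right, Metric.mem_ball,
        not_and_or, not_not, not_le] at hz
      rcases hz with hz | hz
      · have : ((n : ℝ) + 1)⁻¹ • z ∉ tsupport b := by
          rw [b.tsupport_eq]
          simp only [Metric.mem_closedBall, dist_zero_right, hnorm, not_le]
          change 2 < _
          rw [lt_div_iff₀ hn]
          exact hz
        by_contra h
        exact this (support_fderiv_subset ℝ h)
      · have h1 : (b : ℂ → ℝ) =ᶠ[𝓝 (((n : ℝ) + 1)⁻¹ • z)] fun _ => 1 := by
          refine b.eventuallyEq_one_of_mem_ball ?_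
          simp only [Metric.mem_ball, dist_zero_right, hnorm]
          exact (div_lt_one hn).2 hz
        rw [h1.fderiv_eq]
        simp

/-- Passing to the limit in integrations by parts with cutoffs. -/
theorem WeakPair.integral_of_cutoff (hσ : IsSmoothSphereMetric σ₀) {f : ℂ → ℝ} {g : ℂ → ℂ}
    (h : WeakPair f g) (hf : MemLp f 2 (vol σ₀)) {V : ℂ → ℂ} {D : ℂ → ℝ} {C : ℝ}
    (hVm : Measurable V) (hDm : Measurable D) (hV : ∀ z, ‖V z‖ ≤ C * ((1 + ‖z‖) ^ 2)⁻¹)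
    (hD : ∀ z, |D z| ≤ C * Real.exp (2 * σ₀ z))
    (hcut : ∀ χ : ℂ → ℝ, ContDiff ℝ (⊤ : ℕ∞) χ → HasCompactSupport χ →
      ∫ z, χ z * inner ℝ (V z) (g z) = -∫ z, f z * (χ z * D z + fderiv ℝ χ z (V z))) :
    ∫ z, inner ℝ (V z) (g z) = -∫ z, f z * D z := by
  obtain ⟨χ, A, hA, hχ⟩ := exists_cutoff
  have hfin := isFiniteMeasure_vol hσ
  have hfm : AEStronglyMeasurable f volume := hf.1.mono_ac (absolutelyContinuous_vol hσ)
  have hC : 0 ≤ C := by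
    have := (norm_nonneg _).trans (hV 0)
    simpa using this
  have hV2 : MemLp V 2 volume := by
    rw [memLp_two_iff_integrable_sq_norm hVm.aestronglyMeasurable]
    refine (integrable_one_add_norm_pow.const_mul (C ^ 2)).mono' (by fun_prop)
      (ae_of_all _ fun z => ?_)
    rw [Real.norm_of_nonneg (by positivity)]
    calc ‖V z‖ ^ 2 ≤ (C * ((1 + ‖z‖) ^ 2)⁻¹) ^ 2 := by gcongr; exact hV z
      _ = _ := by rw [mul_pow, inv_pow, ← pow_mul]
  have hi1 : Integrable fun z => inner ℝ (V z) (g z) := integrable_inner_of_memLp hV2 h.memLp_grad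
  have hi2 : Integrable fun z => f z * D z := by
    have h1 := (integrable_vol_iff hσ _).1 (hf.integrable (by norm_num)).abs
    refine (h1.const_mul C).mono' (hfm.mul hDm.aestronglyMeasurable) (ae_of_all _ fun z => ?_)
    rw [norm_mul, Real.norm_eq_abs, Real.norm_eq_abs]
    have := hD z
    nlinarith [abs_nonneg (f z)]
  have hone : ∀ z, ∀ᶠ n : ℕ in Filter.atTop, χ n z = 1 := fun z => by
    obtain ⟨N, hN⟩ := exists_nat_ge ‖z‖
    filter_upwards [Filter.eventually_ge_atTop N] with n hn
    refine (hχ n).2.2.2.1 z ?_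
    have : (N : ℝ) ≤ n := by exact_mod_cast hn
    linarith
  have hχlim : ∀ z, Filter.Tendsto (fun n => χ n z) Filter.atTop (𝓝 1) := fun z =>
    tendsto_const_nhds.congr' ((hone z).mono fun n hn => hn.symm)
  have hχm : ∀ n, Measurable (χ n) := fun n => (hχ n).1.continuous.measurable
  have l1 : Filter.Tendsto (fun n => ∫ z, χ n z * inner ℝ (V z) (g z)) Filter.atTop
      (𝓝 (∫ z, inner ℝ (V z) (g z))) := by
    refine tendsto_integral_of_dominated_convergence (fun z => |inner ℝ (V z) (g z)|)
      (fun n => (hχm n).aestronglyMeasurable.mul hi1.1) hi1.abs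
      (fun n => ae_of_all _ fun z => ?_) (ae_of_all _ fun z => ?_)
    · rw [norm_mul, Real.norm_eq_abs, Real.norm_eq_abs]
      have := (hχ n).2.2.1 z
      nlinarith [abs_nonneg (inner ℝ (V z) (g z))]
    · simpa using (hχlim z).mul_const (inner ℝ (V z) (g z))
  have l2 : Filter.Tendsto (fun n => ∫ z, f z * (χ n z * D z)) Filter.atTop
      (𝓝 (∫ z, f z * D z)) := by
    refine tendsto_integral_of_dominated_convergence (fun z => |f z * D z|)
      (fun n => hfm.mul ((hχm n).mul hDm).aestronglyMeasurable) hi2.abs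
      (fun n => ae_of_all _ fun z => ?_) (ae_of_all _ fun z => ?_)
    · have := (hχ n).2.2.1 z
      have e : f z * (χ n z * D z) = χ n z * (f z * D z) := by ring
      rw [e, norm_mul, Real.norm_eq_abs, Real.norm_eq_abs]
      nlinarith [abs_nonneg (f z * D z)]
    · simpa using ((hχlim z).mul_const (D z)).const_mul (f z)
  -- The function f / (1 + |z|)² is square integrable, so the integral of its square q outside large
  -- balls tends to 0. This makes the cutoff error vanish although the energy of the cutoffs does
  -- not.
  set q : ℂ → ℝ := fun z => f z ^ 2 * ((1 + ‖z‖) ^ 4)⁻¹ with hq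
  have hqi : Integrable q := integrable_sq_mul_weight hσ hf
  have hq0 : ∀ z, 0 ≤ q z := fun z => by positivity
  set s : ℕ → ℝ := fun n => ∫ z, (Metric.ball (0 : ℂ) (n + 1))ᶜ.indicator q z with hs
  have hslim : Filter.Tendsto s Filter.atTop (𝓝 0) := by
    have := tendsto_integral_of_dominated_convergence (μ := (volume : Measure ℂ))
      (F := fun n : ℕ => (Metric.ball (0 : ℂ) (n + 1))ᶜ.indicator q) (f := fun _ => 0) q
      (fun n => hqi.1.indicator Metric.isOpen_ball.measurableSet.compl) hqi
      (fun n => ae_of_all _ fun z => by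
        rw [Real.norm_of_nonneg (Set.indicator_nonneg (fun z _ => hq0 z) z)]
        exact Set.indicator_le_self' (fun _ _ => hq0 _) _)
      (ae_of_all _ fun z => by
        refine tendsto_const_nhds.congr' ?_
        obtain ⟨N, hN⟩ := exists_nat_ge ‖z‖
        filter_upwards [Filter.eventually_ge_atTop N] with n hn
        have : (N : ℝ) ≤ n := by exact_mod_cast hn
        rw [Set.indicator_of_notMem]
        simp only [Set.mem_compl_iff, Metric.mem_ball, dist_zero_right, not_not]
        linarith)
    simpa using this
  have hdm : ∀ n, Measurable fun z => fderiv ℝ (χ n) z (V z) := fun n => by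
    have e : (fun z => fderiv ℝ (χ n) z (V z)) = fun z =>
        (V z).re * fderiv ℝ (χ n) z 1 + (V z).im * fderiv ℝ (χ n) z Complex.I :=
      funext fun z => fderiv_apply_re_im _ _
    rw [e]
    have h1 : Measurable fun z => fderiv ℝ (χ n) z 1 := measurable_fderiv_apply_const ℝ _ 1
    have h2 : Measurable fun z => fderiv ℝ (χ n) z Complex.I := measurable_fderiv_apply_const ℝ _ _
    fun_prop
  -- Weighted arithmetic–geometric inequality between f / (1 + |z|)² and the gradient of the cutoff.
  -- The small tail is multiplied by t and the merely bounded energy by t⁻¹.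
  have hbound : ∀ (n : ℕ) (t : ℝ), 0 < t → ∀ z, |f z * fderiv ℝ (χ n) z (V z)| ≤
      t * (Metric.ball (0 : ℂ) (n + 1))ᶜ.indicator q z + t⁻¹ *
        (Metric.closedBall (0 : ℂ) (2 * (n + 1))).indicator
          (fun _ => (A * C) ^ 2 / ((n : ℝ) + 1) ^ 2) z := by
    intro n t ht z
    have hn : (0 : ℝ) < (n : ℝ) + 1 := by positivity
    have h1 := (hχ n).2.2.2.2 z
    have h2 := (fderiv ℝ (χ n) z).le_opNorm (V z)
    by_cases hz : z ∈ Metric.closedBall (0 : ℂ) (2 * (n + 1)) \ Metric.ball 0 (n + 1)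
    · rw [Set.indicator_of_mem hz] at h1
      rw [Set.indicator_of_mem hz.1, Set.indicator_of_mem hz.2, abs_mul]
      have h3 : |fderiv ℝ (χ n) z (V z)| ≤ A / (n + 1) * (C * ((1 + ‖z‖) ^ 2)⁻¹) :=
        h2.trans (mul_le_mul h1 (hV z) (norm_nonneg _) (by positivity))
      set a := A * C / (n + 1)
      set w := ((1 + ‖z‖) ^ 2)⁻¹
      have h4 : |f z| * |fderiv ℝ (χ n) z (V z)| ≤ (|f z| * w) * a := by
        calc _ ≤ |f z| * (A / (n + 1) * (C * w)) := by gcongr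
          _ = _ := by simp only [a]; ring
      have e1 : q z = (|f z| * w) ^ 2 := by
        simp only [hq, w]
        rw [mul_pow, sq_abs, inv_pow, ← pow_mul]
      have e2 : (A * C) ^ 2 / ((n : ℝ) + 1) ^ 2 = a ^ 2 := by
        simp only [a, div_pow]
      rw [e1, e2]
      refine h4.trans ?_
      set x := |f z| * w
      -- A sum of squares equal to twice the slack t x² + t⁻¹ a² - x a.
      have : 0 ≤ t⁻¹ * ((t * x - a) ^ 2 + a ^ 2 + (t * x) ^ 2) := by positivity
      have e3 : t⁻¹ * ((t * x - a) ^ 2 + a ^ 2 + (t * x) ^ 2) =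
          2 * (t * x ^ 2 + t⁻¹ * a ^ 2 - x * a) := by
        field_simp
        ring
      linarith
    · rw [Set.indicator_of_notMem hz] at h1
      have h3 : fderiv ℝ (χ n) z = 0 := norm_le_zero_iff.1 h1
      rw [h3]
      simp only [zero_apply, mul_zero, abs_zero]
      have h5 : 0 ≤ (Metric.ball (0 : ℂ) (n + 1))ᶜ.indicator q z :=
        Set.indicator_nonneg (fun z _ => hq0 z) z
      have h6 : 0 ≤ (Metric.closedBall (0 : ℂ) (2 * (n + 1))).indicator
          (fun _ => (A * C) ^ 2 / ((n : ℝ) + 1) ^ 2) z :=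
        Set.indicator_nonneg (fun _ _ => by positivity) z
      positivity
  have hqn : ∀ n : ℕ, Integrable ((Metric.ball (0 : ℂ) (n + 1))ᶜ.indicator q) := fun n =>
    hqi.indicator Metric.isOpen_ball.measurableSet.compl
  have hcn : ∀ n : ℕ, Integrable ((Metric.closedBall (0 : ℂ) (2 * (n + 1))).indicator
          (fun _ => (A * C) ^ 2 / ((n : ℝ) + 1) ^ 2)) := fun n =>
    (integrableOn_const (isCompact_closedBall _ _).measure_lt_top.ne).integrable_indicator
      Metric.isClosed_closedBall.measurableSet
  have hi3 : ∀ n, Integrable fun z => f z * fderiv ℝ (χ n) z (V z) := fun n =>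
    (((hqn n).const_mul 1).add ((hcn n).const_mul 1⁻¹)).mono'
      (hfm.mul (hdm n).aestronglyMeasurable) (ae_of_all _ (hbound n 1 one_pos))
  -- The disc of radius 2(n+1) has area 4π(n+1)², which cancels the square of the factor 1/(n+1)
  -- from the gradient: K is independent of n.
  set K := (A * C) ^ 2 * (4 * Real.pi)
  have hI : ∀ (n : ℕ) (t : ℝ), 0 < t →
      ‖∫ z, f z * fderiv ℝ (χ n) z (V z)‖ ≤ t * s n + t⁻¹ * K := by
    intro n t ht
    refine (norm_integral_le_of_norm_le (((hqn n).const_mul t).add ((hcn n).const_mul t⁻¹))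
      (ae_of_all _ (hbound n t ht))).trans ?_
    have e := integral_add ((hqn n).const_mul t) ((hcn n).const_mul t⁻¹)
    have e4 : ∫ z, (Metric.closedBall (0 : ℂ) (2 * (n + 1))).indicator
          (fun _ => (A * C) ^ 2 / ((n : ℝ) + 1) ^ 2) z = K := by
      rw [integral_indicator Metric.isClosed_closedBall.measurableSet, setIntegral_const,
        Measure.real, Complex.volume_closedBall, ENNReal.toReal_mul, ENNReal.toReal_pow,
        ENNReal.toReal_ofReal (by positivity)]
      have : ((NNReal.pi : ℝ≥0∞)).toReal = Real.pi := rfl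
      rw [this, smul_eq_mul]
      have hn : (0 : ℝ) < (n : ℝ) + 1 := by positivity
      simp only [K]
      field_simp
      ring
    rw [integral_const_mul, integral_const_mul, e4] at e
    exact e.le
  have hK : 0 ≤ K := by positivity
  have l3 : Filter.Tendsto (fun n => ∫ z, f z * fderiv ℝ (χ n) z (V z)) Filter.atTop (𝓝 0) := by
    rw [Metric.tendsto_atTop']
    intro ε hε
    -- Large enough that t⁻¹ K ≤ ε/2; only then is n taken large, to make t times the tail small.
    set t := 2 * (K + 1) / ε
    have ht : 0 < t := by positivity
    have h1 : Filter.Tendsto (fun n => t * s n) Filter.atTop (𝓝 0) := by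
      simpa using hslim.const_mul t
    obtain ⟨N, hN⟩ := Filter.eventually_atTop.1 (h1.eventually_lt_const (half_pos hε))
    refine ⟨N, fun n hn => ?_⟩
    rw [dist_zero_right]
    refine (hI n t ht).trans_lt ?_
    have h2 := hN n hn.le
    have h3 : t⁻¹ * K ≤ ε / 2 := by
      simp only [t]
      rw [inv_div, div_mul_eq_mul_div, div_le_div_iff₀ (by positivity) (by norm_num)]
      nlinarith
    linarith
  have l4 : Filter.Tendsto (fun n => -∫ z, f z * (χ n z * D z + fderiv ℝ (χ n) z (V z)))
      Filter.atTop (𝓝 (-∫ z, f z * D z)) := by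
    have := (l2.add l3).neg
    rw [add_zero] at this
    refine this.congr fun n => ?_
    have hi4 : Integrable fun z => f z * (χ n z * D z) := by
      refine (hi2.bdd_mul (c := 1) (hχm n).aestronglyMeasurable
        (ae_of_all _ fun z => (hχ n).2.2.1 z)).congr (ae_of_all _ fun z => ?_)
      simp only
      ring
    rw [← integral_add hi4 (hi3 n)]
    simp only [mul_add]
  refine tendsto_nhds_unique l1 (l4.congr fun n => ?_)
  exact (hcut (χ n) (hχ n).1 (hχ n).2.1).symm

end LQG

end

/-! ### Asymptotics of the conformal factor and Gauss–Bonnet. -/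

noncomputable section

namespace LQG

variable {σ₀ : ℂ → ℝ}

/-! ## The background metric at infinity -/

lemma exists_decay_bound {F : ℂ → ℝ} (n : ℕ) {r A B : ℝ} (hr : 0 < r)
    (h1 : ∀ z, ‖z‖ ≤ r → F z ≤ B) (h2 : ∀ z, r ≤ ‖z‖ → F z ≤ A / ‖z‖ ^ n) :
    ∃ C : ℝ, 0 ≤ C ∧ ∀ z, F z ≤ C * ((1 + ‖z‖) ^ n)⁻¹ := by
  refine ⟨|B| * (1 + r) ^ n + |A| * ((1 + r) / r) ^ n, by positivity, fun z => ?_⟩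
  rw [add_mul]
  rcases le_total ‖z‖ r with hz | hz
  · have h3 : |B| ≤ |B| * (1 + r) ^ n * ((1 + ‖z‖) ^ n)⁻¹ := by
      rw [← div_eq_mul_inv, le_div_iff₀ (by positivity)]
      gcongr
    have : 0 ≤ |A| * ((1 + r) / r) ^ n * ((1 + ‖z‖) ^ n)⁻¹ := by positivity
    linarith [h1 z hz, le_abs_self B]
  · have hz0 : 0 < ‖z‖ := hr.trans_le hz
    have h3 : |A| / ‖z‖ ^ n ≤ |A| * ((1 + r) / r) ^ n * ((1 + ‖z‖) ^ n)⁻¹ := by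
      rw [mul_assoc, div_eq_mul_inv, ← inv_pow, ← inv_pow, ← mul_pow]
      gcongr
      rw [inv_eq_one_div, ← div_eq_mul_inv, div_div, div_le_div_iff₀ hz0 (by positivity)]
      nlinarith
    have h4 : A / ‖z‖ ^ n ≤ |A| / ‖z‖ ^ n := by gcongr; exact le_abs_self A
    have : 0 ≤ |B| * (1 + r) ^ n * ((1 + ‖z‖) ^ n)⁻¹ := by positivity
    linarith [h2 z hz]

lemma hasFDerivAt_inv_complex {z : ℂ} (hz : z ≠ 0) :
    HasFDerivAt (fun w : ℂ => w⁻¹)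
      ((ContinuousLinearMap.mul ℝ ℂ) (-(z ^ 2)⁻¹)) z := by
  have h := (hasDerivAt_inv hz).hasFDerivAt.restrictScalars ℝ
  refine h.congr_fderiv ?_
  refine ContinuousLinearMap.ext fun v => ?_
  simp [mul_comm]

lemma hasFDerivAt_log_norm {z : ℂ} (hz : z ≠ 0) :
    HasFDerivAt (fun w : ℂ => Real.log ‖w‖) (innerSL ℝ (kernelField 0 z)) z := by
  have h := hasGradientAt_half_log (δ := 0) (z := z) (by simpa using hz)
  refine h.congr_of_eventuallyEq (Filter.Eventually.of_forall fun w => ?_)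
  simp [Real.log_pow]

/-- Differentiate σ₀(z) = τ(1/z) - 2 log|z|: the derivative of the inversion has norm |z|⁻², and the
logarithm contributes -2 times the kernel field. -/
lemma IsSmoothSphereMetric.exists_gradient_asymp (hσ : IsSmoothSphereMetric σ₀) :
    ∃ A : ℝ, ∀ z, 1 ≤ ‖z‖ →
      ‖gradient σ₀ z + (2 : ℝ) • kernelField 0 z‖ ≤ A / ‖z‖ ^ 2 := by
  obtain ⟨h1, τ, hτ, h2⟩ := hσ
  obtain ⟨A, hA⟩ := (isCompact_closedBall (0 : ℂ) 1).exists_bound_of_continuousOn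
    (hτ.continuous_fderiv (by simp)).continuousOn
  refine ⟨A, fun z hz => ?_⟩
  have hz0 : z ≠ 0 := norm_pos_iff.1 (by linarith)
  have hd : HasFDerivAt σ₀ (fderiv ℝ τ z⁻¹ ∘L (ContinuousLinearMap.mul ℝ ℂ) (-(z ^ 2)⁻¹) -
      (2 : ℝ) • innerSL ℝ (kernelField 0 z)) z := by
    have h3 := (((hτ.differentiable (by simp)) z⁻¹).hasFDerivAt.comp z
      (hasFDerivAt_inv_complex hz0)).sub ((hasFDerivAt_log_norm hz0).const_mul 2)
    refine h3.congr_of_eventuallyEq ?_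
    filter_upwards [isOpen_ne.mem_nhds hz0] with w hw
    have := h2 w⁻¹ (inv_ne_zero hw)
    rw [inv_inv, norm_inv, Real.log_inv] at this
    simp only [Function.comp_apply, Pi.sub_apply, this]
    ring
  rw [← innerSL_apply_norm (𝕜 := ℝ)]
  have hA0 : 0 ≤ A := (norm_nonneg _).trans (hA 0 (by simp))
  refine ContinuousLinearMap.opNorm_le_bound _ (by positivity) fun v => ?_
  have e : innerSL ℝ (gradient σ₀ z + (2 : ℝ) • kernelField 0 z) v =
      fderiv ℝ τ z⁻¹ (-(z ^ 2)⁻¹ * v) := by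
    rw [innerSL_apply_apply, inner_add_left, real_inner_smul_left]
    have h4 : inner ℝ (gradient σ₀ z) v = fderiv ℝ σ₀ z v := by
      rw [gradient, InnerProductSpace.toDual_symm_apply]
    rw [h4, hd.fderiv]
    simp only [sub_apply, smul_apply, ContinuousLinearMap.comp_apply,
      ContinuousLinearMap.mul_apply', innerSL_apply_apply, smul_eq_mul]
    ring
  rw [e]
  refine ((fderiv ℝ τ z⁻¹).le_opNorm _).trans ?_
  have h5 := hA z⁻¹ (by simpa using inv_le_one_of_one_le₀ hz)
  rw [norm_mul, norm_neg, norm_inv, norm_pow]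
  calc ‖fderiv ℝ τ z⁻¹‖ * ((‖z‖ ^ 2)⁻¹ * ‖v‖) ≤ A * ((‖z‖ ^ 2)⁻¹ * ‖v‖) := by gcongr
    _ = _ := by ring

lemma laplacian_eq_fderiv (f : ℂ → ℝ) (z : ℂ) :
    Laplacian.laplacian f z = fderiv ℝ (fderiv ℝ f) z 1 1 +
      fderiv ℝ (fderiv ℝ f) z Complex.I Complex.I := by
  rw [InnerProductSpace.laplacian_eq_iteratedFDeriv_complexPlane]
  simp [iteratedFDeriv_two_apply]

/-- Inversion is holomorphic, so the first-order terms in the second derivative cancel on summing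
over the directions 1 and i. What remains is the second derivative of τ, with the factor |z|⁻²
entering twice. -/
lemma abs_laplacian_comp_inv_le {τ : ℂ → ℝ} (hτ : ContDiff ℝ (⊤ : ℕ∞) τ) {z : ℂ} (hz : z ≠ 0) :
    |Laplacian.laplacian (fun w => τ w⁻¹) z| ≤
      2 * ‖fderiv ℝ (fderiv ℝ τ) z⁻¹‖ / ‖z‖ ^ 4 := by
  have hd : ∀ y : ℂ, y ≠ 0 → fderiv ℝ (fun w => τ w⁻¹) y =
      fderiv ℝ τ y⁻¹ ∘L (ContinuousLinearMap.mul ℝ ℂ) (-(y ^ 2)⁻¹) := fun y hy =>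
    (((hτ.differentiable (by simp)) y⁻¹).hasFDerivAt.comp y (hasFDerivAt_inv_complex hy)).fderiv
  have hτ' : Differentiable ℝ (fderiv ℝ τ) :=
    (hτ.fderiv_right (m := (⊤ : ℕ∞)) (by simp)).differentiable (by simp)
  have h2 : HasFDerivAt (fun y : ℂ => -(y ^ 2)⁻¹)
      ((ContinuousLinearMap.mul ℝ ℂ) (2 * (z ^ 3)⁻¹)) z := by
    have h3 : HasDerivAt (fun y : ℂ => -(y ^ 2)⁻¹) (2 * (z ^ 3)⁻¹) z := by
      refine (((hasDerivAt_pow 2 z).fun_inv (pow_ne_zero 2 hz)).neg).congr_deriv ?_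
      field_simp
      push_cast
      ring
    refine (h3.hasFDerivAt.restrictScalars ℝ).congr_fderiv ?_
    refine ContinuousLinearMap.ext fun v => ?_
    simp [mul_comm]
  have hmain : ∀ v : ℂ, fderiv ℝ (fderiv ℝ (fun w => τ w⁻¹)) z v v =
      fderiv ℝ (fderiv ℝ τ) z⁻¹ (-(z ^ 2)⁻¹ * v) (-(z ^ 2)⁻¹ * v) +
        fderiv ℝ τ z⁻¹ (2 * (z ^ 3)⁻¹ * v * v) := by
    intro v
    have h4 : fderiv ℝ (fun w => τ w⁻¹) =ᶠ[𝓝 z] fun y =>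
        fderiv ℝ τ y⁻¹ ∘L (ContinuousLinearMap.mul ℝ ℂ) (-(y ^ 2)⁻¹) := by
      filter_upwards [isOpen_ne.mem_nhds hz] with y hy using hd y hy
    have h5 := ((hτ' z⁻¹).hasFDerivAt.comp z (hasFDerivAt_inv_complex hz)).clm_comp
      (((ContinuousLinearMap.mul ℝ ℂ).hasFDerivAt).comp z h2)
    rw [h4.fderiv_eq]
    change fderiv ℝ (fun y => (fderiv ℝ τ ∘ fun w => w⁻¹) y ∘L
      ((ContinuousLinearMap.mul ℝ ℂ) ∘ fun y : ℂ => -(y ^ 2)⁻¹) y) z v v = _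
    rw [h5.fderiv]
    simp [ContinuousLinearMap.comp_apply, add_comm]
  set a := -(z ^ 2)⁻¹
  have hsum : Laplacian.laplacian (fun w => τ w⁻¹) z =
      fderiv ℝ (fderiv ℝ τ) z⁻¹ a a +
        fderiv ℝ (fderiv ℝ τ) z⁻¹ (a * Complex.I) (a * Complex.I) := by
    rw [laplacian_eq_fderiv, hmain, hmain]
    -- The first-order term is complex quadratic in the direction, hence changes sign between 1 and
    -- i.
    have : 2 * (z ^ 3)⁻¹ * Complex.I * Complex.I = -(2 * (z ^ 3)⁻¹ * 1 * 1) := by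
      rw [mul_assoc, Complex.I_mul_I]
      ring
    rw [this, map_neg, mul_one]
    ring
  have hn : ∀ b : ℂ, ‖b‖ = (‖z‖ ^ 2)⁻¹ → |fderiv ℝ (fderiv ℝ τ) z⁻¹ b b| ≤
      ‖fderiv ℝ (fderiv ℝ τ) z⁻¹‖ / ‖z‖ ^ 4 := fun b hb => by
    refine ((fderiv ℝ (fderiv ℝ τ) z⁻¹).le_opNorm₂ b b).trans (le_of_eq ?_)
    rw [hb]
    field_simp
  rw [hsum]
  refine (abs_add_le _ _).trans ((add_le_add (hn _ ?_) (hn _ ?_)).trans (le_of_eq (by ring)))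
  · simp [a]
  · simp [a]

/-- Away from 0 the function log|z| is harmonic, so only τ(1/z) contributes to Δσ₀. -/
lemma IsSmoothSphereMetric.exists_laplacian_asymp (hσ : IsSmoothSphereMetric σ₀) :
    ∃ A : ℝ, ∀ z, 1 ≤ ‖z‖ → |Laplacian.laplacian σ₀ z| ≤ A / ‖z‖ ^ 4 := by
  obtain ⟨h1, τ, hτ, h2⟩ := hσ
  obtain ⟨A, hA⟩ := (isCompact_closedBall (0 : ℂ) 1).exists_bound_of_continuousOn
    ((hτ.fderiv_right (m := (⊤ : ℕ∞)) (by simp)).continuous_fderiv (by simp)).continuousOn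
  refine ⟨2 * A, fun z hz => ?_⟩
  have hz0 : z ≠ 0 := norm_pos_iff.1 (by linarith)
  have hlog : InnerProductSpace.HarmonicAt (fun w : ℂ => Real.log ‖w‖) z :=
    AnalyticAt.harmonicAt_log_norm (f := id) analyticAt_id hz0
  have hc1 : ContDiffAt ℝ 2 (fun w => τ w⁻¹) z :=
    ((hτ.of_le (by norm_cast)).contDiffAt).comp z (contDiffAt_inv ℝ hz0)
  have he : σ₀ =ᶠ[𝓝 z] (fun w => τ w⁻¹) + (-2 : ℝ) • fun w => Real.log ‖w‖ := by
    filter_upwards [isOpen_ne.mem_nhds hz0] with w hw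
    have := h2 w⁻¹ (inv_ne_zero hw)
    rw [inv_inv, norm_inv, Real.log_inv] at this
    simp only [Pi.add_apply, Pi.smul_apply, smul_eq_mul, this]
    ring
  have hls : ContDiffAt ℝ 2 ((-2 : ℝ) • fun w : ℂ => Real.log ‖w‖) z := hlog.1.const_smul (-2 : ℝ)
  have hlap : Laplacian.laplacian σ₀ z = Laplacian.laplacian (fun w => τ w⁻¹) z := by
    rw [(InnerProductSpace.laplacian_congr_nhds he).eq_of_nhds,
      ContDiffAt.laplacian_add hc1 hls, InnerProductSpace.laplacian_smul _ hlog.1,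
      hlog.2.eq_of_nhds]
    simp
  rw [hlap]
  refine (abs_laplacian_comp_inv_le hτ hz0).trans ?_
  have := hA z⁻¹ (by simpa using inv_le_one_of_one_le₀ hz)
  gcongr

lemma IsSmoothSphereMetric.continuous_laplacian (hσ : IsSmoothSphereMetric σ₀) :
    Continuous (Laplacian.laplacian σ₀) := by
  have h : Continuous (fderiv ℝ (fderiv ℝ σ₀)) :=
    (hσ.1.fderiv_right (m := (⊤ : ℕ∞)) (by simp)).continuous_fderiv (by simp)
  rw [show Laplacian.laplacian σ₀ = _ from funext (laplacian_eq_fderiv σ₀)]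
  fun_prop

lemma IsSmoothSphereMetric.exists_laplacian_bound (hσ : IsSmoothSphereMetric σ₀) :
    ∃ C : ℝ, 0 ≤ C ∧ ∀ z, |Laplacian.laplacian σ₀ z| ≤ C * ((1 + ‖z‖) ^ 4)⁻¹ := by
  obtain ⟨A, hA⟩ := hσ.exists_laplacian_asymp
  obtain ⟨B, hB⟩ := (isCompact_closedBall (0 : ℂ) 1).exists_bound_of_continuousOn
    hσ.continuous_laplacian.continuousOn
  exact exists_decay_bound 4 one_pos (fun z hz => hB z (by simpa using hz)) hA

lemma contDiff_gradient {f : ℂ → ℝ} (hf : ContDiff ℝ (⊤ : ℕ∞) f) :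
    ContDiff ℝ (⊤ : ℕ∞) (gradient f) := by
  have h : ContDiff ℝ (⊤ : ℕ∞) (fderiv ℝ f) := hf.fderiv_right (by simp)
  exact ((InnerProductSpace.toDual ℝ ℂ).symm.toContinuousLinearEquiv :
    (StrongDual ℝ ℂ) ≃L[ℝ] ℂ).contDiff.comp h

lemma inner_gradient (f : ℂ → ℝ) (z v : ℂ) : inner ℝ (gradient f z) v = fderiv ℝ f z v := by
  rw [gradient, InnerProductSpace.toDual_symm_apply]

lemma divergence_gradient {f : ℂ → ℝ} (hf : ContDiff ℝ (⊤ : ℕ∞) f) (z : ℂ) :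
    divergence (gradient f) z = Laplacian.laplacian f z := by
  have hd : DifferentiableAt ℝ (gradient f) z := (contDiff_gradient hf).differentiable (by simp) z
  have hf' : DifferentiableAt ℝ (fderiv ℝ f) z :=
    (hf.fderiv_right (m := (⊤ : ℕ∞)) (by simp)).differentiable (by simp) z
  have e1 : (fun w => (gradient f w).re) = fun w => fderiv ℝ f w 1 := funext fun w => by
    rw [← inner_gradient, inner_re_im]
    simp
  have e2 : (fun w => (gradient f w).im) = fun w => fderiv ℝ f w Complex.I := funext fun w => by
    rw [← inner_gradient, inner_re_im]
    simp
  rw [divergence, ← fderiv_re hd, ← fderiv_im hd, e1, e2, laplacian_eq_fderiv,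
    fderiv_clm_apply hf' (by fun_prop), fderiv_clm_apply hf' (by fun_prop)]
  simp

lemma exp_mul_gaussCurv (σ₀ : ℂ → ℝ) (z : ℂ) :
    Real.exp (2 * σ₀ z) * gaussCurv σ₀ z = -Laplacian.laplacian σ₀ z := by
  rw [gaussCurv, mul_neg, ← mul_assoc, ← Real.exp_add]
  simp

lemma IsSmoothSphereMetric.continuous_gaussCurv (hσ : IsSmoothSphereMetric σ₀) :
    Continuous (gaussCurv σ₀) := by
  have := hσ.continuous_laplacian
  have := hσ.continuous
  unfold gaussCurv
  fun_prop

lemma IsSmoothSphereMetric.exists_gaussCurv_bound (hσ : IsSmoothSphereMetric σ₀) :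
    ∃ C : ℝ, 0 ≤ C ∧ ∀ z, |gaussCurv σ₀ z| ≤ C := by
  obtain ⟨C, hC, h1⟩ := hσ.exists_laplacian_bound
  obtain ⟨C', hC', h2⟩ := hσ.exists_density_bounds
  refine ⟨C * C', by positivity, fun z => ?_⟩
  have h3 : |Laplacian.laplacian σ₀ z| ≤ C * (C' * Real.exp (2 * σ₀ z)) :=
    (h1 z).trans (by gcongr; exact (h2 z).2)
  have h4 := exp_mul_gaussCurv σ₀ z
  have h5 : Real.exp (2 * σ₀ z) * |gaussCurv σ₀ z| = |Laplacian.laplacian σ₀ z| := by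
    rw [← abs_neg (Laplacian.laplacian σ₀ z), ← h4, abs_mul, abs_of_pos (Real.exp_pos _)]
  have h6 := Real.exp_pos (2 * σ₀ z)
  rw [← h5] at h3
  refine le_of_mul_le_mul_left (h3.trans (le_of_eq ?_)) h6
  ring

/-- The Gauss–Bonnet theorem for the sphere. -/
theorem IsSmoothSphereMetric.integral_gaussCurv (hσ : IsSmoothSphereMetric σ₀) :
    ∫ z, gaussCurv σ₀ z ∂(vol σ₀) = 4 * Real.pi := by
  have hfin := isFiniteMeasure_vol hσ
  obtain ⟨A, hA⟩ := hσ.exists_gradient_asymp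
  obtain ⟨C1, hC1, h1⟩ := hσ.exists_laplacian_bound
  obtain ⟨C2, hC2, h2⟩ := hσ.exists_density_bounds
  -- At infinity ∇σ₀ behaves like -2z/|z|². Adding 2K₁, which is smooth everywhere, cancels this
  -- leading term, so V = O(|z|⁻²) and its divergence Δσ₀ + 4/(1 + |z|²)² integrates to zero. The
  -- second summand has integral 4π.
  set V : ℂ → ℂ := fun z => gradient σ₀ z + (2 : ℝ) • kernelField 1 z with hVdef
  have hVs : ContDiff ℝ (⊤ : ℕ∞) V :=
    (contDiff_gradient hσ.1).add ((contDiff_kernelField one_pos).const_smul (2 : ℝ))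
  set D : ℂ → ℝ := fun z => Laplacian.laplacian σ₀ z + 2 * (2 / (‖z‖ ^ 2 + 1) ^ 2) with hDdef
  have hdiv : ∀ z, divergence V z = D z := fun z => by
    have hd1 : DifferentiableAt ℝ (gradient σ₀) z :=
      (contDiff_gradient hσ.1).differentiable (by simp) z
    have hd2 : DifferentiableAt ℝ (kernelField 1) z :=
      (contDiff_kernelField one_pos).differentiable (by simp) z
    have e1 := divergence_gradient hσ.1 z
    have e2 := divergence_kernelField one_pos z
    rw [divergence] at e1 e2 ⊢
    simp only [hVdef]
    rw [fderiv_fun_add hd1 (hd2.fun_const_smul _), fderiv_fun_const_smul hd2]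
    simp only [add_apply, smul_apply, Complex.add_re, Complex.add_im, Complex.smul_re,
      Complex.smul_im, smul_eq_mul, hDdef]
    norm_num at e2
    linarith
  obtain ⟨B, hB⟩ := (isCompact_closedBall (0 : ℂ) 1).exists_bound_of_continuousOn
    hVs.continuous.continuousOn
  obtain ⟨C3, hC3, h3⟩ := exists_decay_bound (F := fun z => ‖V z‖) (A := A + 2) 2 one_pos
    (fun z hz => hB z (by simpa using hz)) (fun z hz => by
      have hz0 : 0 < ‖z‖ := by linarith
      have e : V z = (gradient σ₀ z + (2 : ℝ) • kernelField 0 z) +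
          (2 : ℝ) • (kernelField 1 z - kernelField 0 z) := by
        simp only [hVdef, smul_sub]
        abel
      have e2 : kernelField 1 z - kernelField 0 z =
          (-(‖z‖ ^ 2 * (‖z‖ ^ 2 + 1))⁻¹) • z := by
        rw [kernelField, kernelField, ← sub_smul]
        congr 1
        field_simp
        ring
      rw [e]
      refine (norm_add_le _ _).trans ?_
      rw [add_div]
      refine add_le_add (hA z hz) ?_
      rw [e2, norm_smul, norm_smul, norm_neg, norm_inv, Real.norm_of_nonneg (by positivity),
        Real.norm_of_nonneg (by positivity), div_eq_mul_inv]
      gcongr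
      rw [mul_inv, mul_assoc]
      refine mul_le_of_le_one_right (by positivity) ?_
      rw [inv_mul_le_iff₀ (by positivity)]
      nlinarith)
  have key := weakPair_one.integral_of_cutoff hσ (V := V) (D := D)
    (C := C3 + (C1 + 4 * 4) * C2) (memLp_const 1)
    hVs.continuous.measurable (hσ.continuous_laplacian.measurable.add (by fun_prop))
    (fun z => (h3 z).trans (by gcongr; exact le_add_of_nonneg_right (by positivity)))
    (fun z => by
      have h4 : |D z| ≤ (C1 + 4 * 4) * ((1 + ‖z‖) ^ 4)⁻¹ := by
        refine (abs_add_le _ _).trans ?_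
        rw [add_mul]
        refine add_le_add (h1 z) ?_
        rw [abs_of_nonneg (by positivity)]
        have h5 : (1 + ‖z‖) ^ 4 ≤ 4 * (‖z‖ ^ 2 + 1) ^ 2 := by
          have h6 : (1 + ‖z‖) ^ 2 ≤ 2 * (‖z‖ ^ 2 + 1) := by nlinarith [sq_nonneg (1 - ‖z‖)]
          calc (1 + ‖z‖) ^ 4 = ((1 + ‖z‖) ^ 2) ^ 2 := by ring
            _ ≤ (2 * (‖z‖ ^ 2 + 1)) ^ 2 := by gcongr
            _ = _ := by ring
        have h7 : (4 * (‖z‖ ^ 2 + 1) ^ 2)⁻¹ ≤ ((1 + ‖z‖) ^ 4)⁻¹ := by gcongr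
        calc 2 * (2 / (‖z‖ ^ 2 + 1) ^ 2) = 4 * 4 * (4 * (‖z‖ ^ 2 + 1) ^ 2)⁻¹ := by
              field_simp; norm_num
          _ ≤ _ := by gcongr
      refine h4.trans ?_
      calc (C1 + 4 * 4) * ((1 + ‖z‖) ^ 4)⁻¹ ≤ (C1 + 4 * 4) * (C2 * Real.exp (2 * σ₀ z)) := by
            gcongr; exact (h2 z).2
        _ ≤ _ := by
          have := mul_nonneg hC3 (Real.exp_pos (2 * σ₀ z)).le
          linarith)
    (fun χ hχ hc => by
      have := weakPair_one.integral_smooth hχ hc hVs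
      simpa only [hdiv] using this)
  have hi : Integrable (Laplacian.laplacian σ₀) :=
    (integrable_one_add_norm_pow.const_mul C1).mono'
      hσ.continuous_laplacian.aestronglyMeasurable (ae_of_all _ h1)
  simp only [inner_zero_right, integral_zero, one_mul, hDdef] at key
  rw [integral_add hi (integral_div_one_add_norm_sq.1.const_mul 2), integral_const_mul,
    integral_div_one_add_norm_sq.2] at key
  rw [integral_vol hσ]
  simp only [exp_mul_gaussCurv, integral_neg]
  linarith

end LQG

end

/-! ### Solving the Poisson equation on the sphere, and uniqueness of the solution. -/

noncomputable section

namespace LQG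

variable {σ₀ : ℂ → ℝ} {φ m : ℂ → ℝ} {B R : ℝ}

/-! ## The inverse Laplacian -/

lemma IsSmoothSphereMetric.tendsto_infty (hσ : IsSmoothSphereMetric σ₀) :
    ∃ l : ℝ, Filter.Tendsto (fun z => σ₀ z + 2 * Real.log ‖z‖) (Bornology.cobounded ℂ) (𝓝 l) := by
  obtain ⟨h1, τ, hτ, h2⟩ := hσ
  refine ⟨τ 0, ?_⟩
  have h3 : Filter.Tendsto (fun z : ℂ => τ z⁻¹) (Bornology.cobounded ℂ) (𝓝 (τ 0)) :=
    (hτ.continuous.tendsto 0).comp Filter.tendsto_inv₀_cobounded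
  refine h3.congr' ?_
  filter_upwards [tendsto_norm_cobounded_atTop.eventually_ge_atTop (1 : ℝ)] with z hz
  have hz0 : z ≠ 0 := norm_pos_iff.1 (by linarith)
  have := h2 z⁻¹ (inv_ne_zero hz0)
  rw [inv_inv, norm_inv, Real.log_inv] at this
  linarith

/-- The weak solution of `Δ_{g₀} u = φ - c K₀`, up to an additive constant. -/
def potential (σ₀ m : ℂ → ℝ) (z : ℂ) : ℝ :=
  (2 * Real.pi)⁻¹ * logPot 0 m z + (∫ w, m w) / (4 * Real.pi) * σ₀ z

/-- The gradient of `potential`. -/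
def potentialGrad (σ₀ m : ℂ → ℝ) (z : ℂ) : ℂ :=
  (2 * Real.pi)⁻¹ • potField 0 m z + ((∫ w, m w) / (4 * Real.pi)) • gradient σ₀ z

lemma hasFDerivAt_potential (hσ : IsSmoothSphereMetric σ₀) (hm : IsNiceDensity m B R) (z : ℂ) :
    HasFDerivAt (potential σ₀ m) (innerSL ℝ (potentialGrad σ₀ m z)) z := by
  have h1 : HasFDerivAt σ₀ (innerSL ℝ (gradient σ₀ z)) z := by
    have h2 := ((hσ.1.differentiable (by simp)) z).hasFDerivAt
    refine h2.congr_fderiv (ContinuousLinearMap.ext fun v => ?_)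
    rw [innerSL_apply_apply, inner_gradient]
  refine (((hm.hasFDerivAt_logPot z).const_mul (2 * Real.pi)⁻¹).add
    (h1.const_mul ((∫ w, m w) / (4 * Real.pi)))).congr_fderiv ?_
  rw [potentialGrad, map_add, map_smul, map_smul]

lemma continuous_potential (hσ : IsSmoothSphereMetric σ₀) (hm : IsNiceDensity m B R) :
    Continuous (potential σ₀ m) :=
  continuous_iff_continuousAt.2 fun z => (hasFDerivAt_potential hσ hm z).continuousAt

/-- With M the integral of m, the growth (M/2π) log|z| of the logarithmic potential cancels against
(M/4π) σ₀(z), which behaves like -(M/2π) log|z| up to a convergent term. Hence the potential extends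
continuously to infinity. -/
lemma tendsto_potential (hσ : IsSmoothSphereMetric σ₀) (hm : IsNiceDensity m B R) :
    ∃ l : ℝ, Filter.Tendsto (potential σ₀ m) (Bornology.cobounded ℂ) (𝓝 l) := by
  obtain ⟨l, hl⟩ := hσ.tendsto_infty
  obtain ⟨C, hC⟩ := hm.exists_logPot_asymp
  have h1 : Filter.Tendsto (fun z => logPot 0 m z - (∫ w, m w) * Real.log ‖z‖)
      (Bornology.cobounded ℂ) (𝓝 0) := by
    refine squeeze_zero_norm' (a := fun z => C / ‖z‖) ?_ ?_
    · filter_upwards [tendsto_norm_cobounded_atTop.eventually_ge_atTop (2 * R)] with z hz using hC z hz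
    · exact tendsto_const_nhds.div_atTop tendsto_norm_cobounded_atTop
  refine ⟨_, ((h1.const_mul (2 * Real.pi)⁻¹).add
    (hl.const_mul ((∫ w, m w) / (4 * Real.pi)))).congr fun z => ?_⟩
  rw [potential]
  field_simp
  ring

lemma measurable_potentialGrad (hσ : IsSmoothSphereMetric σ₀) (hm : IsNiceDensity m B R) :
    Measurable (potentialGrad σ₀ m) :=
  Measurable.add (f := fun z => (2 * Real.pi)⁻¹ • potField 0 m z)
    (g := fun z => ((∫ w, m w) / (4 * Real.pi)) • gradient σ₀ z)
    ((hm.measurable_potField 0).const_smul (2 * Real.pi)⁻¹)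
    ((contDiff_gradient hσ.1).continuous.measurable.const_smul ((∫ w, m w) / (4 * Real.pi)))

/-- The same cancellation at the level of gradients: the terms of order |z|⁻¹ drop out. Decay of
order |z|⁻² is what removing the cutoffs requires. -/
lemma exists_potentialGrad_bound (hσ : IsSmoothSphereMetric σ₀) (hm : IsNiceDensity m B R) :
    ∃ C : ℝ, 0 ≤ C ∧ ∀ z, ‖potentialGrad σ₀ m z‖ ≤ C * ((1 + ‖z‖) ^ 2)⁻¹ := by
  obtain ⟨A, hA⟩ := hσ.exists_gradient_asymp
  obtain ⟨C1, hC1⟩ := hm.exists_potField_asymp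
  obtain ⟨C2, hC2, h2⟩ := hm.exists_potField_bound
  have hR := hm.R_pos
  set r := max 1 (2 * R)
  obtain ⟨C3, h3⟩ := (isCompact_closedBall (0 : ℂ) r).exists_bound_of_continuousOn
    (contDiff_gradient hσ.1).continuous.continuousOn
  set M := ∫ w, m w
  refine exists_decay_bound (B := |(2 * Real.pi)⁻¹| * C2 + |M / (4 * Real.pi)| * C3)
    (A := |(2 * Real.pi)⁻¹| * C1 + |M / (4 * Real.pi)| * A) (r := r) 2
    (lt_max_of_lt_left one_pos) (fun z hz => ?_) (fun z hz => ?_)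
  · refine (norm_add_le _ _).trans (add_le_add ?_ ?_)
    · rw [norm_smul, Real.norm_eq_abs]
      have := h2 0 z
      gcongr
    · rw [norm_smul, Real.norm_eq_abs]
      have := h3 z (by simpa using hz)
      gcongr
  · have hz1 : 1 ≤ ‖z‖ := (le_max_left _ _).trans hz
    have hz2 : 2 * R ≤ ‖z‖ := (le_max_right _ _).trans hz
    have e : potentialGrad σ₀ m z = (2 * Real.pi)⁻¹ • (potField 0 m z - M • kernelField 0 z) +
        (M / (4 * Real.pi)) • (gradient σ₀ z + (2 : ℝ) • kernelField 0 z) := by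
      rw [potentialGrad, smul_sub, smul_add, smul_smul, smul_smul]
      have : (2 * Real.pi)⁻¹ * M = M / (4 * Real.pi) * 2 := by
        field_simp
        ring
      rw [this]
      abel
    rw [e, add_div, mul_div_assoc, mul_div_assoc]
    refine (norm_add_le _ _).trans (add_le_add ?_ ?_)
    · rw [norm_smul, Real.norm_eq_abs]
      have := hC1 z hz2
      gcongr
    · rw [norm_smul, Real.norm_eq_abs]
      have := hA z hz1
      gcongr

/-- The potential as a continuous function on the sphere. -/
lemma exists_potential_continuousMap (hσ : IsSmoothSphereMetric σ₀) (hm : IsNiceDensity m B R) :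
    ∃ k : C(OnePoint ℂ, ℝ), ∀ z : ℂ, k (z : OnePoint ℂ) = potential σ₀ m z := by
  obtain ⟨l, hl⟩ := tendsto_potential hσ hm
  refine ⟨OnePoint.continuousMapMk ⟨potential σ₀ m, continuous_potential hσ hm⟩ l ?_,
    fun z => rfl⟩
  rw [Filter.coclosedCompact_eq_cocompact, ← Metric.cobounded_eq_cocompact]
  exact hl

lemma memLp_two_of_bound {V : ℂ → ℂ} {C : ℝ} (hVm : Measurable V)
    (hV : ∀ z, ‖V z‖ ≤ C * ((1 + ‖z‖) ^ 2)⁻¹) : MemLp V 2 volume := by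
  rw [memLp_two_iff_integrable_sq_norm hVm.aestronglyMeasurable]
  refine (integrable_one_add_norm_pow.const_mul (C ^ 2)).mono' (by fun_prop)
    (ae_of_all _ fun z => ?_)
  rw [Real.norm_of_nonneg (by positivity)]
  calc ‖V z‖ ^ 2 ≤ (C * ((1 + ‖z‖) ^ 2)⁻¹) ^ 2 := by gcongr; exact hV z
    _ = _ := by rw [mul_pow, inv_pow, ← pow_mul]

lemma integrable_of_continuousMap (hσ : IsSmoothSphereMetric σ₀) (k : C(OnePoint ℂ, ℝ)) :
    Integrable (fun z : ℂ => k (z : OnePoint ℂ)) (vol σ₀) := by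
  have := isFiniteMeasure_vol hσ
  refine Integrable.of_bound ?_ ‖k‖ (ae_of_all _ fun z => k.norm_coe_le_norm _)
  exact (k.continuous.comp OnePoint.continuous_coe).aestronglyMeasurable

lemma vol_univ_ne_zero (hσ : IsSmoothSphereMetric σ₀) : (vol σ₀).real Set.univ ≠ 0 := by
  have := isFiniteMeasure_vol hσ
  rw [Measure.real, ENNReal.toReal_ne_zero]
  refine ⟨fun h => ?_, measure_ne_top _ _⟩
  have := absolutelyContinuous_vol hσ h
  simp at this

/-- A differentiable function on the sphere with well-behaved gradient, minus its mean, as an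
element of `H¹₀`. -/
def H10.ofContinuousMap (hσ : IsSmoothSphereMetric σ₀) (k : C(OnePoint ℂ, ℝ)) (V : ℂ → ℂ)
    (hk : ∀ z : ℂ, HasFDerivAt (fun w : ℂ => k (w : OnePoint ℂ)) (innerSL ℝ (V z)) z)
    (hV2 : MemLp V 2 volume) : H10 σ₀ where
  toFun z := k z - (∫ w : ℂ, k (w : OnePoint ℂ) ∂(vol σ₀)) / (vol σ₀).real Set.univ
  grad := V
  memLp_toFun := by
    have := isFiniteMeasure_vol hσ
    have hc : Continuous fun z : ℂ => k (z : OnePoint ℂ) := k.continuous.comp OnePoint.continuous_coe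
    refine MemLp.of_bound (hc.sub continuous_const).aestronglyMeasurable (‖k‖ + ‖(∫ w : ℂ, k (w : OnePoint ℂ) ∂(vol σ₀)) /
      (vol σ₀).real Set.univ‖) (ae_of_all _ fun z => ?_)
    refine (norm_sub_le _ _).trans ?_
    gcongr
    exact k.norm_coe_le_norm _
  memLp_grad := hV2
  isWeakGrad ψ hψ hc v := by
    set a := (∫ w : ℂ, k (w : OnePoint ℂ) ∂(vol σ₀)) / (vol σ₀).real Set.univ
    have hd : ∀ z : ℂ, HasFDerivAt (fun w : ℂ => k (w : OnePoint ℂ) - a) (innerSL ℝ (V z)) z :=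
      fun z => (hk z).sub_const a
    have hcont : Continuous fun w : ℂ => k (w : OnePoint ℂ) - a :=
      continuous_iff_continuousAt.2 fun z => (hd z).continuousAt
    have hVl : LocallyIntegrable fun z => inner ℝ (V z) v := by
      have h1 : LocallyIntegrable V := hV2.locallyIntegrable (by norm_num)
      intro x
      obtain ⟨s, hs, hi⟩ := h1 x
      exact ⟨s, hs, hi.inner_const v⟩
    have hfd : ∀ z, fderiv ℝ (fun w : ℂ => k (w : OnePoint ℂ) - a) z v = inner ℝ (V z) v :=
      fun z => by rw [(hd z).fderiv, innerSL_apply_apply]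
    have := integral_mul_fderiv_eq_neg_fderiv_mul_of_integrable (μ := (volume : Measure ℂ))
      (f := fun w : ℂ => k (w : OnePoint ℂ) - a) (g := ψ) (v := v)
      (by
        simp only [hfd]
        exact integrable_mul_of_hasCompactSupport hVl hψ.continuous hc)
      (integrable_mul_of_hasCompactSupport hcont.locallyIntegrable
        ((hψ.continuous_fderiv (by simp)).clm_apply continuous_const) (hc.fderiv_apply ℝ v))
      (integrable_mul_of_hasCompactSupport hcont.locallyIntegrable hψ.continuous hc)
      (fun x _ => (hd x).differentiableAt) (fun x _ => (hψ.differentiable (by simp)) x)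
    rw [this]
    simp only [hfd, mul_comm]
  mean_zero := by
    have := isFiniteMeasure_vol hσ
    have hne := vol_univ_ne_zero hσ
    rw [integral_sub (integrable_of_continuousMap hσ k) (integrable_const _), integral_const,
      smul_eq_mul]
    field_simp
    simp

/-- By Gauss–Bonnet the multiple of K₀ removed by centering is M/(4π), and e^(2σ₀) K₀ = -Δσ₀ turns
it into the source term of (M/4π) σ₀. -/
lemma IsSmoothSphereMetric.exp_mul_centerFun (hσ : IsSmoothSphereMetric σ₀)
    (hφ : ∀ z, m z = Real.exp (2 * σ₀ z) * φ z) (z : ℂ) :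
    Real.exp (2 * σ₀ z) * centerFun σ₀ φ z =
      m z + (∫ w, m w) / (4 * Real.pi) * Laplacian.laplacian σ₀ z := by
  have h1 : ∫ w, φ w ∂(vol σ₀) = ∫ w, m w := by
    rw [integral_vol hσ]
    simp only [hφ]
  have h2 := exp_mul_gaussCurv σ₀ z
  rw [centerFun, hσ.integral_gaussCurv, h1, hφ z, mul_sub]
  linear_combination (-(∫ w, m w) / (4 * Real.pi)) * h2

lemma exists_abs_le_density (hσ : IsSmoothSphereMetric σ₀) {D : ℂ → ℝ} {C : ℝ} (hC : 0 ≤ C)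
    (h : ∀ z, |D z| ≤ C * ((1 + ‖z‖) ^ 4)⁻¹) :
    ∃ C' : ℝ, 0 ≤ C' ∧ ∀ z, |D z| ≤ C' * Real.exp (2 * σ₀ z) := by
  obtain ⟨C2, hC2, h2⟩ := hσ.exists_density_bounds
  refine ⟨C * C2, by positivity, fun z => (h z).trans ?_⟩
  rw [mul_assoc]
  gcongr
  exact (h2 z).2

/-- The weak equation for the potential. -/
theorem integral_inner_potentialGrad (hσ : IsSmoothSphereMetric σ₀) (hm : IsNiceDensity m B R)
    (hφ : ∀ z, m z = Real.exp (2 * σ₀ z) * φ z) {f : ℂ → ℝ} {g : ℂ → ℂ}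
    (h : WeakPair f g) (hf : MemLp f 2 (vol σ₀)) :
    ∫ z, inner ℝ (potentialGrad σ₀ m z) (g z) = -∫ z, centerFun σ₀ φ z * f z ∂(vol σ₀) := by
  set M := ∫ w, m w
  obtain ⟨C1, hC1, h1⟩ := exists_potentialGrad_bound hσ hm
  obtain ⟨C2, hC2, h2⟩ := hσ.exists_laplacian_bound
  have hR := hm.R_pos
  obtain ⟨C3, hC3, h3⟩ := exists_decay_bound (F := fun z => |m z|) (A := 0) (B := B) 4
    (show 0 < R + 1 by linarith)
    (fun z _ => hm.bound z) (fun z hz => by simp [hm.supp z (by linarith)])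
  have h4 : ∀ z, |m z + M / (4 * Real.pi) * Laplacian.laplacian σ₀ z| ≤
      (C3 + |M / (4 * Real.pi)| * C2) * ((1 + ‖z‖) ^ 4)⁻¹ := fun z => by
    rw [add_mul, mul_assoc]
    refine (abs_add_le _ _).trans (add_le_add (h3 z) ?_)
    rw [abs_mul]
    gcongr
    exact h2 z
  obtain ⟨C4, hC4, h5⟩ := exists_abs_le_density hσ (by positivity) h4
  have key := h.integral_of_cutoff hσ hf (V := potentialGrad σ₀ m)
    (D := fun z => m z + M / (4 * Real.pi) * Laplacian.laplacian σ₀ z) (C := C1 + C4)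
    (measurable_potentialGrad hσ hm)
    (hm.meas.add (hσ.continuous_laplacian.measurable.const_mul _))
    (fun z => (h1 z).trans (by gcongr; linarith))
    (fun z => (h5 z).trans (by gcongr; linarith))
    -- Under a cutoff the two summands of the potential are treated separately: the logarithmic one
    -- by `WeakPair.integral_potField`, the one with σ₀ as a smooth field.
    (fun χ hχ hc => by
      have e1 := h.integral_potField hχ hc hm
      have e2 := h.integral_smooth hχ hc (contDiff_gradient hσ.1)
      simp only [divergence_gradient hσ.1] at e2
      have hgχ := h.locInt_grad.integrable_smul_left_of_hasCompactSupport hχ.continuous hc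
      have hfχ := integrable_mul_of_hasCompactSupport h.locInt hχ.continuous hc
      have hdχ : Continuous fun z => ‖fderiv ℝ χ z‖ := (hχ.continuous_fderiv (by simp)).norm
      have hfdχ := integrable_mul_of_hasCompactSupport h.locInt hdχ (hc.fderiv ℝ).norm
      obtain ⟨C5, hC5, h6⟩ := hm.exists_potField_bound
      have hcG := (contDiff_gradient hσ.1).continuous
      have i1 : Integrable fun z => χ z * inner ℝ (potField 0 m z) (g z) := by
        refine (hgχ.norm.const_mul C5).mono' (hχ.continuous.aestronglyMeasurable.mul
          ((hm.measurable_potField 0).aestronglyMeasurable.inner h.memLp_grad.1))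
          (ae_of_all _ fun z => ?_)
        rw [norm_mul, norm_smul]
        have h7 := norm_inner_le_norm (𝕜 := ℝ) (potField 0 m z) (g z)
        have h8 := h6 0 z
        calc ‖χ z‖ * ‖inner ℝ (potField 0 m z) (g z)‖ ≤ ‖χ z‖ * (C5 * ‖g z‖) := by
              gcongr
              exact h7.trans (by gcongr)
          _ = _ := by ring
      have i2 : Integrable fun z => χ z * inner ℝ (gradient σ₀ z) (g z) := by
        have h7 := integrable_mul_of_hasCompactSupport (locallyIntegrable_re h.locInt_grad)
          (hχ.continuous.mul (Complex.continuous_re.comp hcG))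
          (hc.mul_right (f' := fun z => (gradient σ₀ z).re))
        have h8 := integrable_mul_of_hasCompactSupport (locallyIntegrable_im h.locInt_grad)
          (hχ.continuous.mul (Complex.continuous_im.comp hcG))
          (hc.mul_right (f' := fun z => (gradient σ₀ z).im))
        refine (h7.add h8).congr (ae_of_all _ fun z => ?_)
        simp only [inner_re_im, Pi.add_apply, Function.comp_apply, Pi.mul_apply]
        ring
      have i3 : Integrable fun z => f z * (χ z * (2 * Real.pi * m z) +
          fderiv ℝ χ z (potField 0 m z)) := by
        refine ((hfχ.abs.mul_const (2 * Real.pi * B)).add (hfdχ.abs.mul_const C5)).mono'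
          (h.locInt.aestronglyMeasurable.mul (Measurable.aestronglyMeasurable ?_))
          (ae_of_all _ fun z => ?_)
        · refine (hχ.continuous.measurable.mul (hm.meas.const_mul _)).add ?_
          have e : (fun z => fderiv ℝ χ z (potField 0 m z)) = fun z =>
            (potField 0 m z).re * fderiv ℝ χ z 1 + (potField 0 m z).im * fderiv ℝ χ z Complex.I :=
            funext fun z => fderiv_apply_re_im _ _
          rw [e]
          have := hm.measurable_potField 0
          have h1 : Measurable fun z => fderiv ℝ χ z 1 := measurable_fderiv_apply_const ℝ χ 1
          have h2 : Measurable fun z => fderiv ℝ χ z Complex.I :=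
            measurable_fderiv_apply_const ℝ χ _
          fun_prop
        · have h9 : |fderiv ℝ χ z (potField 0 m z)| ≤ ‖fderiv ℝ χ z‖ * C5 :=
            ((fderiv ℝ χ z).le_opNorm _).trans (by gcongr; exact h6 0 z)
          have h10 : |χ z * (2 * Real.pi * m z)| ≤ |χ z| * (2 * Real.pi * B) := by
            rw [abs_mul, abs_mul, abs_of_pos Real.two_pi_pos]
            gcongr
            exact hm.bound z
          simp only [Pi.add_apply, Real.norm_eq_abs, abs_mul, abs_norm] at h10 ⊢
          calc |f z| * |χ z * (2 * Real.pi * m z) + fderiv ℝ χ z (potField 0 m z)|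
              ≤ |f z| * (|χ z| * (2 * Real.pi * B) + ‖fderiv ℝ χ z‖ * C5) := by
                gcongr
                refine (abs_add_le _ _).trans (add_le_add ?_ h9)
                rw [abs_mul (χ z), abs_mul (2 * Real.pi), abs_mul 2 Real.pi]
                exact h10
            _ = _ := by ring
      have i4 : Integrable fun z => f z * (χ z * Laplacian.laplacian σ₀ z +
          fderiv ℝ χ z (gradient σ₀ z)) := by
        refine integrable_mul_of_hasCompactSupport h.locInt ?_ ?_
        · exact (hχ.continuous.mul hσ.continuous_laplacian).add
            ((hχ.continuous_fderiv (by simp)).clm_apply hcG)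
        · refine (hc.mul_right).add ((hc.fderiv ℝ).mono' ?_)
          refine (Function.support_subset_iff'.2 fun z hz => ?_)
          have : fderiv ℝ χ z = 0 := by
            by_contra h0
            exact hz (subset_tsupport _ h0)
          simp [this]
      have e3 : ∫ z, χ z * inner ℝ (potentialGrad σ₀ m z) (g z) =
          (2 * Real.pi)⁻¹ * (∫ z, χ z * inner ℝ (potField 0 m z) (g z)) +
          M / (4 * Real.pi) * ∫ z, χ z * inner ℝ (gradient σ₀ z) (g z) := by
        rw [← integral_const_mul, ← integral_const_mul,
          ← integral_add (i1.const_mul _) (i2.const_mul _)]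
        refine integral_congr_ae (ae_of_all _ fun z => ?_)
        simp only [potentialGrad, inner_add_left, real_inner_smul_left]
        ring
      rw [e3, e1, e2, mul_neg, mul_neg, ← neg_add, ← integral_const_mul, ← integral_const_mul,
          ← integral_add (i3.const_mul _) (i4.const_mul _)]
      congr 1
      refine integral_congr_ae (ae_of_all _ fun z => ?_)
      simp only [potentialGrad, map_add, map_smul, smul_eq_mul]
      field_simp
      ring)
  rw [key, integral_vol hσ]
  congr 2 with z
  rw [← mul_assoc, hσ.exp_mul_centerFun hφ]
  ring

/-- Existence of the inverse Laplacian, represented by a continuously differentiable function on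
the sphere. -/
theorem exists_isInvLaplacian (hσ : IsSmoothSphereMetric σ₀) (hm : IsNiceDensity m B R)
    (hφ : ∀ z, m z = Real.exp (2 * σ₀ z) * φ z) :
    ∃ (u : H10 σ₀) (k : C(OnePoint ℂ, ℝ)), IsInvLaplacian (centerFun σ₀ φ) u ∧
      (∃ b : ℝ, ∀ z : ℂ, k (z : OnePoint ℂ) = u.toFun z + b) ∧
      (∀ z : ℂ, HasFDerivAt (fun w : ℂ => k (w : OnePoint ℂ)) (innerSL ℝ (u.grad z)) z) ∧
      ∫ z : ℂ, k (z : OnePoint ℂ) * gaussCurv σ₀ z ∂(vol σ₀) = 0 := by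
  have hfin := isFiniteMeasure_vol hσ
  obtain ⟨k, hk⟩ := exists_potential_continuousMap hσ hm
  obtain ⟨C1, hC1, h1⟩ := exists_potentialGrad_bound hσ hm
  have hd : ∀ z : ℂ, HasFDerivAt (fun w : ℂ => k (w : OnePoint ℂ))
      (innerSL ℝ (potentialGrad σ₀ m z)) z := fun z => by
    simpa only [hk] using hasFDerivAt_potential hσ hm z
  set u := H10.ofContinuousMap hσ k _ hd
    (memLp_two_of_bound (measurable_potentialGrad hσ hm) h1)
  -- Since K₀ has total integral 4π, subtracting this constant makes the pairing with K₀ vanish.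
  set b := (∫ z : ℂ, k (z : OnePoint ℂ) * gaussCurv σ₀ z ∂(vol σ₀)) / (4 * Real.pi)
  refine ⟨u, k - ContinuousMap.const _ b, fun f => ?_, ⟨(∫ w : ℂ, k (w : OnePoint ℂ) ∂(vol σ₀)) /
    (vol σ₀).real Set.univ - b, fun z => ?_⟩, fun z => ?_, ?_⟩
  · exact integral_inner_potentialGrad hσ hm hφ (f.weakPair hσ) f.memLp_toFun
  · simp [u, H10.ofContinuousMap]
  · exact (hd z).sub_const b
  · obtain ⟨C, hC, h2⟩ := hσ.exists_gaussCurv_bound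
    have hKi : Integrable (gaussCurv σ₀) (vol σ₀) :=
      Integrable.of_bound hσ.continuous_gaussCurv.aestronglyMeasurable C (ae_of_all _ h2)
    have hkK : Integrable (fun z : ℂ => k (z : OnePoint ℂ) * gaussCurv σ₀ z) (vol σ₀) :=
      (integrable_of_continuousMap hσ k).mul_bdd (c := C)
        hσ.continuous_gaussCurv.aestronglyMeasurable (ae_of_all _ h2)
    simp only [ContinuousMap.sub_apply, ContinuousMap.const_apply, sub_mul]
    rw [integral_sub hkK (hKi.const_mul b), integral_const_mul, hσ.integral_gaussCurv]
    simp only [b]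
    field_simp
    simp

lemma isNiceDensity_of_smooth (hσ : IsSmoothSphereMetric σ₀) {ψ : ℂ → ℝ} (hψ : Continuous ψ)
    (hc : HasCompactSupport ψ) :
    ∃ B R, IsNiceDensity (fun z => Real.exp (2 * σ₀ z) * ψ z) B R := by
  have hcont : Continuous fun z => Real.exp (2 * σ₀ z) * ψ z := by
    have := hσ.continuous
    fun_prop
  obtain ⟨B, hB⟩ := hc.mul_left.exists_bound_of_continuous hcont
  obtain ⟨R, hR⟩ := hc.isBounded.subset_closedBall 0
  refine ⟨B, max R 1, hcont.measurable, hB, fun z hz => ?_,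
    ae_of_all _ fun z => hcont.continuousAt, lt_max_of_lt_right one_pos⟩
  have : z ∉ tsupport ψ := fun h => by
    have := hR h
    simp only [Metric.mem_closedBall, dist_zero_right] at this
    linarith [le_max_left R 1]
  simp [image_eq_zero_of_notMem_tsupport this]

/-- An element of `H¹₀` with vanishing gradient vanishes. -/
theorem H10.ae_eq_zero_of_grad (hσ : IsSmoothSphereMetric σ₀) (u : H10 σ₀)
    (hu : u.grad =ᵐ[volume] 0) : u.toFun =ᵐ[volume] 0 := by
  have hfin := isFiniteMeasure_vol hσ
  have hui : Integrable u.toFun (vol σ₀) := u.memLp_toFun.integrable (by norm_num)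
  obtain ⟨C, hC, h2⟩ := hσ.exists_gaussCurv_bound
  have hKu : Integrable (fun z => gaussCurv σ₀ z * u.toFun z) (vol σ₀) :=
    hui.bdd_mul hσ.continuous_gaussCurv.aestronglyMeasurable (ae_of_all _ h2)
  -- If ∇u = 0, testing the equation for Δ⁻¹ of a centred ψ against u gives ∫ ψu = κ ∫ ψ for every
  -- test function ψ. Hence u equals the constant κ almost everywhere, and mean zero forces κ = 0.
  set κ := (∫ z, gaussCurv σ₀ z * u.toFun z ∂(vol σ₀)) / (4 * Real.pi)
  have hcσ := hσ.continuous
  have hconst : ∀ᵐ z, Real.exp (2 * σ₀ z) * (u.toFun z - κ) = 0 := by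
    refine ae_eq_zero_of_integral_contDiff_smul_eq_zero ?_ fun ψ hψ hc => ?_
    · refine Integrable.locallyIntegrable ?_
      exact (integrable_vol_iff hσ _).1 (hui.sub (integrable_const κ))
    obtain ⟨B, R, hm⟩ := isNiceDensity_of_smooth hσ hψ.continuous hc
    obtain ⟨C', hC'⟩ := hc.exists_bound_of_continuous hψ.continuous
    obtain ⟨v, k, hv, -⟩ := exists_isInvLaplacian (φ := ψ) hσ hm fun z => rfl
    have h3 := hv u
    have h4 : ∫ z, inner ℝ (v.grad z) (u.grad z) = 0 := by
      rw [integral_eq_zero_of_ae]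
      filter_upwards [hu] with z hz
      simp [hz]
    have hψu : Integrable (fun z => ψ z * u.toFun z) (vol σ₀) :=
      hui.bdd_mul hψ.continuous.aestronglyMeasurable (ae_of_all _ hC')
    have hψi : Integrable ψ (vol σ₀) :=
      Integrable.of_bound hψ.continuous.aestronglyMeasurable C' (ae_of_all _ hC')
    rw [h4] at h3
    simp only [centerFun, hσ.integral_gaussCurv, sub_mul, mul_assoc] at h3
    rw [integral_sub hψu (hKu.const_mul _), integral_const_mul] at h3
    have h5 : ∫ z, ψ z * (u.toFun z - κ) ∂(vol σ₀) = 0 := by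
      simp only [mul_sub]
      rw [integral_sub hψu (hψi.mul_const κ), integral_mul_const]
      simp only [κ]
      linear_combination h3
    rw [integral_vol hσ] at h5
    rw [← h5]
    congr 1 with z
    simp only [smul_eq_mul]
    ring
  have h6 : ∀ᵐ z, u.toFun z = κ := by
    filter_upwards [hconst] with z hz
    have := (mul_eq_zero.1 hz).resolve_left (Real.exp_pos _).ne'
    linarith
  have h7 : κ = 0 := by
    have h8 := u.mean_zero
    rw [integral_congr_ae ((vol_absolutelyContinuous σ₀).ae_le h6), integral_const, smul_eq_mul]
      at h8
    refine (mul_eq_zero.1 h8).resolve_left ?_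
    exact vol_univ_ne_zero hσ
  filter_upwards [h6] with z hz
  rw [hz, h7]
  rfl

end LQG

end

/-! ### The Dirichlet form on finite combinations, and measure-theoretic facts on dyadic squares. -/

noncomputable section

namespace LQG

variable {σ₀ : ℂ → ℝ}

/-! ## Linear algebra in `H¹₀` -/

/-- A finite linear combination in `H¹₀`. -/
def H10.linComb {ι : Type*} (hσ : IsSmoothSphereMetric σ₀) (s : Finset ι) (a : ι → ℝ)
    (u : ι → H10 σ₀) : H10 σ₀ where
  toFun z := ∑ i ∈ s, a i * (u i).toFun z
  grad z := ∑ i ∈ s, a i • (u i).grad z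
  memLp_toFun := memLp_finsetSum s fun i _ => (u i).memLp_toFun.const_mul (a i)
  memLp_grad := memLp_finsetSum s fun i _ => (u i).memLp_grad.const_smul (a i)
  isWeakGrad ψ hψ hc v := by
    have hi : ∀ i, Integrable fun z => (u i).toFun z * fderiv ℝ ψ z v := fun i =>
      integrable_mul_of_hasCompactSupport ((u i).weakPair hσ).locInt
        ((hψ.continuous_fderiv (by simp)).clm_apply continuous_const) (hc.fderiv_apply ℝ v)
    have hg : ∀ i, Integrable fun z => ψ z * inner ℝ ((u i).grad z) v := fun i => by
      have h1 := (((u i).weakPair hσ).locInt_grad.integrable_smul_left_of_hasCompactSupport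
        hψ.continuous hc).inner_const (𝕜 := ℝ) v
      simpa only [real_inner_smul_left] using h1
    simp only [Finset.sum_mul, sum_inner, Finset.mul_sum, real_inner_smul_left]
    rw [integral_finsetSum _ fun i _ => by simpa only [mul_assoc] using (hi i).const_mul (a i),
      integral_finsetSum _ fun i _ => by
        simpa only [mul_left_comm] using (hg i).const_mul (a i), ← Finset.sum_neg_distrib]
    refine Finset.sum_congr rfl fun i _ => ?_
    simp only [mul_assoc, mul_left_comm _ (a i)]
    rw [integral_const_mul, integral_const_mul, (u i).isWeakGrad ψ hψ hc v]
    ring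
  mean_zero := by
    have := isFiniteMeasure_vol hσ
    rw [integral_finsetSum _ fun i _ => ((u i).memLp_toFun.integrable (by norm_num)).const_mul _]
    simp [integral_const_mul, (u _).mean_zero]

/-- The integral of `∇u · ∇v`. -/
def gram (u v : H10 σ₀) : ℝ := ∫ z, inner ℝ (u.grad z) (v.grad z)

lemma dirichlet_eq_gram (u v : H10 σ₀) : dirichlet u v = (2 * Real.pi)⁻¹ * gram u v := rfl

lemma gram_comm (u v : H10 σ₀) : gram u v = gram v u := by
  simp only [gram, real_inner_comm]

lemma gram_linComb_left {ι : Type*} (hσ : IsSmoothSphereMetric σ₀) (s : Finset ι) (a : ι → ℝ)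
    (u : ι → H10 σ₀) (v : H10 σ₀) :
    gram (H10.linComb hσ s a u) v = ∑ i ∈ s, a i * gram (u i) v := by
  simp only [gram, H10.linComb, sum_inner, real_inner_smul_left]
  rw [integral_finsetSum _ fun i _ =>
    (integrable_inner_of_memLp (u i).memLp_grad v.memLp_grad).const_mul _]
  simp only [integral_const_mul]

lemma gram_linComb_right {ι : Type*} (hσ : IsSmoothSphereMetric σ₀) (s : Finset ι) (a : ι → ℝ)
    (u : ι → H10 σ₀) (v : H10 σ₀) :
    gram v (H10.linComb hσ s a u) = ∑ i ∈ s, a i * gram v (u i) := by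
  rw [gram_comm, gram_linComb_left]
  simp only [gram_comm v]

lemma gram_self_eq (u : H10 σ₀) : gram u u = ∫ z, ‖u.grad z‖ ^ 2 := by
  simp only [gram, real_inner_self_eq_norm_sq]

lemma gram_self_nonneg (u : H10 σ₀) : 0 ≤ gram u u := by
  rw [gram_self_eq]
  positivity

lemma grad_ae_eq_zero_of_gram {u : H10 σ₀} (h : gram u u = 0) : u.grad =ᵐ[volume] 0 := by
  rw [gram_self_eq, integral_eq_zero_iff_of_nonneg (fun z => by positivity)
    ((memLp_two_iff_integrable_sq_norm u.memLp_grad.1).1 u.memLp_grad)] at h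
  filter_upwards [h] with z hz
  simpa using hz

lemma gram_self_eq_zero {u : H10 σ₀} (h : u.grad =ᵐ[volume] 0) : gram u u = 0 := by
  rw [gram, integral_eq_zero_of_ae]
  filter_upwards [h] with z hz
  simp [hz]

/-- Bounded measurable functions. -/
structure IsBddMeas (φ : ℂ → ℝ) : Prop where
  meas : Measurable φ
  bdd : ∃ C, ∀ z, |φ z| ≤ C

lemma IsBddMeas.integrable_mul {φ : ℂ → ℝ} (hφ : IsBddMeas φ) (hσ : IsSmoothSphereMetric σ₀)
    (f : H10 σ₀) : Integrable (fun z => φ z * f.toFun z) (vol σ₀) := by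
  have := isFiniteMeasure_vol hσ
  obtain ⟨C, hC⟩ := hφ.bdd
  exact (f.memLp_toFun.integrable (by norm_num)).bdd_mul hφ.meas.aestronglyMeasurable
    (ae_of_all _ hC)

lemma IsBddMeas.integrable {φ : ℂ → ℝ} (hφ : IsBddMeas φ) (hσ : IsSmoothSphereMetric σ₀) :
    Integrable φ (vol σ₀) := by
  have := isFiniteMeasure_vol hσ
  obtain ⟨C, hC⟩ := hφ.bdd
  exact Integrable.of_bound hφ.meas.aestronglyMeasurable C (ae_of_all _ hC)

lemma isBddMeas_gaussCurv (hσ : IsSmoothSphereMetric σ₀) : IsBddMeas (gaussCurv σ₀) where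
  meas := hσ.continuous_gaussCurv.measurable
  bdd := let ⟨C, _, h⟩ := hσ.exists_gaussCurv_bound; ⟨C, h⟩

lemma IsBddMeas.centerFun {φ : ℂ → ℝ} (hφ : IsBddMeas φ) (hσ : IsSmoothSphereMetric σ₀) :
    IsBddMeas (centerFun σ₀ φ) where
  meas := hφ.meas.sub ((isBddMeas_gaussCurv hσ).meas.const_mul _)
  bdd := by
    obtain ⟨C, hC⟩ := hφ.bdd
    obtain ⟨C', hC'⟩ := (isBddMeas_gaussCurv hσ).bdd
    refine ⟨C + |(∫ w, φ w ∂(vol σ₀)) / ∫ w, gaussCurv σ₀ w ∂(vol σ₀)| * C', fun z => ?_⟩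
    refine (abs_sub _ _).trans (add_le_add (hC z) ?_)
    rw [abs_mul]
    gcongr
    exact hC' z

lemma integral_centerFun (hσ : IsSmoothSphereMetric σ₀) {φ : ℂ → ℝ} (hφ : IsBddMeas φ) :
    ∫ z, centerFun σ₀ φ z ∂(vol σ₀) = 0 := by
  have h0 : ∫ w, gaussCurv σ₀ w ∂(vol σ₀) ≠ 0 := by
    rw [hσ.integral_gaussCurv]
    positivity
  unfold centerFun
  rw [integral_sub (hφ.integrable hσ) (((isBddMeas_gaussCurv hσ).integrable hσ).const_mul _),
    integral_const_mul, div_mul_cancel₀ _ h0, sub_self]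

/-- Linear relations between right-hand sides pass to the gradients of the inverse Laplacians. -/
lemma linComb_grad_ae_eq_zero {ι : Type*} (hσ : IsSmoothSphereMetric σ₀) (s : Finset ι)
    (a : ι → ℝ) (u : ι → H10 σ₀) {φ : ι → ℂ → ℝ} (hφ : ∀ i ∈ s, IsBddMeas (φ i))
    (hu : ∀ i ∈ s, IsInvLaplacian (φ i) (u i)) (h0 : ∀ᵐ z, ∑ i ∈ s, a i * φ i z = 0) :
    (H10.linComb hσ s a u).grad =ᵐ[volume] 0 := by
  refine grad_ae_eq_zero_of_gram ?_
  set w := H10.linComb hσ s a u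
  rw [gram_linComb_left]
  -- Test each equation against the combination w itself: the energy of w is minus the pairing of w
  -- with the combined right-hand side, which vanishes.
  have h1 : ∀ i ∈ s, a i * gram (u i) w = -∫ z, a i * (φ i z * w.toFun z) ∂(vol σ₀) := by
    intro i hi
    rw [gram, hu i hi w, integral_const_mul]
    ring
  rw [Finset.sum_congr rfl h1, Finset.sum_neg_distrib,
    ← integral_finsetSum _ fun i hi => ((hφ i hi).integrable_mul hσ w).const_mul _,
    integral_eq_zero_of_ae, neg_zero]
  filter_upwards [(vol_absolutelyContinuous σ₀).ae_le h0] with z hz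
  simp only [Pi.zero_apply, ← mul_assoc, ← Finset.sum_mul]
  rw [hz, zero_mul]

/-- `invLaplacian` is an arbitrary choice among weak solutions; uniqueness lets the explicit
solution be compared with it. -/
lemma grad_ae_eq_of_isInvLaplacian (hσ : IsSmoothSphereMetric σ₀) {φ : ℂ → ℝ} (hφ : IsBddMeas φ)
    {u v : H10 σ₀} (hu : IsInvLaplacian φ u) (hv : IsInvLaplacian φ v) :
    u.grad =ᵐ[volume] v.grad ∧ u.toFun =ᵐ[volume] v.toFun := by
  have h := linComb_grad_ae_eq_zero hσ Finset.univ ![1, -1] ![u, v] (φ := fun _ => φ)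
    (fun _ _ => hφ) (fun i _ => by fin_cases i <;> simpa) (ae_of_all _ fun z => by simp)
  have h2 := H10.ae_eq_zero_of_grad hσ _ h
  constructor
  · filter_upwards [h] with z hz
    simp only [H10.linComb, Fin.sum_univ_two] at hz
    simpa [sub_eq_zero, ← sub_eq_add_neg] using hz
  · filter_upwards [h2] with z hz
    simp only [H10.linComb, Fin.sum_univ_two] at hz
    simpa [sub_eq_zero, ← sub_eq_add_neg] using hz

/-! ## Dyadic squares as sets -/

lemma DyadicSquare.side_pos (S : DyadicSquare) : 0 < S.side := by
  unfold DyadicSquare.side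
  positivity

lemma DyadicSquare.carrier_eq (S : DyadicSquare) : S.carrier =
    Complex.re ⁻¹' Set.Icc ((S.2.1 : ℕ) * S.side) (((S.2.1 : ℕ) + 1) * S.side) ∩
    Complex.im ⁻¹' Set.Icc ((S.2.2 : ℕ) * S.side) (((S.2.2 : ℕ) + 1) * S.side) := rfl

lemma DyadicSquare.isClosed_carrier (S : DyadicSquare) : IsClosed S.carrier :=
  (isClosed_Icc.preimage Complex.continuous_re).inter (isClosed_Icc.preimage Complex.continuous_im)

lemma DyadicSquare.convex_carrier (S : DyadicSquare) : Convex ℝ S.carrier :=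
  ((convex_Icc _ _).linear_preimage Complex.reLm).inter
    ((convex_Icc _ _).linear_preimage Complex.imLm)

lemma mul_side_le_one (S : DyadicSquare) (i : Fin (2 ^ S.1)) : ((i : ℕ) + 1 : ℝ) * S.side ≤ 1 := by
  have h : ((i : ℕ) + 1 : ℝ) ≤ 2 ^ S.1 := by exact_mod_cast i.isLt
  unfold DyadicSquare.side
  rw [mul_inv_le_iff₀ (by positivity), one_mul]
  exact h

lemma DyadicSquare.carrier_subset (S : DyadicSquare) : S.carrier ⊆ unitSquare := by
  rintro z ⟨⟨h1, h2⟩, h3, h4⟩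
  have := S.side_pos
  exact ⟨⟨le_trans (by positivity) h1, h2.trans (mul_side_le_one S _)⟩,
    ⟨le_trans (by positivity) h3, h4.trans (mul_side_le_one S _)⟩⟩

/-- The open square inside a dyadic square. -/
def DyadicSquare.inner (S : DyadicSquare) : Set ℂ :=
  Complex.re ⁻¹' Set.Ioo ((S.2.1 : ℕ) * S.side) (((S.2.1 : ℕ) + 1) * S.side) ∩
  Complex.im ⁻¹' Set.Ioo ((S.2.2 : ℕ) * S.side) (((S.2.2 : ℕ) + 1) * S.side)

lemma DyadicSquare.isOpen_inner (S : DyadicSquare) : IsOpen S.inner :=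
  (isOpen_Ioo.preimage Complex.continuous_re).inter (isOpen_Ioo.preimage Complex.continuous_im)

lemma DyadicSquare.inner_subset (S : DyadicSquare) : S.inner ⊆ S.carrier := fun _ hz =>
  ⟨Set.Ioo_subset_Icc_self hz.1, Set.Ioo_subset_Icc_self hz.2⟩

lemma DyadicSquare.inner_nonempty (S : DyadicSquare) : S.inner.Nonempty := by
  have := S.side_pos
  refine ⟨⟨((S.2.1 : ℕ) + 1 / 2) * S.side, ((S.2.2 : ℕ) + 1 / 2) * S.side⟩, ⟨?_, ?_⟩, ?_, ?_⟩
  all_goals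
    simp only
    gcongr
    norm_num

lemma DyadicSquare.volume_pos (S : DyadicSquare) : 0 < volume S.carrier :=
  (S.isOpen_inner.measure_pos volume S.inner_nonempty).trans_le (measure_mono S.inner_subset)

lemma DyadicSquare.norm_le_two (S : DyadicSquare) {z : ℂ} (hz : z ∈ S.carrier) : ‖z‖ ≤ 2 := by
  obtain ⟨⟨h1, h2⟩, h3, h4⟩ := S.carrier_subset hz
  refine (Complex.norm_le_abs_re_add_abs_im z).trans ?_
  rw [abs_of_nonneg h1, abs_of_nonneg h3]
  linarith

lemma flat_of_mem (hflat : ∀ᶠ z in 𝓝ˢ unitSquare, σ₀ z = 0) {z : ℂ} (hz : z ∈ unitSquare) :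
    σ₀ z = 0 :=
  (Filter.Eventually.self_of_nhdsSet hflat) z hz

lemma gaussCurv_eq_zero (hflat : ∀ᶠ z in 𝓝ˢ unitSquare, σ₀ z = 0) {z : ℂ}
    (hz : z ∈ unitSquare) : gaussCurv σ₀ z = 0 := by
  have h1 : σ₀ =ᶠ[𝓝 z] fun _ => 0 := (eventually_nhdsSet_iff_forall.1 hflat) z hz
  rw [gaussCurv, (InnerProductSpace.laplacian_congr_nhds h1).eq_of_nhds]
  simp

lemma DyadicSquare.isBddMeas_ind (S : DyadicSquare) : IsBddMeas S.ind where
  meas := measurable_one.indicator S.isClosed_carrier.measurableSet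
  bdd := ⟨1, fun z => by
    unfold DyadicSquare.ind
    by_cases h : z ∈ S.carrier <;> simp [h]⟩

/-- The indicator is continuous off the frontier of the square, which is null because the square is
convex. -/
lemma DyadicSquare.isNiceDensity (S : DyadicSquare) (c : ℝ) :
    IsNiceDensity (fun z => c * S.ind z) |c| 2 where
  meas := S.isBddMeas_ind.meas.const_mul c
  bound z := by
    unfold DyadicSquare.ind
    by_cases h : z ∈ S.carrier <;> simp [h]
  supp z hz := by
    unfold DyadicSquare.ind
    rw [Set.indicator_of_notMem fun h => (S.norm_le_two h).not_gt hz, mul_zero]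
  cont := by
    have h : ∀ᵐ z, z ∉ frontier S.carrier := by
      rw [ae_iff]
      simpa using S.convex_carrier.addHaar_frontier volume
    filter_upwards [h] with z hz
    exact continuousAt_const.mul ((continuous_one.continuousOn).continuousAt_indicator hz)
  R_pos := two_pos

end LQG

end

/-! ### Invertibility of the Gram matrix and the minimal energy function. -/

noncomputable section

namespace LQG

variable {σ₀ : ℂ → ℝ}

/-! ## Potentials of dyadic squares -/

lemma exp_mul_ind (hflat : ∀ᶠ z in 𝓝ˢ unitSquare, σ₀ z = 0) (S : DyadicSquare) (c : ℝ) (z : ℂ) :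
    c * S.ind z = Real.exp (2 * σ₀ z) * (c * S.ind z) := by
  unfold DyadicSquare.ind
  by_cases hz : z ∈ S.carrier
  · simp [flat_of_mem hflat (S.carrier_subset hz)]
  · simp [hz]

lemma isInvLaplacian_ind (hσ : IsSmoothSphereMetric σ₀)
    (hflat : ∀ᶠ z in 𝓝ˢ unitSquare, σ₀ z = 0) (S : DyadicSquare) (c : ℝ) :
    IsInvLaplacian (centerFun σ₀ fun z => c * S.ind z)
      (invLaplacian σ₀ (centerFun σ₀ fun z => c * S.ind z)) := by
  obtain ⟨u, k, hu, -⟩ := exists_isInvLaplacian hσ (S.isNiceDensity c) (exp_mul_ind hflat S c)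
  exact Classical.epsilon_spec ⟨u, hu⟩

/-- The function `Δ_{g₀}⁻¹ 𝟙̃_S`. -/
def squarePot (σ₀ : ℂ → ℝ) (S : DyadicSquare) : H10 σ₀ := invLaplacian σ₀ (S.indTilde σ₀)

lemma isInvLaplacian_squarePot (hσ : IsSmoothSphereMetric σ₀)
    (hflat : ∀ᶠ z in 𝓝ˢ unitSquare, σ₀ z = 0) (S : DyadicSquare) :
    IsInvLaplacian (S.indTilde σ₀) (squarePot σ₀ S) := by
  have h := isInvLaplacian_ind hσ hflat S 1
  simp only [one_mul] at h
  exact h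

lemma isBddMeas_indTilde (hσ : IsSmoothSphereMetric σ₀) (S : DyadicSquare) :
    IsBddMeas (S.indTilde σ₀) := S.isBddMeas_ind.centerFun hσ

/-- The chosen solution `squarePot` is determined only almost everywhere. The explicit potential
supplies a continuous representative on the sphere with a gradient at every point, as needed for the
pointwise `dirichletEnergy`. -/
lemma exists_squarePot_continuousMap (hσ : IsSmoothSphereMetric σ₀)
    (hflat : ∀ᶠ z in 𝓝ˢ unitSquare, σ₀ z = 0) (S : DyadicSquare) :
    ∃ (k : C(OnePoint ℂ, ℝ)) (V : ℂ → ℂ), V =ᵐ[volume] (squarePot σ₀ S).grad ∧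
      (∃ b : ℝ, ∀ᵐ z : ℂ, k (z : OnePoint ℂ) = (squarePot σ₀ S).toFun z + b) ∧
      (∀ z : ℂ, HasFDerivAt (fun w : ℂ => k (w : OnePoint ℂ)) (innerSL ℝ (V z)) z) ∧
      ∫ z : ℂ, k (z : OnePoint ℂ) * gaussCurv σ₀ z ∂(vol σ₀) = 0 := by
  obtain ⟨u, k, hu, ⟨b, hb⟩, hd, h0⟩ :=
    exists_isInvLaplacian hσ (S.isNiceDensity 1) (exp_mul_ind hflat S 1)
  simp only [one_mul] at hu
  obtain ⟨h1, h2⟩ := grad_ae_eq_of_isInvLaplacian hσ (isBddMeas_indTilde hσ S) hu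
    (isInvLaplacian_squarePot hσ hflat S)
  refine ⟨k, u.grad, h1, ⟨b, ?_⟩, hd, h0⟩
  filter_upwards [h2] with z hz
  rw [hb, hz]

/-- A smooth compactly supported function, minus its mean, as an element of `H¹₀`. -/
lemma exists_H10_of_smooth (hσ : IsSmoothSphereMetric σ₀) {ψ : ℂ → ℝ}
    (hψ : ContDiff ℝ (⊤ : ℕ∞) ψ) (hc : HasCompactSupport ψ) :
    ∃ (u : H10 σ₀) (b : ℝ), ∀ z, u.toFun z = ψ z - b := by
  have hlim : Filter.Tendsto ψ (Filter.coclosedCompact ℂ) (𝓝 0) := by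
    rw [Filter.coclosedCompact_eq_cocompact]
    exact hc.is_zero_at_infty
  set k : C(OnePoint ℂ, ℝ) := OnePoint.continuousMapMk ⟨ψ, hψ.continuous⟩ 0 hlim
  have hk : ∀ z : ℂ, k (z : OnePoint ℂ) = ψ z := fun z => rfl
  have hg : HasCompactSupport (gradient ψ) := by
    refine (hc.fderiv ℝ).mono' (Function.support_subset_iff'.2 fun z hz => ?_)
    have : fderiv ℝ ψ z = 0 := by
      by_contra h0
      exact hz (subset_tsupport _ h0)
    rw [gradient, this, map_zero]
  refine ⟨H10.ofContinuousMap hσ k (gradient ψ) (fun z => ?_)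
    ((contDiff_gradient hψ).continuous.memLp_of_hasCompactSupport hg), _, fun z => rfl⟩
  have h2 := ((hψ.differentiable (by simp)) z).hasFDerivAt
  refine h2.congr_fderiv (ContinuousLinearMap.ext fun v => ?_)
  rw [innerSL_apply_apply, inner_gradient]

/-- Squares with disjoint interiors, in the almost everywhere sense. -/
def AEDisjointSquares (F : Finset DyadicSquare) : Prop :=
  ∀ S ∈ F, ∀ T ∈ F, S ≠ T → volume (S.carrier ∩ T.carrier) = 0

/-- Linear independence of the potentials. If the combined gradient vanishes, then Φ = ∑ x_S 𝟙̃_S is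
orthogonal to all of `H10`. As Φ has mean zero, it is orthogonal to every test function, hence zero
almost everywhere. On a square S of F the curvature vanishes and the other members meet S in a null
set, so Φ equals x_S there. -/
lemma eq_zero_of_linComb_grad (hσ : IsSmoothSphereMetric σ₀)
    (hflat : ∀ᶠ z in 𝓝ˢ unitSquare, σ₀ z = 0) {F : Finset DyadicSquare}
    (hF : AEDisjointSquares F) (x : DyadicSquare → ℝ)
    (h : (H10.linComb hσ F x (squarePot σ₀)).grad =ᵐ[volume] 0) : ∀ S ∈ F, x S = 0 := by
  have hcσ := hσ.continuous
  set Φ : ℂ → ℝ := fun z => ∑ S ∈ F, x S * S.indTilde σ₀ z with hΦ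
  have hpair : ∀ f : H10 σ₀, ∫ z, Φ z * f.toFun z ∂(vol σ₀) = 0 := by
    intro f
    have h1 : gram (H10.linComb hσ F x (squarePot σ₀)) f = 0 := by
      rw [gram, integral_eq_zero_of_ae]
      filter_upwards [h] with z hz
      simp [hz]
    rw [gram_linComb_left] at h1
    simp only [hΦ, Finset.sum_mul, mul_assoc]
    rw [integral_finsetSum _ fun S _ => ((isBddMeas_indTilde hσ S).integrable_mul hσ f).const_mul _,
      ← neg_eq_zero, ← h1, ← Finset.sum_neg_distrib]
    refine Finset.sum_congr rfl fun S _ => ?_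
    rw [gram, isInvLaplacian_squarePot hσ hflat S f, integral_const_mul]
    ring
  have hΦb : IsBddMeas Φ := by
    constructor
    · exact Finset.measurable_sum _ fun S _ => (isBddMeas_indTilde hσ S).meas.const_mul _
    · choose C hC using fun S => (isBddMeas_indTilde hσ S).bdd
      refine ⟨∑ S ∈ F, |x S| * C S, fun z => (Finset.abs_sum_le_sum_abs _ _).trans ?_⟩
      refine Finset.sum_le_sum fun S _ => ?_
      rw [abs_mul]
      have := hC S z
      gcongr
  have hΦi : Integrable Φ (vol σ₀) := hΦb.integrable hσ
  have hΦ0 : ∫ z, Φ z ∂(vol σ₀) = 0 := by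
    simp only [hΦ]
    rw [integral_finsetSum _ fun S _ => ((isBddMeas_indTilde hσ S).integrable hσ).const_mul _]
    simp only [integral_const_mul, DyadicSquare.indTilde,
      integral_centerFun hσ (DyadicSquare.isBddMeas_ind _), mul_zero, Finset.sum_const_zero]
  have hzero : ∀ᵐ z, Real.exp (2 * σ₀ z) * Φ z = 0 := by
    refine ae_eq_zero_of_integral_contDiff_smul_eq_zero
      ((integrable_vol_iff hσ _).1 hΦi).locallyIntegrable fun ψ hψ hc => ?_
    obtain ⟨u, b, hu⟩ := exists_H10_of_smooth hσ hψ hc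
    have h1 := hpair u
    have hψi : Integrable (fun z => Φ z * ψ z) (vol σ₀) := by
      obtain ⟨C, hC⟩ := hc.exists_bound_of_continuous hψ.continuous
      exact hΦi.mul_bdd (c := C) hψ.continuous.aestronglyMeasurable (ae_of_all _ hC)
    simp only [hu, mul_sub] at h1
    rw [integral_sub hψi (hΦi.mul_const b), integral_mul_const, hΦ0, zero_mul, sub_zero,
      integral_vol hσ] at h1
    rw [← h1]
    congr 1 with z
    simp only [smul_eq_mul]
    ring
  intro S hS
  by_contra hxS
  have h2 : ∀ᵐ z, ∀ T ∈ F, S ≠ T → z ∉ S.carrier ∩ T.carrier := by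
    rw [Filter.eventually_all_finset]
    intro T hT
    by_cases hST : S = T
    · exact ae_of_all _ fun z h => absurd hST h
    · have := hF S hS T hT hST
      filter_upwards [measure_eq_zero_iff_ae_notMem.1 this] with z hz _ using hz
  have h3 : ∀ᵐ z, z ∉ S.carrier := by
    filter_upwards [hzero, h2] with z hz1 hz2 hz
    have hflatz := flat_of_mem hflat (S.carrier_subset hz)
    have hK := gaussCurv_eq_zero hflat (S.carrier_subset hz)
    rw [hflatz, mul_zero, Real.exp_zero, one_mul] at hz1
    apply hxS
    rw [← hz1, hΦ]
    simp only [DyadicSquare.indTilde, centerFun, hK, mul_zero, sub_zero]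
    rw [Finset.sum_eq_single S]
    · simp [DyadicSquare.ind, hz]
    · intro T hT hTS
      have : z ∉ T.carrier := fun h => hz2 T hT hTS.symm ⟨hz, h⟩
      simp [DyadicSquare.ind, this]
    · exact fun h => absurd hS h
  exact S.volume_pos.ne' (measure_eq_zero_iff_ae_notMem.2 h3)

/-! ## The regularization -/

/-- The Gram matrix of the functions `Δ_{g₀}⁻¹ 𝟙̃_S`, `S ∈ F`. -/
def gramMatrix (σ₀ : ℂ → ℝ) (F : Finset DyadicSquare) : Matrix F F ℝ :=
  Matrix.of fun S T => gram (squarePot σ₀ S) (squarePot σ₀ T)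

/-- Extension by zero of a vector indexed by a finite collection of squares. -/
def extendZero {F : Finset DyadicSquare} (x : F → ℝ) (S : DyadicSquare) : ℝ :=
  if h : S ∈ F then x ⟨S, h⟩ else 0

lemma extendZero_coe {F : Finset DyadicSquare} (x : F → ℝ) (S : F) : extendZero x S = x S := by
  simp [extendZero]

/-- The linear combination `∑ x_S Δ_{g₀}⁻¹ 𝟙̃_S`. -/
def squareComb (hσ : IsSmoothSphereMetric σ₀) {F : Finset DyadicSquare} (x : F → ℝ) : H10 σ₀ :=
  H10.linComb hσ F (extendZero x) (squarePot σ₀)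

lemma gram_squareComb_left (hσ : IsSmoothSphereMetric σ₀) {F : Finset DyadicSquare} (x : F → ℝ)
    (v : H10 σ₀) : gram (squareComb hσ x) v = ∑ S : F, x S * gram (squarePot σ₀ S) v := by
  rw [squareComb, gram_linComb_left, ← Finset.sum_coe_sort]
  simp only [extendZero_coe]

lemma gram_squareComb (hσ : IsSmoothSphereMetric σ₀) {F : Finset DyadicSquare} (x y : F → ℝ) :
    gram (squareComb hσ x) (squareComb hσ y) = x ⬝ᵥ (gramMatrix σ₀ F).mulVec y := by
  rw [gram_squareComb_left, dotProduct]
  refine Finset.sum_congr rfl fun S _ => ?_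
  rw [gram_comm, gram_squareComb_left, Matrix.mulVec, dotProduct]
  congr 1
  refine Finset.sum_congr rfl fun T _ => ?_
  rw [gramMatrix, Matrix.of_apply, gram_comm, mul_comm]

lemma posDef_gramMatrix (hσ : IsSmoothSphereMetric σ₀)
    (hflat : ∀ᶠ z in 𝓝ˢ unitSquare, σ₀ z = 0) {F : Finset DyadicSquare}
    (hF : AEDisjointSquares F) : (gramMatrix σ₀ F).PosDef := by
  refine Matrix.PosDef.of_dotProduct_mulVec_pos ?_ fun x hx => ?_
  · ext S T
    simp [gramMatrix, gram_comm]
  · rw [star_trivial, ← gram_squareComb hσ]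
    refine lt_of_le_of_ne (gram_self_nonneg _) fun h => hx ?_
    have h1 := eq_zero_of_linComb_grad hσ hflat hF _ (grad_ae_eq_zero_of_gram h.symm)
    ext S
    have := h1 S S.2
    rwa [extendZero_coe] at this

/-- The coefficients of the minimal energy function. -/
def energyCoeff (σ₀ : ℂ → ℝ) {F : Finset DyadicSquare} (a : F → ℝ) : F → ℝ :=
  -((gramMatrix σ₀ F)⁻¹.mulVec a)

/-- The energy `aᵀ G⁻¹ a` of the minimal energy function with data `a`. -/
def minEnergy (σ₀ : ℂ → ℝ) {F : Finset DyadicSquare} (a : F → ℝ) : ℝ :=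
  a ⬝ᵥ (gramMatrix σ₀ F)⁻¹.mulVec a

lemma gramMatrix_mulVec_energyCoeff (hσ : IsSmoothSphereMetric σ₀)
    (hflat : ∀ᶠ z in 𝓝ˢ unitSquare, σ₀ z = 0) {F : Finset DyadicSquare}
    (hF : AEDisjointSquares F) (a : F → ℝ) :
    (gramMatrix σ₀ F).mulVec (energyCoeff σ₀ a) = -a := by
  have hu : IsUnit (gramMatrix σ₀ F).det :=
    (Matrix.isUnit_iff_isUnit_det _).1 (posDef_gramMatrix hσ hflat hF).isUnit
  rw [energyCoeff, Matrix.mulVec_neg, Matrix.mulVec_mulVec, Matrix.mul_nonsing_inv _ hu,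
    Matrix.one_mulVec]

lemma gram_squareComb_energyCoeff (hσ : IsSmoothSphereMetric σ₀)
    (hflat : ∀ᶠ z in 𝓝ˢ unitSquare, σ₀ z = 0) {F : Finset DyadicSquare}
    (hF : AEDisjointSquares F) (a : F → ℝ) :
    gram (squareComb hσ (energyCoeff σ₀ a)) (squareComb hσ (energyCoeff σ₀ a)) =
      minEnergy σ₀ a := by
  rw [gram_squareComb, gramMatrix_mulVec_energyCoeff hσ hflat hF, energyCoeff, minEnergy,
    neg_dotProduct_neg, dotProduct_comm]

lemma integral_squareComb_energyCoeff (hσ : IsSmoothSphereMetric σ₀)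
    (hflat : ∀ᶠ z in 𝓝ˢ unitSquare, σ₀ z = 0) {F : Finset DyadicSquare}
    (hF : AEDisjointSquares F) (a : F → ℝ) (S : F) :
    ∫ z, (squareComb hσ (energyCoeff σ₀ a)).toFun z * (S : DyadicSquare).indTilde σ₀ z ∂(vol σ₀) =
      a S := by
  have h1 := isInvLaplacian_squarePot hσ hflat S (squareComb hσ (energyCoeff σ₀ a))
  have h2 : gram (squarePot σ₀ S) (squareComb hσ (energyCoeff σ₀ a)) = -a S := by
    have := congrFun (gramMatrix_mulVec_energyCoeff hσ hflat hF a) S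
    rw [Pi.neg_apply] at this
    rw [← this, gram_comm, gram_squareComb_left, Matrix.mulVec, dotProduct]
    refine Finset.sum_congr rfl fun T _ => ?_
    rw [gramMatrix, Matrix.of_apply, gram_comm, mul_comm]
  rw [gram] at h2
  simp only [mul_comm (H10.toFun _ _)]
  linarith

/-- Pythagoras: any competitor exceeds the minimal energy function by the energy of the
difference. -/
lemma gram_competitor (hσ : IsSmoothSphereMetric σ₀)
    (hflat : ∀ᶠ z in 𝓝ˢ unitSquare, σ₀ z = 0) {F : Finset DyadicSquare}
    (hF : AEDisjointSquares F) (a : F → ℝ) (f : H10 σ₀)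
    (hf : ∀ S : F, ∫ z, f.toFun z * (S : DyadicSquare).indTilde σ₀ z ∂(vol σ₀) = a S) :
    gram f f = minEnergy σ₀ a + gram (H10.linComb hσ Finset.univ ![1, -1]
      ![f, squareComb hσ (energyCoeff σ₀ a)]) (H10.linComb hσ Finset.univ ![1, -1]
      ![f, squareComb hσ (energyCoeff σ₀ a)]) := by
  have h1 : gram (squareComb hσ (energyCoeff σ₀ a)) f = minEnergy σ₀ a := by
    rw [gram_squareComb_left, minEnergy, energyCoeff, dotProduct]
    refine Finset.sum_congr rfl fun S _ => ?_
    rw [gram, isInvLaplacian_squarePot hσ hflat S f, ← hf S, Pi.neg_apply]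
    simp only [mul_comm (H10.toFun _ _)]
    ring
  have h2 := gram_squareComb_energyCoeff hσ hflat hF a
  rw [gram_linComb_left]
  simp only [gram_linComb_right, Fin.sum_univ_two, Matrix.cons_val_zero, Matrix.cons_val_one]
  rw [gram_comm f (squareComb _ _), h1, h2]
  ring

lemma isMinimalEnergy_squareComb (hσ : IsSmoothSphereMetric σ₀)
    (hflat : ∀ᶠ z in 𝓝ˢ unitSquare, σ₀ z = 0) {F : Finset DyadicSquare}
    (hF : AEDisjointSquares F) (a : DyadicSquare → ℝ) :
    IsMinimalEnergy (F : Set DyadicSquare) a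
      (squareComb hσ (energyCoeff σ₀ fun S : F => a S)) := by
  refine ⟨fun S hS => integral_squareComb_energyCoeff hσ hflat hF (fun S : F => a S) ⟨S, hS⟩,
    fun f' hf' => ?_⟩
  rw [dirichlet_eq_gram, dirichlet_eq_gram, gram_squareComb_energyCoeff hσ hflat hF,
    gram_competitor hσ hflat hF (fun S : F => a S) f' fun S => hf' S S.2]
  have := gram_self_nonneg (H10.linComb hσ Finset.univ ![1, -1]
      ![f', squareComb hσ (energyCoeff σ₀ fun S : F => a S)])
  gcongr
  linarith

/-- By `gram_competitor`, a second minimizer differs by an element of zero energy, and such an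
element vanishes. -/
lemma squareComb_unique (hσ : IsSmoothSphereMetric σ₀)
    (hflat : ∀ᶠ z in 𝓝ˢ unitSquare, σ₀ z = 0) {F : Finset DyadicSquare}
    (hF : AEDisjointSquares F) (a : DyadicSquare → ℝ) {f : H10 σ₀}
    (hf : IsMinimalEnergy (F : Set DyadicSquare) a f) :
    f.toFun =ᵐ[volume] (squareComb hσ (energyCoeff σ₀ fun S : F => a S)).toFun := by
  have h1 := gram_competitor hσ hflat hF (fun S : F => a S) f fun S => hf.1 S S.2
  have h2 := hf.2 _ (isMinimalEnergy_squareComb hσ hflat hF a).1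
  rw [dirichlet_eq_gram, dirichlet_eq_gram, gram_squareComb_energyCoeff hσ hflat hF] at h2
  have h3 := le_of_mul_le_mul_left h2 (inv_pos.2 Real.two_pi_pos)
  have h4 := gram_self_nonneg (H10.linComb hσ Finset.univ ![1, -1]
      ![f, squareComb hσ (energyCoeff σ₀ fun S : F => a S)])
  have h5 := H10.ae_eq_zero_of_grad hσ _ (grad_ae_eq_zero_of_gram (le_antisymm
    (by linarith) h4))
  filter_upwards [h5] with z hz
  simp only [H10.linComb, Fin.sum_univ_two] at hz
  simpa [sub_eq_zero, ← sub_eq_add_neg] using hz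

lemma continuousMap_ext_of_ae {k k' : C(OnePoint ℂ, ℝ)}
    (h : ∀ᵐ z : ℂ, k (z : OnePoint ℂ) = k' (z : OnePoint ℂ)) : k = k' := by
  have h1 : (fun z : ℂ => k (z : OnePoint ℂ)) = fun z : ℂ => k' (z : OnePoint ℂ) :=
    Continuous.ae_eq_iff_eq volume (k.continuous.comp OnePoint.continuous_coe)
      (k'.continuous.comp OnePoint.continuous_coe) |>.1 h
  refine ContinuousMap.coe_injective ?_
  exact OnePoint.denseRange_coe.equalizer k.continuous k'.continuous h1

/-- The regularization is a linear function of the data; its Dirichlet energy is `aᵀ G⁻¹ a`. -/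
theorem exists_regularization (hσ : IsSmoothSphereMetric σ₀)
    (hflat : ∀ᶠ z in 𝓝ˢ unitSquare, σ₀ z = 0) {F : Finset DyadicSquare}
    (hF : AEDisjointSquares F) :
    ∃ Rg : (F → ℝ) →ₗ[ℝ] C(OnePoint ℂ, ℝ),
      (∀ a : DyadicSquare → ℝ, regularization σ₀ (F : Set DyadicSquare) a = Rg fun S => a S) ∧
      (∀ a, ∫ z : ℂ, Rg a (z : OnePoint ℂ) * gaussCurv σ₀ z ∂(vol σ₀) = 0) ∧
      ∀ a, dirichletEnergy (Rg a) = minEnergy σ₀ a := by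
  have hfin := isFiniteMeasure_vol hσ
  choose k V hV hk hd h0 using exists_squarePot_continuousMap hσ hflat
  choose b hb using hk
  set Rg : (F → ℝ) →ₗ[ℝ] C(OnePoint ℂ, ℝ) :=
    { toFun := fun a => ∑ S : F, energyCoeff σ₀ a S • k S
      map_add' := fun a a' => by
        simp only [energyCoeff, Matrix.mulVec_add, neg_add, Pi.add_apply, add_smul,
          Finset.sum_add_distrib]
      map_smul' := fun c a => by
        simp only [energyCoeff, Matrix.mulVec_smul, ← smul_neg, Pi.smul_apply, smul_assoc,
          Finset.smul_sum, RingHom.id_apply] } with hRg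
  have hRgv : ∀ a p, Rg a p = ∑ S : F, energyCoeff σ₀ a S * k S p := fun a p => by
    simp [hRg]
  have hK : ∀ a, ∫ z : ℂ, Rg a (z : OnePoint ℂ) * gaussCurv σ₀ z ∂(vol σ₀) = 0 := fun a => by
    have hi : ∀ S, Integrable (fun z : ℂ => k S (z : OnePoint ℂ) * gaussCurv σ₀ z) (vol σ₀) :=
      fun S => by
        obtain ⟨C, hC⟩ := (isBddMeas_gaussCurv hσ).bdd
        exact (integrable_of_continuousMap hσ (k S)).mul_bdd (c := C)
          hσ.continuous_gaussCurv.aestronglyMeasurable (ae_of_all _ hC)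
    simp only [hRgv, Finset.sum_mul, mul_assoc]
    rw [integral_finsetSum Finset.univ fun (S : F) _ => (hi S).const_mul (energyCoeff σ₀ a S)]
    simp [integral_const_mul, h0]
  have hRgf : ∀ a, ∀ᵐ z : ℂ, Rg a (z : OnePoint ℂ) = (squareComb hσ (energyCoeff σ₀ a)).toFun z +
      ∑ S : F, energyCoeff σ₀ a S * b S := fun a => by
    filter_upwards [ae_all_iff.2 hb] with z hz
    rw [hRgv, squareComb, H10.linComb]
    simp only
    rw [← Finset.sum_coe_sort F fun i => extendZero (energyCoeff σ₀ a) i * (squarePot σ₀ i).toFun z,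
      ← Finset.sum_add_distrib]
    refine Finset.sum_congr rfl fun S _ => ?_
    rw [hz, extendZero_coe]
    ring
  refine ⟨Rg, fun a => ?_, hK, fun a => ?_⟩
  · have hex : IsRegularization σ₀ (F : Set DyadicSquare) a (Rg fun S => a S) :=
      ⟨⟨_, isMinimalEnergy_squareComb hσ hflat hF a, _, hRgf _⟩, hK _⟩
    have hspec : IsRegularization σ₀ (F : Set DyadicSquare) a
        (regularization σ₀ (F : Set DyadicSquare) a) := Classical.epsilon_spec ⟨_, hex⟩
    set k' := regularization σ₀ (F : Set DyadicSquare) a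
    obtain ⟨⟨f, hf, b', hb'⟩, hk0⟩ := hspec
    have h1 := squareComb_unique hσ hflat hF a hf
    set c := b' - ∑ S : F, energyCoeff σ₀ (fun S : F => a S) S * b S
    have h2 : ∀ᵐ z : ℂ, k' (z : OnePoint ℂ) = Rg (fun S => a S) (z : OnePoint ℂ) + c := by
      filter_upwards [h1, hb', hRgf fun S => a S] with z hz1 hz2 hz3
      rw [hz2, hz3, hz1]
      simp only [c]
      ring
    -- Both functions pair to zero with K₀, whose total integral 4π is nonzero, so they cannot
    -- differ by a nonzero constant.
    have h3 : c = 0 := by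
      have hi : Integrable (fun z : ℂ => Rg (fun S => a S) (z : OnePoint ℂ) * gaussCurv σ₀ z)
          (vol σ₀) := by
        obtain ⟨C, hC⟩ := (isBddMeas_gaussCurv hσ).bdd
        exact (integrable_of_continuousMap hσ _).mul_bdd (c := C)
          hσ.continuous_gaussCurv.aestronglyMeasurable (ae_of_all _ hC)
      rw [integral_congr_ae (g := fun z : ℂ => Rg (fun S => a S) (z : OnePoint ℂ) *
        gaussCurv σ₀ z + c * gaussCurv σ₀ z), integral_add hi
        (((isBddMeas_gaussCurv hσ).integrable hσ).const_mul c), hK, integral_const_mul,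
        hσ.integral_gaussCurv, zero_add] at hk0
      · exact (mul_eq_zero.1 hk0).resolve_right (by positivity)
      · filter_upwards [(vol_absolutelyContinuous σ₀).ae_le h2] with z hz
        rw [hz, add_mul]
    refine continuousMap_ext_of_ae ?_
    filter_upwards [h2] with z hz
    rw [hz, h3, add_zero]
  · rw [← gram_squareComb_energyCoeff hσ hflat hF, gram_self_eq, dirichletEnergy]
    refine integral_congr_ae ?_
    filter_upwards [ae_all_iff.2 hV] with z hz
    have h1 : HasFDerivAt (fun w : ℂ => Rg a (w : OnePoint ℂ))
        (∑ S : F, energyCoeff σ₀ a S • innerSL ℝ (V S z)) z := by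
      simp only [hRgv]
      exact HasFDerivAt.fun_sum fun S _ => (hd S z).const_mul _
    have h2 : gradient (fun w : ℂ => Rg a (w : OnePoint ℂ)) z =
        (squareComb hσ (energyCoeff σ₀ a)).grad z := by
      refine ext_inner_right ℝ fun v => ?_
      rw [inner_gradient, h1.fderiv, squareComb, H10.linComb]
      simp only
      rw [← Finset.sum_coe_sort F fun i => extendZero (energyCoeff σ₀ a) i • (squarePot σ₀ i).grad z,
        sum_inner, sum_apply]
      refine Finset.sum_congr rfl fun S _ => ?_
      rw [extendZero_coe, ← hz, real_inner_smul_left, smul_apply, innerSL_apply_apply, smul_eq_mul]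
    rw [h2]

end LQG

end

/-! ### Almost sure linearity of the Gaussian field. -/

noncomputable section

namespace LQG

/-! ## Linear relations for the field -/

variable {σ₀ : ℂ → ℝ} {Ω : Type*} {X : H10 σ₀ → Ω → ℝ}

/-- The pairing of the field with the indicator function of a dyadic square. -/
def squareMass (X : H10 σ₀ → Ω → ℝ) (S : DyadicSquare) (ω : Ω) : ℝ :=
  -(2 * Real.pi) * X (squarePot σ₀ S) ω

/-- Centering is idempotent, since the centred indicator already has mean zero. -/
lemma pairGFF_indTilde (hσ : IsSmoothSphereMetric σ₀) (S : DyadicSquare) (ω : Ω) :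
    pairGFF X (S.indTilde σ₀) ω = squareMass X S ω := by
  have h : centerFun σ₀ (S.indTilde σ₀) = S.indTilde σ₀ := by
    ext z
    rw [centerFun, DyadicSquare.indTilde, integral_centerFun hσ S.isBddMeas_ind]
    simp
  rw [pairGFF, pairMod, h]
  rfl

variable [MeasurableSpace Ω] {P : Measure Ω}

lemma IsGFF.memLp_two (hX : IsGFF X P) (u : H10 σ₀) : MemLp (X u) 2 P :=
  (hX.gaussian.hasGaussianLaw_eval u).memLp_two

lemma IsGFF.covariance_sum (hX : IsGFF X P) (hσ : IsSmoothSphereMetric σ₀) {ι : Type*}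
    (s : Finset ι) (a : ι → ℝ) (u : ι → H10 σ₀) :
    covariance (fun ω => ∑ i ∈ s, a i * X (u i) ω) (fun ω => ∑ i ∈ s, a i * X (u i) ω) P =
      (2 * Real.pi)⁻¹ * gram (H10.linComb hσ s a u) (H10.linComb hσ s a u) := by
  have := hX.gaussian.isProbabilityMeasure
  have hm : ∀ i, MemLp (fun ω => a i * X (u i) ω) 2 P := fun i => (hX.memLp_two _).const_mul _
  rw [covariance_fun_sum_fun_sum' (fun i _ => hm i) (fun i _ => hm i), gram_linComb_left,
    Finset.mul_sum]
  refine Finset.sum_congr rfl fun i _ => ?_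
  rw [gram_linComb_right, Finset.mul_sum, Finset.mul_sum]
  refine Finset.sum_congr rfl fun j _ => ?_
  rw [covariance_const_mul_left, covariance_const_mul_right, hX.covariance_eq, dirichlet_eq_gram]
  ring

/-- A family satisfying `IsGFF` is not assumed linear in f. Linearity holds almost surely because a
combination has variance (2π)⁻¹ times its energy: if the energy is zero, the combination equals its
mean, which is zero. -/
lemma IsGFF.sum_ae_eq_zero (hX : IsGFF X P) (hσ : IsSmoothSphereMetric σ₀) {ι : Type*}
    (s : Finset ι) (a : ι → ℝ) (u : ι → H10 σ₀)
    (h : (H10.linComb hσ s a u).grad =ᵐ[volume] 0) : ∀ᵐ ω ∂P, ∑ i ∈ s, a i * X (u i) ω = 0 := by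
  have := hX.gaussian.isProbabilityMeasure
  have hm : ∀ i, MemLp (fun ω => a i * X (u i) ω) 2 P := fun i => (hX.memLp_two _).const_mul _
  have hL : MemLp (fun ω => ∑ i ∈ s, a i * X (u i) ω) 2 P := memLp_finsetSum s fun i _ => hm i
  have h1 := hX.covariance_sum hσ s a u
  rw [gram_self_eq_zero h, mul_zero, covariance_self hL.aestronglyMeasurable.aemeasurable] at h1
  have h2 : ∫ ω, ∑ i ∈ s, a i * X (u i) ω ∂P = 0 := by
    rw [integral_finsetSum s fun i _ => (hm i).integrable (by norm_num)]
    simp [integral_const_mul, hX.centered]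
  have h3 : evariance (fun ω => ∑ i ∈ s, a i * X (u i) ω) P = 0 := by
    rw [← hL.ofReal_variance_eq, h1, ENNReal.ofReal_zero]
  rw [evariance_eq_zero_iff hL.aestronglyMeasurable.aemeasurable] at h3
  filter_upwards [h3] with ω hω
  rw [hω, h2]

/-- The average and the mass use separately chosen inverse Laplacians of proportional functions, so
proportionality of the field values holds only almost surely. -/
lemma IsGFF.squareAverage_ae_eq (hX : IsGFF X P) (hσ : IsSmoothSphereMetric σ₀)
    (hflat : ∀ᶠ z in 𝓝ˢ unitSquare, σ₀ z = 0) (S : DyadicSquare) :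
    ∀ᵐ ω ∂P, squareAverage X S ω = (S.side ^ 2)⁻¹ * squareMass X S ω := by
  set c := (S.side ^ 2)⁻¹
  have hlin : ∀ z, centerFun σ₀ (fun z => c * S.ind z) z = c * S.indTilde σ₀ z := fun z => by
    simp only [DyadicSquare.indTilde, centerFun, integral_const_mul]
    ring
  have hbd : IsBddMeas (centerFun σ₀ (fun z => c * S.ind z)) := by
    obtain ⟨C, hC⟩ := S.isBddMeas_ind.bdd
    refine IsBddMeas.centerFun ⟨S.isBddMeas_ind.meas.const_mul c, |c| * C, fun z => ?_⟩ hσ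
    rw [abs_mul]
    exact mul_le_mul_of_nonneg_left (hC z) (abs_nonneg c)
  have h := linComb_grad_ae_eq_zero hσ Finset.univ ![1, -c]
    ![invLaplacian σ₀ (centerFun σ₀ fun z => c * S.ind z), squarePot σ₀ S]
    (φ := ![centerFun σ₀ fun z => c * S.ind z, S.indTilde σ₀])
    (fun i _ => by
      fin_cases i
      · exact hbd
      · exact isBddMeas_indTilde hσ S)
    (fun i _ => by
      fin_cases i
      · exact isInvLaplacian_ind hσ hflat S c
      · exact isInvLaplacian_squarePot hσ hflat S)
    (ae_of_all _ fun z => by simp [hlin])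
  filter_upwards [hX.sum_ae_eq_zero hσ _ _ _ h] with ω hω
  simp only [Fin.sum_univ_two, Matrix.cons_val_zero, Matrix.cons_val_one] at hω
  rw [squareAverage, pairGFF, pairMod, squareMass]
  linear_combination (-(2 * Real.pi)) * hω

lemma IsGFF.squareMass_sum_ae_eq_zero (hX : IsGFF X P) (hσ : IsSmoothSphereMetric σ₀)
    (hflat : ∀ᶠ z in 𝓝ˢ unitSquare, σ₀ z = 0) {ι : Type*} (s : Finset ι) (a : ι → ℝ)
    (T : ι → DyadicSquare) (h : ∀ᵐ z : ℂ, ∑ i ∈ s, a i * (T i).ind z = 0) :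
    ∀ᵐ ω ∂P, ∑ i ∈ s, a i * squareMass X (T i) ω = 0 := by
  have h0 : ∑ i ∈ s, a i * ∫ z, (T i).ind z ∂(vol σ₀) = 0 := by
    simp only [← integral_const_mul]
    rw [← integral_finsetSum s fun i _ => ((T i).isBddMeas_ind.integrable hσ).const_mul _,
      integral_eq_zero_of_ae]
    exact (vol_absolutelyContinuous σ₀).ae_le h
  have h1 : ∀ᵐ z : ℂ, ∑ i ∈ s, a i * (T i).indTilde σ₀ z = 0 := by
    filter_upwards [h] with z hz
    have : ∀ i, a i * (T i).indTilde σ₀ z = a i * (T i).ind z -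
        (a i * ∫ w, (T i).ind w ∂(vol σ₀)) * (gaussCurv σ₀ z /
          ∫ w, gaussCurv σ₀ w ∂(vol σ₀)) := fun i => by
      simp only [DyadicSquare.indTilde, centerFun]
      ring
    simp only [this, Finset.sum_sub_distrib, ← Finset.sum_mul, hz, h0]
    ring
  have h2 := hX.sum_ae_eq_zero hσ s a _ (linComb_grad_ae_eq_zero hσ s a (fun i => squarePot σ₀ (T i))
    (fun i _ => isBddMeas_indTilde hσ (T i)) (fun i _ => isInvLaplacian_squarePot hσ hflat (T i)) h1)
  filter_upwards [h2] with ω hω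
  simp only [squareMass, mul_left_comm _ (-(2 * Real.pi)), ← Finset.mul_sum, hω, mul_zero]

lemma IsGFF.measurable_squareMass (hX : IsGFF X P) (S : DyadicSquare) :
    Measurable (squareMass X S) := (hX.measurable _).const_mul _

lemma IsGFF.integral_squareMass (hX : IsGFF X P) (S : DyadicSquare) :
    ∫ ω, squareMass X S ω ∂P = 0 := by
  simp only [squareMass, integral_const_mul, hX.centered, mul_zero]

lemma IsGFF.covariance_squareMass (hX : IsGFF X P) (S T : DyadicSquare) :
    covariance (squareMass X S) (squareMass X T) P =
      2 * Real.pi * gram (squarePot σ₀ S) (squarePot σ₀ T) := by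
  unfold squareMass
  rw [covariance_const_mul_left, covariance_const_mul_right, hX.covariance_eq, dirichlet_eq_gram]
  field_simp

end LQG

end

/-! ### The tree structure of dyadic squares and their null overlaps. -/

noncomputable section

namespace LQG

/-! ## Combinatorics of dyadic squares -/

namespace DyadicSquare

lemma index_of_Icc_subset {k m i j : ℕ}
    (h : Set.Icc ((i : ℝ) * (2 ^ k)⁻¹) ((i + 1 : ℝ) * (2 ^ k)⁻¹) ⊆
      Set.Icc ((j : ℝ) * (2 ^ m)⁻¹) ((j + 1 : ℝ) * (2 ^ m)⁻¹)) :
    m ≤ k ∧ i / 2 ^ (k - m) = j := by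
  have hk : (0 : ℝ) < (2 ^ k)⁻¹ := by positivity
  have hle : (i : ℝ) * (2 ^ k)⁻¹ ≤ (i + 1 : ℝ) * (2 ^ k)⁻¹ := by nlinarith
  have h1 := (Set.Icc_subset_Icc_iff hle).1 h
  have hmk : m ≤ k := by
    by_contra hlt
    have : ((2 : ℝ) ^ m)⁻¹ < (2 ^ k)⁻¹ := by
      gcongr
      · norm_num
      · omega
    nlinarith [h1.1, h1.2]
  refine ⟨hmk, ?_⟩
  obtain ⟨d, rfl⟩ := Nat.exists_eq_add_of_le hmk
  have hm : (0 : ℝ) < 2 ^ m := by positivity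
  have hd : (0 : ℝ) < 2 ^ d := by positivity
  obtain ⟨h2, h3⟩ := h1
  rw [pow_add, ← div_eq_mul_inv, ← div_eq_mul_inv, div_le_div_iff₀ (by positivity) (by positivity)]
    at h2 h3
  have h4 : j * 2 ^ d ≤ i := by
    have : (j : ℝ) * 2 ^ d ≤ i := by
      refine le_of_mul_le_mul_right ?_ hm
      linarith
    exact_mod_cast this
  have h5 : i + 1 ≤ (j + 1) * 2 ^ d := by
    have : (i + 1 : ℝ) ≤ (j + 1) * 2 ^ d := by
      refine le_of_mul_le_mul_right ?_ hm
      linarith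
    exact_mod_cast this
  rw [Nat.add_sub_cancel_left]
  exact Nat.div_eq_of_lt_le h4 (by omega)

lemma Icc_subset_of_index {k m i j : ℕ} (hmk : m ≤ k) (hij : i / 2 ^ (k - m) = j) :
    Set.Icc ((i : ℝ) * (2 ^ k)⁻¹) ((i + 1 : ℝ) * (2 ^ k)⁻¹) ⊆
      Set.Icc ((j : ℝ) * (2 ^ m)⁻¹) ((j + 1 : ℝ) * (2 ^ m)⁻¹) := by
  obtain ⟨d, rfl⟩ := Nat.exists_eq_add_of_le hmk
  rw [Nat.add_sub_cancel_left] at hij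
  have hm : (0 : ℝ) < 2 ^ m := by positivity
  have h4 : (j : ℝ) * 2 ^ d ≤ i := by exact_mod_cast hij ▸ Nat.div_mul_le_self i (2 ^ d)
  have h5 : (i + 1 : ℝ) ≤ (j + 1) * 2 ^ d := by
    have : i < 2 ^ d * (j + 1) := hij ▸ Nat.lt_mul_div_succ i (by positivity)
    exact_mod_cast (by rw [mul_comm]; omega : i + 1 ≤ (j + 1) * 2 ^ d)
  refine Set.Icc_subset_Icc ?_ ?_
  · rw [pow_add, ← div_eq_mul_inv, ← div_eq_mul_inv, div_le_div_iff₀ hm (by positivity)]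
    nlinarith
  · rw [pow_add, ← div_eq_mul_inv, ← div_eq_mul_inv, div_le_div_iff₀ (by positivity) hm]
    nlinarith

/-- Geometry reduces to arithmetic: an ancestor's indices are those of the square with their last
binary digits deleted. All later tree arguments rest on this form. -/
lemma carrier_subset_iff {S T : DyadicSquare} : S.carrier ⊆ T.carrier ↔
    T.1 ≤ S.1 ∧ (S.2.1 : ℕ) / 2 ^ (S.1 - T.1) = T.2.1 ∧ (S.2.2 : ℕ) / 2 ^ (S.1 - T.1) = T.2.2 := by
  constructor
  · intro h
    have hs := S.side_pos
    have hre : ((S.2.1 : ℕ) : ℝ) * S.side ∈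
        Set.Icc (((S.2.1 : ℕ) : ℝ) * S.side) (((S.2.1 : ℕ) + 1 : ℝ) * S.side) :=
      ⟨le_rfl, by nlinarith⟩
    have him : ((S.2.2 : ℕ) : ℝ) * S.side ∈
        Set.Icc (((S.2.2 : ℕ) : ℝ) * S.side) (((S.2.2 : ℕ) + 1 : ℝ) * S.side) :=
      ⟨le_rfl, by nlinarith⟩
    have h1 : Set.Icc (((S.2.1 : ℕ) : ℝ) * S.side) (((S.2.1 : ℕ) + 1 : ℝ) * S.side) ⊆
        Set.Icc (((T.2.1 : ℕ) : ℝ) * T.side) (((T.2.1 : ℕ) + 1 : ℝ) * T.side) := fun x hx =>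
      (@h ⟨x, ((S.2.2 : ℕ) : ℝ) * S.side⟩ ⟨hx, him⟩).1
    have h2 : Set.Icc (((S.2.2 : ℕ) : ℝ) * S.side) (((S.2.2 : ℕ) + 1 : ℝ) * S.side) ⊆
        Set.Icc (((T.2.2 : ℕ) : ℝ) * T.side) (((T.2.2 : ℕ) + 1 : ℝ) * T.side) := fun x hx =>
      (@h ⟨((S.2.1 : ℕ) : ℝ) * S.side, x⟩ ⟨hre, hx⟩).2
    obtain ⟨h3, h4⟩ := index_of_Icc_subset h1
    exact ⟨h3, h4, (index_of_Icc_subset h2).2⟩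
  · rintro ⟨h1, h2, h3⟩ z ⟨hz1, hz2⟩
    exact ⟨Icc_subset_of_index h1 h2 hz1, Icc_subset_of_index h1 h3 hz2⟩

lemma ext_index {S T : DyadicSquare} (h1 : S.1 = T.1) (h2 : (S.2.1 : ℕ) = T.2.1)
    (h3 : (S.2.2 : ℕ) = T.2.2) : S = T := by
  obtain ⟨k, i, j⟩ := S
  obtain ⟨k', i', j'⟩ := T
  obtain rfl : k = k' := h1
  obtain rfl : i = i' := Fin.ext h2
  obtain rfl : j = j' := Fin.ext h3
  rfl

lemma eq_of_carrier_subset {S T : DyadicSquare} (h : S.carrier ⊆ T.carrier) (hl : S.1 ≤ T.1) :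
    S = T := by
  obtain ⟨h1, h2, h3⟩ := carrier_subset_iff.1 h
  have h4 : S.1 = T.1 := le_antisymm hl h1
  rw [Nat.sub_eq_zero_of_le hl, pow_zero, Nat.div_one] at h2 h3
  exact ext_index h4 h2 h3

lemma carrier_ssubset_iff {S T : DyadicSquare} : S.carrier ⊂ T.carrier ↔
    S.carrier ⊆ T.carrier ∧ T.1 < S.1 := by
  constructor
  · intro h
    refine ⟨h.1, ?_⟩
    by_contra hl
    rw [eq_of_carrier_subset h.1 (not_lt.1 hl)] at h
    exact h.2 subset_rfl
  · rintro ⟨h, hl⟩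
    exact ⟨h, fun h' => absurd (carrier_subset_iff.1 h').1 (not_le.2 hl)⟩

lemma carrier_ssubset_of_ne {S T : DyadicSquare} (h : S.carrier ⊆ T.carrier) (hne : S ≠ T) :
    S.carrier ⊂ T.carrier :=
  carrier_ssubset_iff.2 ⟨h, lt_of_not_ge fun hl => hne (eq_of_carrier_subset h hl)⟩

/-- Two ancestors of the same square are nested. -/
lemma carrier_subset_of_common {S T U : DyadicSquare} (hT : S.carrier ⊆ T.carrier)
    (hU : S.carrier ⊆ U.carrier) (hl : T.1 ≤ U.1) : U.carrier ⊆ T.carrier := by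
  rw [carrier_subset_iff] at *
  obtain ⟨h1, h2, h3⟩ := hT
  obtain ⟨h4, h5, h6⟩ := hU
  have he : S.1 - T.1 = (S.1 - U.1) + (U.1 - T.1) := by omega
  rw [he, pow_add, ← Nat.div_div_eq_div_mul] at h2 h3
  rw [h5] at h2
  rw [h6] at h3
  exact ⟨hl, h2, h3⟩

/-- The ancestor of a square at a given coarser level. -/
lemma exists_ancestor (S : DyadicSquare) {m : ℕ} (hm : m ≤ S.1) :
    ∃ T : DyadicSquare, T.1 = m ∧ S.carrier ⊆ T.carrier := by
  have hlt : ∀ i : Fin (2 ^ S.1), (i : ℕ) / 2 ^ (S.1 - m) < 2 ^ m := fun i => by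
    rw [Nat.div_lt_iff_lt_mul (by positivity), ← pow_add]
    have := i.2
    rwa [show m + (S.1 - m) = S.1 by omega]
  exact ⟨⟨m, ⟨_, hlt S.2.1⟩, ⟨_, hlt S.2.2⟩⟩, rfl, carrier_subset_iff.2 ⟨hm, rfl, rfl⟩⟩

/-- The four children of a dyadic square. -/
def child (T : DyadicSquare) (p : Fin 2 × Fin 2) : DyadicSquare :=
  ⟨T.1 + 1, ⟨2 * T.2.1 + p.1, by rw [pow_succ]; omega⟩, ⟨2 * T.2.2 + p.2, by rw [pow_succ]; omega⟩⟩

lemma child_subset (T : DyadicSquare) (p : Fin 2 × Fin 2) : (T.child p).carrier ⊆ T.carrier := by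
  rw [carrier_subset_iff]
  have h1 := p.1.2
  have h2 := p.2.2
  refine ⟨Nat.le_succ _, ?_, ?_⟩ <;>
  · simp only [child, Nat.add_sub_cancel_left, pow_one]
    omega

lemma child_side (T : DyadicSquare) (p : Fin 2 × Fin 2) : (T.child p).side = T.side / 2 := by
  simp only [side, child, pow_succ]
  field_simp

/-- The two closed halves overlap only at the midpoint, which is excluded. In the plane the
exclusion costs two lines, a null set. -/
lemma indicator_Icc_half {i : ℕ} {s x : ℝ} (hs : 0 < s) (hx : x ≠ (2 * i + 1) * (s / 2)) :
    (Set.Icc (i * s) ((i + 1) * s)).indicator (1 : ℝ → ℝ) x = ∑ a : Fin 2,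
      (Set.Icc (((2 * i + a : ℕ) : ℝ) * (s / 2)) ((((2 * i + a : ℕ) : ℝ) + 1) * (s / 2))).indicator
        1 x := by
  simp only [Fin.sum_univ_two, Fin.val_zero, Fin.val_one, Set.indicator_apply, Set.mem_Icc,
    Pi.one_apply]
  push_cast
  rcases lt_or_gt_of_ne hx with h | h
  · have h2 : ¬ ((2 * (i : ℝ) + 1) * (s / 2) ≤ x ∧ x ≤ (2 * (i : ℝ) + 1 + 1) * (s / 2)) :=
      fun h' => absurd h'.1 (not_le.2 h)
    rw [if_neg h2, add_zero]
    congr 1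
    apply propext
    constructor
    · rintro ⟨h3, h4⟩
      exact ⟨by linarith, by linarith⟩
    · rintro ⟨h3, h4⟩
      exact ⟨by linarith, by linarith⟩
  · have h2 : ¬ ((2 * (i : ℝ) + 0) * (s / 2) ≤ x ∧ x ≤ (2 * (i : ℝ) + 0 + 1) * (s / 2)) :=
      fun h' => absurd h'.2 (not_le.2 (by linarith))
    rw [if_neg h2, zero_add]
    congr 1
    apply propext
    constructor
    · rintro ⟨h3, h4⟩
      exact ⟨by linarith, by linarith⟩
    · rintro ⟨h3, h4⟩
      exact ⟨by linarith, by linarith⟩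

lemma ind_eq_mul (S : DyadicSquare) (z : ℂ) : S.ind z =
    (Set.Icc ((S.2.1 : ℕ) * S.side) (((S.2.1 : ℕ) + 1) * S.side)).indicator 1 z.re *
    (Set.Icc ((S.2.2 : ℕ) * S.side) (((S.2.2 : ℕ) + 1) * S.side)).indicator 1 z.im := by
  rw [ind, carrier_eq, Set.inter_indicator_one]
  rfl

end DyadicSquare

lemma quasiMeasurePreserving_re : Measure.QuasiMeasurePreserving Complex.re :=
  Measure.quasiMeasurePreserving_fst.comp
    Complex.volume_preserving_equiv_real_prod.quasiMeasurePreserving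

lemma quasiMeasurePreserving_im : Measure.QuasiMeasurePreserving Complex.im :=
  Measure.quasiMeasurePreserving_snd.comp
    Complex.volume_preserving_equiv_real_prod.quasiMeasurePreserving

lemma ae_re_ne (c : ℝ) : ∀ᵐ z : ℂ, z.re ≠ c :=
  quasiMeasurePreserving_re.ae (Measure.ae_ne volume c)

lemma ae_im_ne (c : ℝ) : ∀ᵐ z : ℂ, z.im ≠ c :=
  quasiMeasurePreserving_im.ae (Measure.ae_ne volume c)

namespace DyadicSquare

lemma ind_ae_eq_sum_child (T : DyadicSquare) :
    ∀ᵐ z : ℂ, T.ind z = ∑ p : Fin 2 × Fin 2, (T.child p).ind z := by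
  filter_upwards [ae_re_ne ((2 * (T.2.1 : ℕ) + 1) * (T.side / 2)),
    ae_im_ne ((2 * (T.2.2 : ℕ) + 1) * (T.side / 2))] with z h1 h2
  simp only [ind_eq_mul, child_side]
  rw [indicator_Icc_half T.side_pos h1, indicator_Icc_half T.side_pos h2, Finset.sum_mul_sum,
    Fintype.sum_prod_type]
  rfl

/-- Distinct squares of one level differ in some index, so a common point lies on a grid line. -/
lemma volume_inter_eq_zero_of_level_eq {S T : DyadicSquare} (hl : S.1 = T.1) (hne : S ≠ T) :
    volume (S.carrier ∩ T.carrier) = 0 := by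
  have hside : S.side = T.side := by rw [side, side, hl]
  have hs := T.side_pos
  have hkey : ∀ {i j : ℕ} {x : ℝ}, i < j → x ≤ ((i : ℝ) + 1) * T.side → (j : ℝ) * T.side ≤ x →
      x = j * T.side := by
    intro i j x hij h1 h2
    have : (i : ℝ) + 1 ≤ j := by exact_mod_cast hij
    nlinarith
  rw [measure_eq_zero_iff_ae_notMem]
  filter_upwards [ae_re_ne ((S.2.1 : ℕ) * T.side), ae_re_ne ((T.2.1 : ℕ) * T.side),
    ae_im_ne ((S.2.2 : ℕ) * T.side), ae_im_ne ((T.2.2 : ℕ) * T.side)] with z h1 h2 h3 h4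
  rintro ⟨⟨⟨h5, h6⟩, h7, h8⟩, ⟨h9, h10⟩, h11, h12⟩
  rw [hside] at h5 h6 h7 h8
  by_cases hre : (S.2.1 : ℕ) = T.2.1
  · have him : (S.2.2 : ℕ) ≠ T.2.2 := fun him => hne (ext_index hl hre him)
    rcases lt_or_gt_of_ne him with h | h
    · exact h4 (hkey h h8 h11)
    · exact h3 (hkey h h12 h7)
  · rcases lt_or_gt_of_ne hre with h | h
    · exact h2 (hkey h h6 h9)
    · exact h1 (hkey h h10 h5)

/-- Replace the finer square by its ancestor at the coarser level. This ancestor differs from the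
other square, as the two are not nested, so the case of equal levels applies. -/
lemma volume_inter_eq_zero {S T : DyadicSquare} (hne : S ≠ T) (h1 : ¬ S.carrier ⊂ T.carrier)
    (h2 : ¬ T.carrier ⊂ S.carrier) : volume (S.carrier ∩ T.carrier) = 0 := by
  wlog hl : S.1 ≤ T.1 generalizing S T
  · rw [Set.inter_comm]
    exact this hne.symm h2 h1 (not_le.1 hl).le
  obtain ⟨U, hU, hTU⟩ := T.exists_ancestor hl
  have hSU : S ≠ U := by
    rintro rfl
    exact h2 (carrier_ssubset_of_ne hTU hne.symm)
  exact measure_mono_null (Set.inter_subset_inter_right _ hTU)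
    (volume_inter_eq_zero_of_level_eq hU.symm hSU)

end DyadicSquare

end LQG

end

/-! ### Change of measure for rescaled Gaussian vectors. -/

noncomputable section

namespace LQG

/-! ## Scaling of Gaussian vectors -/

section Scaling

variable {ι : Type*} [Fintype ι]

/-- Checked on boxes, where independence of the coordinates factors the integral. -/
lemma pi_withDensity (μ : ι → Measure ℝ) [∀ i, IsProbabilityMeasure (μ i)] {f : ι → ℝ → ℝ≥0∞}
    (hf : ∀ i, Measurable (f i)) [∀ i, SigmaFinite ((μ i).withDensity (f i))] :
    Measure.pi (fun i => (μ i).withDensity (f i)) =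
      (Measure.pi μ).withDensity fun x => ∏ i, f i (x i) := by
  refine (Measure.pi_eq fun s hs => ?_)
  rw [withDensity_apply _ (MeasurableSet.univ_pi hs), ← lintegral_indicator
    (MeasurableSet.univ_pi hs)]
  have h1 : ∀ x : ι → ℝ, (Set.univ.pi s).indicator (fun x => ∏ i, f i (x i)) x =
      ∏ i, (s i).indicator (f i) (x i) := by
    intro x
    by_cases hx : x ∈ Set.univ.pi s
    · rw [Set.indicator_of_mem hx]
      exact Finset.prod_congr rfl fun i _ => (Set.indicator_of_mem (hx i trivial) _).symm
    · rw [Set.indicator_of_notMem hx]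
      simp only [Set.mem_univ_pi, not_forall] at hx
      obtain ⟨i, hi⟩ := hx
      exact (Finset.prod_eq_zero (Finset.mem_univ i) (Set.indicator_of_notMem hi _)).symm
  simp only [h1]
  have hm : ∀ i, Measurable ((s i).indicator (f i)) := fun i => (hf i).indicator (hs i)
  rw [lintegral_prod_eq_prod_lintegral_of_indepFun Finset.univ
    (fun i (x : ι → ℝ) => (s i).indicator (f i) (x i))
    (iIndepFun_pi (X := fun i => (s i).indicator (f i)) fun i => (hm i).aemeasurable)
    fun i => (hm i).comp (measurable_pi_apply i)]
  refine Finset.prod_congr rfl fun i _ => ?_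
  rw [(measurePreserving_eval μ i).lintegral_comp (hm i), lintegral_indicator (hs i),
    withDensity_apply _ (hs i)]

/-- The density of `N(0, b⁻²)` with respect to `N(0, a⁻²)`. -/
lemma gaussianReal_scaling {a b : ℝ} (ha : 0 < a) (hb : 0 < b) :
    (gaussianReal 0 1).map (· / b) = ((gaussianReal 0 1).map (· / a)).withDensity fun x =>
      ENNReal.ofReal (b / a * Real.exp ((a ^ 2 - b ^ 2) / 2 * x ^ 2)) := by
  have hv : ∀ {d : ℝ}, 0 < d → (1 / NNReal.mk (d ^ 2) (sq_nonneg _) : NNReal) ≠ 0 := by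
    intro d hd
    refine div_ne_zero one_ne_zero fun h => ?_
    have := congrArg NNReal.toReal h
    simp at this
    exact hd.ne' this
  have hpdf : ∀ {d : ℝ}, 0 < d → ∀ x, gaussianPDFReal 0
      (1 / NNReal.mk (d ^ 2) (sq_nonneg _)) x =
      d * (√(2 * Real.pi))⁻¹ * Real.exp (-(d ^ 2 * x ^ 2) / 2) := by
    intro d hd x
    rw [gaussianPDFReal]
    have h1 : ((1 / NNReal.mk (d ^ 2) (sq_nonneg _) : NNReal) : ℝ) = (d ^ 2)⁻¹ := by simp
    rw [h1, Real.sqrt_mul (by positivity), Real.sqrt_inv, Real.sqrt_sq hd.le, mul_inv, inv_inv,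
      sub_zero]
    congr 1
    · ring
    · congr 1
      field_simp
  rw [gaussianReal_map_div_const, gaussianReal_map_div_const, zero_div, zero_div,
    gaussianReal_of_var_ne_zero _ (hv ha), gaussianReal_of_var_ne_zero _ (hv hb),
    ← withDensity_mul _ (measurable_gaussianPDF _ _) (by fun_prop)]
  congr 1
  ext x
  rw [Pi.mul_apply, gaussianPDF, gaussianPDF, hpdf ha, hpdf hb, ← ENNReal.ofReal_mul (by positivity)]
  congr 1
  have h2 : Real.exp (-(b ^ 2 * x ^ 2) / 2) =
      Real.exp (-(a ^ 2 * x ^ 2) / 2) * Real.exp ((a ^ 2 - b ^ 2) / 2 * x ^ 2) := by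
    rw [← Real.exp_add]
    congr 1
    ring
  rw [h2]
  field_simp

/-- Each coordinate contributes the density ratio of `gaussianReal_scaling`. The factors b/a
multiply to a power depending only on the dimension, which is why only the number of squares enters
later. -/
lemma lintegral_pi_gaussianReal_scaling {a b : ℝ} (ha : 0 < a) (hb : 0 < b)
    {g : (ι → ℝ) → ℝ≥0∞} (hg : Measurable g) :
    ∫⁻ x : ι → ℝ, g (fun i => x i / b) ∂(Measure.pi fun _ => gaussianReal 0 1) =
      ENNReal.ofReal ((b / a) ^ Fintype.card ι) *
        ∫⁻ x : ι → ℝ, g (fun i => x i / a) * ENNReal.ofReal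
          (Real.exp ((a ^ 2 - b ^ 2) / 2 * ∑ i, (x i / a) ^ 2))
          ∂(Measure.pi fun _ => gaussianReal 0 1) := by
  have hmap : ∀ d : ℝ, (Measure.pi fun _ : ι => gaussianReal 0 1).map (fun x i => x i / d) =
      Measure.pi fun _ => (gaussianReal 0 1).map (· / d) := fun d =>
    Measure.pi_map_pi (μ := fun _ => gaussianReal 0 1) (f := fun _ x => x / d)
      fun _ => (measurable_id.div_const d).aemeasurable
  have hp : ∀ d : ℝ, IsProbabilityMeasure ((gaussianReal 0 1).map (· / d)) := fun d =>
    Measure.isProbabilityMeasure_map (by fun_prop)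
  set D : ℝ → ℝ≥0∞ := fun x => ENNReal.ofReal (b / a * Real.exp ((a ^ 2 - b ^ 2) / 2 * x ^ 2))
  have hD : Measurable D := by fun_prop
  have hsf : SigmaFinite (((gaussianReal 0 1).map (· / a)).withDensity D) := by
    rw [← gaussianReal_scaling ha hb]
    infer_instance
  have hpr : ∀ x : ι → ℝ, ∏ i, D (x i) = ENNReal.ofReal ((b / a) ^ Fintype.card ι) *
      ENNReal.ofReal (Real.exp ((a ^ 2 - b ^ 2) / 2 * ∑ i, (x i) ^ 2)) := by
    intro x
    rw [← ENNReal.ofReal_prod_of_nonneg fun i _ => by positivity, Finset.prod_mul_distrib,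
      ← Real.exp_sum, ← Finset.mul_sum, Finset.prod_const, Finset.card_univ,
      ENNReal.ofReal_mul (by positivity)]
  rw [← lintegral_map (f := g) hg (by fun_prop), hmap, gaussianReal_scaling ha hb,
    pi_withDensity _ fun _ => hD,
    lintegral_withDensity_eq_lintegral_mul _ (Finset.measurable_fun_prod _ fun i _ => by fun_prop) hg,
    ← hmap, lintegral_map (by fun_prop) (by fun_prop),
    ← lintegral_const_mul _ (by fun_prop)]
  refine lintegral_congr fun x => ?_
  simp only [Pi.mul_apply, hpr]
  ring

end Scaling

section Whitening

open Matrix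
open scoped MatrixOrder

variable {ι : Type*} [Fintype ι] [DecidableEq ι] {Ω : Type*} [MeasurableSpace Ω] {P : Measure Ω}

/-- A centred Gaussian vector with invertible covariance matrix is a linear image of a standard
one. -/
lemma exists_whitening {Y : ι → Ω → ℝ} (hm : ∀ i, Measurable (Y i))
    (hY : HasGaussianLaw (fun ω i => Y i ω) P) (hc : ∀ i, ∫ ω, Y i ω ∂P = 0) {Γ : Matrix ι ι ℝ}
    (hΓ : Γ.PosDef) (hcov : ∀ i j, covariance (Y i) (Y j) P = Γ i j) :
    ∃ A L : Matrix ι ι ℝ, A * L = 1 ∧ Lᵀ * L = Γ⁻¹ ∧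
      P.map (fun ω => L.mulVec fun i => Y i ω) = Measure.pi fun _ => gaussianReal 0 1 := by
  have := hY.isProbabilityMeasure
  -- Factor Γ = BᵀB. Then L = (Bᵀ)⁻¹ satisfies LΓLᵀ = 1 and LᵀL = Γ⁻¹, so it whitens the vector.
  obtain ⟨B, hB⟩ := CStarAlgebra.nonneg_iff_eq_star_mul_self.1
    hΓ.posSemidef.nonneg
  rw [star_eq_conjTranspose, conjTranspose_eq_transpose_of_trivial] at hB
  have hdet : IsUnit B.det := by
    have h1 := hΓ.det_pos
    rw [hB, det_mul, det_transpose] at h1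
    exact isUnit_iff_ne_zero.2 fun h => by simp [h] at h1
  have hdetT : IsUnit Bᵀ.det := by rwa [det_transpose]
  set L := Bᵀ⁻¹
  have hLΓ : L * Γ * Lᵀ = 1 := by
    rw [hB, ← mul_assoc, nonsing_inv_mul _ hdetT, one_mul, transpose_nonsing_inv,
      transpose_transpose, mul_nonsing_inv _ hdet]
  refine ⟨Bᵀ, L, mul_nonsing_inv _ hdetT, ?_, ?_⟩
  · rw [hB, Matrix.mul_inv_rev, transpose_nonsing_inv, transpose_transpose]
  · set ξ : ι → Ω → ℝ := fun i ω => ∑ j, L i j * Y j ω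
    have hξm : ∀ i, Measurable (ξ i) := fun i =>
      Finset.measurable_sum _ fun j _ => (hm j).const_mul _
    have hξG : HasGaussianLaw (fun ω i => ξ i ω) P :=
      hY.map_fun (LinearMap.toContinuousLinearMap (Matrix.mulVecLin L))
    have hL2 : ∀ j, MemLp (Y j) 2 P := fun j => (hY.eval j).memLp_two
    have hξcov : ∀ i k, covariance (ξ i) (ξ k) P = (1 : Matrix ι ι ℝ) i k := by
      intro i k
      rw [covariance_fun_sum_fun_sum' (fun j _ => (hL2 j).const_mul _)
        (fun j _ => (hL2 j).const_mul _), ← hLΓ, mul_apply, Finset.sum_comm]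
      refine Finset.sum_congr rfl fun j _ => ?_
      rw [mul_apply, Finset.sum_mul]
      refine Finset.sum_congr rfl fun l _ => ?_
      rw [covariance_const_mul_left, covariance_const_mul_right, hcov, transpose_apply]
      ring
    have hξc : ∀ i, ∫ ω, ξ i ω ∂P = 0 := fun i => by
      rw [integral_finsetSum _ fun j _ => ((hL2 j).integrable (by norm_num)).const_mul _]
      simp [integral_const_mul, hc]
    -- For jointly Gaussian variables, vanishing covariances imply independence.
    have hind : iIndepFun ξ P := hξG.iIndepFun_of_covariance_eq_zero fun i j hij => by
      rw [hξcov, one_apply_ne hij]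
    have hmap := (iIndepFun_iff_map_fun_eq_pi_map fun i => (hξm i).aemeasurable).1 hind
    change P.map (fun ω i => ξ i ω) = _
    rw [hmap]
    congr 1
    ext1 i
    rw [(hξG.eval i).map_eq_gaussianReal, hξc, ← covariance_self (hξm i).aemeasurable, hξcov,
      one_apply_eq, Real.toNNReal_one]

/-- Changing the scale of a Gaussian vector amounts to a change of measure. -/
theorem lintegral_gaussian_scaling {Y : ι → Ω → ℝ} (hm : ∀ i, Measurable (Y i))
    (hY : HasGaussianLaw (fun ω i => Y i ω) P) (hc : ∀ i, ∫ ω, Y i ω ∂P = 0) {Γ : Matrix ι ι ℝ}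
    (hΓ : Γ.PosDef) (hcov : ∀ i j, covariance (Y i) (Y j) P = Γ i j) {a b : ℝ} (ha : 0 < a)
    (hb : 0 < b) {g : (ι → ℝ) → ℝ≥0∞} (hg : Measurable g) :
    ∫⁻ ω, g (fun i => Y i ω / b) ∂P = ENNReal.ofReal ((b / a) ^ Fintype.card ι) *
      ∫⁻ ω, g (fun i => Y i ω / a) * ENNReal.ofReal (Real.exp ((a ^ 2 - b ^ 2) / 2 *
        ((fun i => Y i ω / a) ⬝ᵥ Γ⁻¹.mulVec fun i => Y i ω / a))) ∂P := by
  obtain ⟨A, L, hAL, hLL, hlaw⟩ := exists_whitening hm hY hc hΓ hcov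
  have hLm : Measurable fun ω => L.mulVec fun i => Y i ω :=
    (LinearMap.continuous_of_finiteDimensional (Matrix.mulVecLin L)).measurable.comp
      (measurable_pi_lambda _ hm)
  have hAm : Measurable fun x : ι → ℝ => A.mulVec x :=
    (LinearMap.continuous_of_finiteDimensional (Matrix.mulVecLin A)).measurable
  have hdiv : ∀ (d : ℝ) (y : ι → ℝ), (fun i => y i / d) = d⁻¹ • y := fun d y => by
    ext i
    simp [div_eq_inv_mul]
  have hback : ∀ (d : ℝ) (ω : Ω), (fun i => Y i ω / d) =
      A.mulVec fun i => (L.mulVec fun i => Y i ω) i / d := fun d ω => by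
    rw [hdiv, hdiv, mulVec_smul, mulVec_mulVec, hAL, one_mulVec]
  -- As Γ⁻¹ = LᵀL, the quadratic form of the density is the squared length of the whitened vector.
  have hquad : ∀ (ω : Ω), ((fun i => Y i ω / a) ⬝ᵥ Γ⁻¹.mulVec fun i => Y i ω / a) =
      ∑ i, ((L.mulVec fun i => Y i ω) i / a) ^ 2 := fun ω => by
    have h1 : (fun i => (L.mulVec fun i => Y i ω) i / a) = L.mulVec fun i => Y i ω / a := by
      rw [hdiv, hdiv, mulVec_smul]
    rw [← hLL, ← mulVec_mulVec, dotProduct_mulVec, vecMul_transpose, ← h1, dotProduct]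
    exact Finset.sum_congr rfl fun i _ => (sq _).symm
  simp only [hquad]
  simp only [hback]
  have hs := lintegral_pi_gaussianReal_scaling ha hb (hg.comp hAm)
  have hgd : ∀ d : ℝ, Measurable fun x : ι → ℝ => (g ∘ fun x => A *ᵥ x) fun i => x i / d :=
    fun d => (hg.comp hAm).comp (by fun_prop)
  have hga : Measurable fun x : ι → ℝ => (g ∘ fun x => A *ᵥ x) (fun i => x i / a) *
      ENNReal.ofReal (Real.exp ((a ^ 2 - b ^ 2) / 2 * ∑ i, (x i / a) ^ 2)) :=
    (hgd a).mul (by fun_prop)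
  rw [← hlaw, lintegral_map (hgd b) hLm, lintegral_map hga hLm] at hs
  exact hs

end Whitening

end LQG

end

/-! ### Subdivisions as finite covers, read off from finitely many masses. -/

noncomputable section

namespace LQG

/-! ## Subdivisions -/

/-- Every sufficiently small dyadic square is contained in a member of `F`. -/
def IsDyadicCover (F : Finset DyadicSquare) : Prop :=
  ∀ D : DyadicSquare, (∀ S ∈ F, S.1 < D.1) → ∃ S ∈ F, D.carrier ⊆ S.carrier

/-- No member of `F` is strictly contained in another one. -/
def IsDyadicAntichain (F : Finset DyadicSquare) : Prop :=
  ∀ S ∈ F, ∀ T ∈ F, ¬ S.carrier ⊂ T.carrier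

lemma IsDyadicAntichain.aeDisjointSquares {F : Finset DyadicSquare} (hF : IsDyadicAntichain F) :
    AEDisjointSquares F := fun S hS T hT hne =>
  DyadicSquare.volume_inter_eq_zero hne (hF S hS T hT) (hF T hT S hS)

/-- The mass of a square is the sum of the masses of its children. -/
def IsAdditiveMass (y : DyadicSquare → ℝ) : Prop :=
  ∀ T : DyadicSquare, y T = ∑ p, y (T.child p)

/-- An additive mass on the members of a cover determines the mass of all coarser squares. -/
lemma IsDyadicCover.exists_linearMap {F : Finset DyadicSquare} (hF : IsDyadicCover F)
    (T : DyadicSquare) (hT : ∀ S ∈ F, ¬ T.carrier ⊂ S.carrier) :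
    ∃ l : (F → ℝ) →ₗ[ℝ] ℝ, ∀ y, IsAdditiveMass y → y T = l fun S => y S := by
  set N := F.sup (fun S => S.1) with hN
  -- Induction from fine levels to coarse ones. Truncated subtraction makes the shift by 1
  -- necessary: the quantity must still drop when T has level exactly N.
  induction hd : N + 1 - T.1 using Nat.strong_induction_on generalizing T with
  | _ d ih =>
    by_cases hTF : T ∈ F
    · exact ⟨LinearMap.proj ⟨T, hTF⟩, fun y _ => rfl⟩
    -- A square finer than every member lies in a member by the covering property. It would then be
    -- that member or strictly inside it, and both are excluded.
    have hle : T.1 ≤ N := by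
      by_contra hlt
      obtain ⟨S, hS, hTS⟩ := hF T fun S hS =>
        (Finset.le_sup (f := fun S : DyadicSquare => S.1) hS).trans_lt (not_le.1 hlt)
      refine hT S hS (DyadicSquare.carrier_ssubset_of_ne hTS ?_)
      rintro rfl
      exact hTF hS
    have hchild : ∀ p, ∃ l : (F → ℝ) →ₗ[ℝ] ℝ,
        ∀ y, IsAdditiveMass y → y (T.child p) = l fun S => y S := by
      intro p
      refine ih (N + 1 - (T.child p).1) ?_ (T.child p) (fun S hS hpS => ?_) rfl
      · have : (T.child p).1 = T.1 + 1 := rfl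
        omega
      -- A member strictly containing a child contains the parent T as well. Since T is not a
      -- member, it would contain T strictly, against the hypothesis on T.
      · obtain ⟨h1, h2⟩ := DyadicSquare.carrier_ssubset_iff.1 hpS
        have h3 : S.1 ≤ T.1 := Nat.lt_succ_iff.1 h2
        refine hT S hS (DyadicSquare.carrier_ssubset_of_ne
          (DyadicSquare.carrier_subset_of_common h1 (T.child_subset p) h3) ?_)
        rintro rfl
        exact hTF hS
    choose l hl using hchild
    refine ⟨∑ p, l p, fun y hy => ?_⟩
    rw [hy T, LinearMap.sum_apply]
    exact Finset.sum_congr rfl fun p _ => hl p y hy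

lemma DyadicSquare.exists_descendant (T : DyadicSquare) (i : ℕ) :
    ∃ D : DyadicSquare, D.1 = T.1 + i ∧ D.carrier ⊆ T.carrier := by
  induction i with
  | zero => exact ⟨T, rfl, subset_rfl⟩
  | succ i ih =>
    obtain ⟨D, h1, h2⟩ := ih
    exact ⟨D.child 0, by rw [← add_assoc, ← h1]; rfl, (D.child_subset 0).trans h2⟩

/-- The value at a square is the mean over its four children, so some child does not exceed it;
iterate. -/
lemma DyadicSquare.exists_descendant_le {h : DyadicSquare → ℝ}
    (hh : ∀ T, 4 * h T = ∑ p, h (T.child p)) (T : DyadicSquare) (i : ℕ) :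
    ∃ D : DyadicSquare, D.1 = T.1 + i ∧ D.carrier ⊆ T.carrier ∧ h D ≤ h T := by
  induction i with
  | zero => exact ⟨T, rfl, subset_rfl, le_rfl⟩
  | succ i ih =>
    obtain ⟨D, h1, h2, h3⟩ := ih
    obtain ⟨p, -, hp⟩ : ∃ p ∈ (Finset.univ : Finset (Fin 2 × Fin 2)), h (D.child p) ≤ h D := by
      refine Finset.exists_le_of_sum_le Finset.univ_nonempty ?_
      rw [← hh D]
      simp
    exact ⟨D.child p, by rw [← add_assoc, ← h1]; rfl, (D.child_subset p).trans h2, hp.trans h3⟩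

variable {σ₀ : ℂ → ℝ} {Ω : Type*} {X : H10 σ₀ → Ω → ℝ} {c ε : ℝ} {ω : Ω}

/-- The linear relations between square averages that hold almost surely. -/
structure IsRegularPoint (X : H10 σ₀ → Ω → ℝ) (ω : Ω) : Prop where
  average : ∀ S, squareAverage X S ω = (S.side ^ 2)⁻¹ * squareMass X S ω
  mass : IsAdditiveMass fun S => squareMass X S ω

lemma IsRegularPoint.four_mul_average (h : IsRegularPoint X ω) (T : DyadicSquare) :
    4 * squareAverage X T ω = ∑ p, squareAverage X (T.child p) ω := by
  simp only [h.average, DyadicSquare.child_side, ← Finset.mul_sum]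
  rw [← show squareMass X T ω = ∑ p, squareMass X (T.child p) ω from h.mass T]
  have := T.side_pos
  field_simp
  ring

/-- Take the coarsest square containing S whose size is at most ε. -/
lemma exists_mem_subdivision {S : DyadicSquare} (h : squareSize X c S ω ≤ ε) :
    ∃ T ∈ subdivision X c ε ω, S.carrier ⊆ T.carrier := by
  classical
  have hex : ∃ m, ∃ T : DyadicSquare, T.1 = m ∧ S.carrier ⊆ T.carrier ∧ squareSize X c T ω ≤ ε :=
    ⟨_, S, rfl, subset_rfl, h⟩
  obtain ⟨T, h1, h2, h3⟩ := Nat.find_spec hex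
  refine ⟨T, ⟨h3, fun U hU => lt_of_not_ge fun h4 => ?_⟩, h2⟩
  obtain ⟨h5, h6⟩ := DyadicSquare.carrier_ssubset_iff.1 hU
  exact Nat.find_min hex (h1 ▸ h6) ⟨U, rfl, h2.trans h5, h4⟩

lemma isDyadicAntichain_of_subdivision_eq {F : Finset DyadicSquare}
    (hF : subdivision X c ε ω = F) : IsDyadicAntichain F := by
  intro S hS T hT hST
  rw [← Finset.mem_coe, ← hF] at hS hT
  exact absurd hT.1 (not_le.2 (hS.2 T hST))

/-- The averages on a decreasing sequence of squares cannot all be large, as the average on some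
child is at most the average on the parent. -/
lemma isDyadicCover_of_subdivision_eq (h : IsRegularPoint X ω) (hε : 0 < ε)
    {F : Finset DyadicSquare} (hF : subdivision X c ε ω = F) : IsDyadicCover F := by
  intro D hD
  by_contra hno
  have hlarge : ∀ E : DyadicSquare, E.carrier ⊆ D.carrier → ε < squareSize X c E ω := by
    intro E hE
    by_contra hsmall
    obtain ⟨T, hT, hET⟩ := exists_mem_subdivision (not_lt.1 hsmall)
    rw [hF, Finset.mem_coe] at hT
    exact hno ⟨T, hT, DyadicSquare.carrier_subset_of_common hET hE (hD T hT).le⟩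
  set K := Real.exp (squareAverage X D ω / backgroundCharge c) * D.side
  have hK : 0 < K := mul_pos (Real.exp_pos _) D.side_pos
  obtain ⟨i, hi⟩ := exists_pow_lt_of_lt_one (div_pos hε hK) (by norm_num : (1 / 2 : ℝ) < 1)
  obtain ⟨E, h1, h2, h3⟩ := DyadicSquare.exists_descendant_le h.four_mul_average D i
  have h4 := hlarge E h2
  have hside : E.side = D.side * (1 / 2) ^ i := by
    rw [DyadicSquare.side, DyadicSquare.side, h1, pow_add, mul_inv, one_div, inv_pow]
  have h5 : squareSize X c E ω ≤ K * (1 / 2) ^ i := by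
    rw [squareSize, hside, ← mul_assoc]
    have := D.side_pos
    have hQ : 0 ≤ backgroundCharge c := Real.sqrt_nonneg _
    simp only [K]
    gcongr
  rw [lt_div_iff₀ hK] at hi
  linarith

/-- For a cover it suffices that F is contained in the subdivision. A square S of the subdivision
has a deep descendant inside some member U of F, so S and U are nested, and the minimality
conditions for both force S = U. Thus the event constrains only members of F and their ancestors. -/
lemma subdivision_eq_iff {F : Finset DyadicSquare} (hF : IsDyadicCover F) :
    subdivision X c ε ω = F ↔ ∀ S ∈ F, squareSize X c S ω ≤ ε ∧
      ∀ T : DyadicSquare, S.carrier ⊂ T.carrier → ε < squareSize X c T ω := by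
  constructor
  · intro h S hS
    rw [← Finset.mem_coe, ← h] at hS
    exact hS
  · intro h
    refine Set.Subset.antisymm (fun S hS => ?_) fun S hS => h S hS
    obtain ⟨D, h1, h2⟩ := S.exists_descendant (F.sup (fun S => S.1) + 1)
    obtain ⟨U, hU, hDU⟩ := hF D fun V hV => by
      have := Finset.le_sup (f := fun S : DyadicSquare => S.1) hV
      omega
    rcases le_total S.1 U.1 with hl | hl
    · have h3 := DyadicSquare.carrier_subset_of_common h2 hDU hl
      by_cases hne : U = S
      · exact hne ▸ hU
      · exact absurd hS.1 (not_le.2 ((h U hU).2 S (DyadicSquare.carrier_ssubset_of_ne h3 hne)))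
    · have h3 := DyadicSquare.carrier_subset_of_common hDU h2 hl
      by_cases hne : S = U
      · exact hne ▸ hU
      · exact absurd (h U hU).1 (not_le.2 (hS.2 U (DyadicSquare.carrier_ssubset_of_ne h3 hne)))

/-- The event that the subdivision equals `F` depends only on the masses of the squares in `F`,
divided by the background charge. -/
lemma exists_subdivision_set {F : Finset DyadicSquare} (hA : IsDyadicAntichain F)
    (hF : IsDyadicCover F) (ε : ℝ) : ∃ B : Set (F → ℝ), MeasurableSet B ∧
      ∀ {Ω : Type*} (X : H10 σ₀ → Ω → ℝ) (c : ℝ) (ω : Ω), IsRegularPoint X ω →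
        (subdivision X c ε ω = F ↔ (fun S : F => squareMass X S ω / backgroundCharge c) ∈ B) := by
  -- Squares strictly inside a member of F get the dummy functional 0; their sizes do not enter the
  -- event.
  have hex : ∀ T : DyadicSquare, ∃ l : (F → ℝ) →ₗ[ℝ] ℝ, (∀ S ∈ F, ¬ T.carrier ⊂ S.carrier) →
      ∀ y, IsAdditiveMass y → y T = l fun S => y S := by
    intro T
    by_cases hT : ∀ S ∈ F, ¬ T.carrier ⊂ S.carrier
    · obtain ⟨l, hl⟩ := hF.exists_linearMap T hT
      exact ⟨l, fun _ => hl⟩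
    · exact ⟨0, fun h => absurd h hT⟩
  choose l hl using hex
  have hlm : ∀ T, Measurable (l T) := fun T =>
    (LinearMap.continuous_of_finiteDimensional (l T)).measurable
  set f : DyadicSquare → (F → ℝ) → ℝ := fun T z => Real.exp ((T.side ^ 2)⁻¹ * l T z) * T.side
  have hfm : ∀ T, Measurable (f T) := fun T =>
    (Real.measurable_exp.comp ((hlm T).const_mul _)).mul_const _
  refine ⟨⋂ S ∈ F, ({z | f S z ≤ ε} ∩ ⋂ (T : DyadicSquare) (_ : S.carrier ⊂ T.carrier),
    {z | ε < f T z}), ?_, fun X c ω hω => ?_⟩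
  · refine MeasurableSet.biInter (Set.to_countable _) fun S _ =>
      (measurableSet_le (hfm S) measurable_const).inter ?_
    exact MeasurableSet.iInter fun T => MeasurableSet.iInter fun _ =>
      measurableSet_lt measurable_const (hfm T)
  -- Linearity moves the factor 1/Q from the average into the mass vector. Hence the set B does not
  -- depend on the central charge.
  · have hsize : ∀ T, (∀ S ∈ F, ¬ T.carrier ⊂ S.carrier) →
        f T (fun S : F => squareMass X S ω / backgroundCharge c) = squareSize X c T ω := by
      intro T hT
      have h1 := hl T hT _ hω.mass
      have h2 : (fun S : F => squareMass X S ω / backgroundCharge c) =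
          (backgroundCharge c)⁻¹ • fun S : F => squareMass X S ω := by
        ext S
        simp [div_eq_inv_mul]
      simp only [f]
      rw [h2, map_smul, ← h1, squareSize, hω.average, smul_eq_mul]
      congr 2
      ring
    rw [subdivision_eq_iff hF]
    simp only [Set.mem_iInter, Set.mem_inter_iff, Set.mem_ofPred_eq]
    refine forall₂_congr fun S hS => and_congr ?_ (forall₂_congr fun T hST => ?_)
    · rw [hsize S (hA S hS)]
    · rw [hsize T fun U hU hTU => hA S hS U hU (hST.trans hTU)]

lemma IsGFF.ae_isRegularPoint [MeasurableSpace Ω] {P : Measure Ω} (hX : IsGFF X P)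
    (hσ : IsSmoothSphereMetric σ₀) (hflat : ∀ᶠ z in 𝓝ˢ unitSquare, σ₀ z = 0) :
    ∀ᵐ ω ∂P, IsRegularPoint X ω := by
  have h1 := ae_all_iff.2 fun S => hX.squareAverage_ae_eq hσ hflat S
  have h2 : ∀ᵐ ω ∂P, ∀ T : DyadicSquare,
      squareMass X T ω = ∑ p, squareMass X (T.child p) ω := by
    refine ae_all_iff.2 fun T => ?_
    -- The index `none` carries the parent with coefficient -1, and the remaining indices carry the
    -- children with coefficient 1.
    have h := hX.squareMass_sum_ae_eq_zero hσ hflat Finset.univ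
      (fun o : Option (Fin 2 × Fin 2) => o.elim (-1) fun _ => 1) (fun o => o.elim T T.child) (by
        filter_upwards [T.ind_ae_eq_sum_child] with z hz
        simp [Fintype.sum_option, hz])
    filter_upwards [h] with ω hω
    simp only [Fintype.sum_option, Option.elim_none, Option.elim_some, one_mul] at hω
    linarith
  filter_upwards [h1, h2] with ω hω1 hω2 using ⟨hω1, hω2⟩

end LQG

end

/-! ### Dependence of metric, determinant and event on the mass vector; measurability. -/

noncomputable section

namespace LQG

variable {σ₀ : ℂ → ℝ}

/-! ## The normalized metric as a function of the field -/

lemma sphereArea_pos (hσ : IsSmoothSphereMetric σ₀) (s : C(OnePoint ℂ, ℝ)) :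
    0 < sphereArea σ₀ s := by
  have : NeZero (vol σ₀) := ⟨fun h => vol_univ_ne_zero hσ (by rw [h]; rfl)⟩
  refine integral_exp_pos ?_
  set k : C(OnePoint ℂ, ℝ) := ⟨fun p => Real.exp (2 * s p), by fun_prop⟩
  exact integrable_of_continuousMap hσ k

/-- Composition with the exponential is continuous for uniform convergence, and integration is
Lipschitz since the total area is finite. -/
lemma continuous_sphereArea (hσ : IsSmoothSphereMetric σ₀) : Continuous (sphereArea σ₀) := by
  have hfin := isFiniteMeasure_vol hσ
  set e : C(ℝ, ℝ) := ⟨fun x => Real.exp (2 * x), by fun_prop⟩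
  have h1 : Continuous fun s : C(OnePoint ℂ, ℝ) => e.comp s := ContinuousMap.continuous_postcomp e
  have h2 : LipschitzWith ((vol σ₀).real Set.univ).toNNReal
      fun k : C(OnePoint ℂ, ℝ) => ∫ z : ℂ, k (z : OnePoint ℂ) ∂(vol σ₀) := by
    refine LipschitzWith.of_dist_le_mul fun k k' => ?_
    rw [dist_eq_norm, ← integral_sub (integrable_of_continuousMap hσ k)
      (integrable_of_continuousMap hσ k'), Real.coe_toNNReal _ measureReal_nonneg, mul_comm]
    refine norm_integral_le_of_norm_le_const (ae_of_all _ fun z => ?_)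
    rw [← dist_eq_norm]
    exact ContinuousMap.dist_apply_le_dist _
  exact h2.continuous.comp h1

/-- The function `s + C` with the constant `C` that normalizes the metric of `n` squares. -/
def normalizedField (σ₀ : ℂ → ℝ) (n : ℕ) (s : C(OnePoint ℂ, ℝ)) : C(OnePoint ℂ, ℝ) :=
  s + ContinuousMap.const (OnePoint ℂ)
    (1 / 4 * Real.log n - 3 / 4 * Real.log (sphereArea σ₀ s))

/-- The conformal factor of the normalized metric. -/
def normalizedMetric (σ₀ : ℂ → ℝ) (n : ℕ) (s : C(OnePoint ℂ, ℝ)) : C(OnePoint ℂ, ℝ) :=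
  ContinuousMap.comp ⟨fun x : ℝ => Real.exp (2 * x), by fun_prop⟩ (normalizedField σ₀ n s)

lemma continuous_normalizedMetric (hσ : IsSmoothSphereMetric σ₀) (n : ℕ) :
    Continuous (normalizedMetric σ₀ n) := by
  refine (ContinuousMap.continuous_postcomp _).comp (continuous_id.add ?_)
  refine ContinuousMap.continuous_const'.comp (continuous_const.sub (continuous_const.mul ?_))
  exact (continuous_sphereArea hσ).log fun s => (sphereArea_pos hσ s).ne'

/-- By the choice of the normalization the determinant of the normalized metric is a constant times
the exponential of the Dirichlet energy. -/
lemma polyakovAlvarezDet_normalizedField (hσ : IsSmoothSphereMetric σ₀) (n : ℕ)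
    {s : C(OnePoint ℂ, ℝ)} (hs : ∫ z : ℂ, s (z : OnePoint ℂ) * gaussCurv σ₀ z ∂(vol σ₀) = 0) :
    polyakovAlvarezDet σ₀ (normalizedField σ₀ n s) =
      Real.exp (1 / 3 * Real.log n - Real.log (sphereArea σ₀ 0)) *
        Real.exp (-(1 / (12 * Real.pi)) * dirichletEnergy s) := by
  have hA := sphereArea_pos hσ s
  set C := 1 / 4 * Real.log n - 3 / 4 * Real.log (sphereArea σ₀ s) with hC
  have hval : ∀ p, normalizedField σ₀ n s p = s p + C := fun p => rfl
  have h1 : dirichletEnergy (normalizedField σ₀ n s) = dirichletEnergy s := by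
    simp only [dirichletEnergy, hval, gradient, fderiv_add_const]
  have h2 : ∫ z : ℂ, gaussCurv σ₀ z * normalizedField σ₀ n s (z : OnePoint ℂ) ∂(vol σ₀) =
      4 * Real.pi * C := by
    simp only [hval, mul_add]
    have hi : Integrable (fun z : ℂ => gaussCurv σ₀ z * s (z : OnePoint ℂ)) (vol σ₀) := by
      obtain ⟨B, hB⟩ := (isBddMeas_gaussCurv hσ).bdd
      exact (integrable_of_continuousMap hσ s).bdd_mul (c := B)
        hσ.continuous_gaussCurv.aestronglyMeasurable (ae_of_all _ hB)
    rw [integral_add hi (((isBddMeas_gaussCurv hσ).integrable hσ).mul_const C), integral_mul_const,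
      hσ.integral_gaussCurv]
    simp only [mul_comm (gaussCurv σ₀ _)]
    rw [hs, zero_add]
  have h3 : sphereArea σ₀ (normalizedField σ₀ n s) = Real.exp (2 * C) * sphereArea σ₀ s := by
    simp only [sphereArea, hval, mul_add, Real.exp_add]
    rw [integral_mul_const, mul_comm]
  rw [polyakovAlvarezDet, h1, h2, h3, Real.log_mul (Real.exp_ne_zero _) hA.ne', Real.log_exp,
    ← Real.exp_add]
  congr 1
  have hpi := Real.pi_ne_zero
  -- The curvature term gives -2C/3 and the area term 2C. The sum 4C/3 equals (1/3) log n minus the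
  -- log-area of s, which cancels the remaining log-area.
  have h4 : 1 / (6 * Real.pi) * (4 * Real.pi * C) = 2 / 3 * C := by
    field_simp
    ring
  rw [h4, hC]
  ring

/-! ## The events of the subdivision -/

variable {Ω : Type*} {X : H10 σ₀ → Ω → ℝ} {c ε : ℝ}

lemma regMetric_eq {ω : Ω} : regMetric X c ε ω =
    normalizedMetric σ₀ (subdivision X c ε ω).ncard (scaledField X c ε ω) := rfl

lemma logFactor_eq {ω : Ω} : logFactor X c ε ω =
    normalizedField σ₀ (subdivision X c ε ω).ncard (scaledField X c ε ω) := rfl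

/-- The event that the subdivision equals `F`. -/
def subdivisionEvent (X : H10 σ₀ → Ω → ℝ) (c ε : ℝ) (F : Finset DyadicSquare) : Set Ω :=
  {ω | subdivision X c ε ω = F}

/-- There are only countably many finite collections of dyadic squares, so identities for a fixed
subdivision can be summed. -/
lemma countEvent_eq_iUnion (n : ℕ) : countEvent X c ε n =
    ⋃ F : {F : Finset DyadicSquare // F.card = n}, subdivisionEvent X c ε F := by
  ext ω
  simp only [countEvent, subdivisionEvent, Set.mem_ofPred_eq, Set.mem_iUnion]
  constructor
  · intro h
    have hfin := Set.finite_of_encard_eq_coe h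
    refine ⟨⟨hfin.toFinset, ?_⟩, hfin.coe_toFinset.symm⟩
    rw [← hfin.coe_toFinset, Set.encard_coe_eq_coe_finsetCard] at h
    exact_mod_cast h
  · rintro ⟨⟨F, rfl⟩, h⟩
    rw [h, Set.encard_coe_eq_coe_finsetCard]

lemma pairwise_disjoint_subdivisionEvent (n : ℕ) : Pairwise (Function.onFun Disjoint
    fun F : {F : Finset DyadicSquare // F.card = n} => subdivisionEvent X c ε F) := by
  intro F G hFG
  refine Set.disjoint_left.2 fun ω (hF : subdivision X c ε ω = _) (hG : subdivision X c ε ω = _) =>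
    hFG (Subtype.ext (Finset.coe_injective (hF.symm.trans hG)))

variable [MeasurableSpace Ω] {P : Measure Ω}

lemma IsGFF.measurable_squareSize (hX : IsGFF X P) (S : DyadicSquare) :
    Measurable (squareSize X c S) := by
  have h1 : Measurable (squareAverage X S) := (hX.measurable _).const_mul _
  exact (Real.measurable_exp.comp (h1.div_const _)).mul_const _

lemma IsGFF.measurableSet_subdivisionEvent (hX : IsGFF X P) (F : Finset DyadicSquare) :
    MeasurableSet (subdivisionEvent X c ε F) := by
  have h1 : ∀ S, MeasurableSet {ω | S ∈ subdivision X c ε ω} := fun S => by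
    have : {ω | S ∈ subdivision X c ε ω} = {ω | squareSize X c S ω ≤ ε} ∩
        ⋂ (T : DyadicSquare) (_ : S.carrier ⊂ T.carrier), {ω | ε < squareSize X c T ω} := by
      ext ω
      simp [subdivision]
    rw [this]
    exact (measurableSet_le (hX.measurable_squareSize S) measurable_const).inter
      (MeasurableSet.iInter fun T => MeasurableSet.iInter fun _ =>
        measurableSet_lt measurable_const (hX.measurable_squareSize T))
  have h2 : subdivisionEvent X c ε F = ⋂ S, {ω | S ∈ subdivision X c ε ω ↔ S ∈ F} := by
    ext ω
    simp [subdivisionEvent, Set.ext_iff]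
  rw [h2]
  exact MeasurableSet.iInter fun S => (h1 S).iff (MeasurableSet.const _)

lemma IsGFF.measurableSet_countEvent (hX : IsGFF X P) (n : ℕ) :
    MeasurableSet (countEvent X c ε n) := by
  rw [countEvent_eq_iUnion]
  exact MeasurableSet.iUnion fun F => hX.measurableSet_subdivisionEvent _

/-! ## The regularized metric on the event of a given subdivision -/

/-- On the event that the subdivision equals `F`, almost surely, everything is a function of the
masses of the squares in `F` divided by the background charge. -/
structure IsMassParametrization (X : H10 σ₀ → Ω → ℝ) (P : Measure Ω) (ε : ℝ)
    (F : Finset DyadicSquare) (B : Set (F → ℝ)) (Rg : (F → ℝ) →ₗ[ℝ] C(OnePoint ℂ, ℝ)) :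
    Prop where
  measurableSet : MeasurableSet B
  subdivision_eq_iff : ∀ c, ∀ᵐ ω ∂P, subdivision X c ε ω = F ↔
    (fun S : F => squareMass X S ω / backgroundCharge c) ∈ B
  scaledField_eq : ∀ c ω, subdivision X c ε ω = F →
    scaledField X c ε ω = Rg fun S : F => squareMass X S ω / backgroundCharge c
  integral_eq_zero : ∀ a, ∫ z : ℂ, Rg a (z : OnePoint ℂ) * gaussCurv σ₀ z ∂(vol σ₀) = 0
  dirichletEnergy_eq : ∀ a, dirichletEnergy (Rg a) = minEnergy σ₀ a

lemma exists_isMassParametrization (hX : IsGFF X P) (hσ : IsSmoothSphereMetric σ₀)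
    (hflat : ∀ᶠ z in 𝓝ˢ unitSquare, σ₀ z = 0) {F : Finset DyadicSquare}
    (hA : IsDyadicAntichain F) (hF : IsDyadicCover F) (ε : ℝ) :
    ∃ B Rg, IsMassParametrization X P ε F B Rg := by
  obtain ⟨B, hB, hBsub⟩ := exists_subdivision_set (σ₀ := σ₀) hA hF ε
  obtain ⟨Rg, h1, h2, h3⟩ := exists_regularization hσ hflat hA.aeDisjointSquares
  refine ⟨B, Rg, hB, fun c => ?_, fun c ω h => ?_, h2, h3⟩
  · filter_upwards [hX.ae_isRegularPoint hσ hflat] with ω hω using hBsub X c ω hω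
  · rw [scaledField, regField, h, h1, ← map_smul]
    congr 1
    ext S
    simp [pairGFF_indTilde hσ, div_eq_inv_mul]

/-- An event of positive probability contains a regular point, and the properties of F can be read
off there. -/
lemma IsGFF.isDyadic_of_ne_zero (hX : IsGFF X P) (hσ : IsSmoothSphereMetric σ₀)
    (hflat : ∀ᶠ z in 𝓝ˢ unitSquare, σ₀ z = 0) (hε : 0 < ε) {F : Finset DyadicSquare}
    (h : P (subdivisionEvent X c ε F) ≠ 0) : IsDyadicAntichain F ∧ IsDyadicCover F := by
  have h1 : ∃ᵐ ω ∂P, subdivision X c ε ω = F := frequently_ae_iff.2 h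
  obtain ⟨ω, h2, h3⟩ := (h1.and_eventually (hX.ae_isRegularPoint hσ hflat)).exists
  exact ⟨isDyadicAntichain_of_subdivision_eq h2, isDyadicCover_of_subdivision_eq h3 hε h2⟩

variable {F : Finset DyadicSquare} {B : Set (F → ℝ)} {Rg : (F → ℝ) →ₗ[ℝ] C(OnePoint ℂ, ℝ)}

lemma IsMassParametrization.regMetric_eq (h : IsMassParametrization X P ε F B Rg) {ω : Ω}
    (hω : subdivision X c ε ω = F) : regMetric X c ε ω = normalizedMetric σ₀ F.card
      (Rg fun S : F => squareMass X S ω / backgroundCharge c) := by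
  rw [LQG.regMetric_eq, h.scaledField_eq c ω hω, hω, Set.ncard_coe_finset]

lemma IsMassParametrization.reducedDet_eq (h : IsMassParametrization X P ε F B Rg) {ω : Ω}
    (hω : subdivision X c ε ω = F) : reducedDet X c ε ω = Real.exp (-(1 / (12 * Real.pi)) *
      minEnergy σ₀ fun S : F => squareMass X S ω / backgroundCharge c) := by
  rw [reducedDet, h.scaledField_eq c ω hω, h.dirichletEnergy_eq]

lemma IsMassParametrization.polyakovAlvarezDet_eq (h : IsMassParametrization X P ε F B Rg)
    (hσ : IsSmoothSphereMetric σ₀) {ω : Ω} (hω : subdivision X c ε ω = F) :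
    polyakovAlvarezDet σ₀ (logFactor X c ε ω) =
      Real.exp (1 / 3 * Real.log F.card - Real.log (sphereArea σ₀ 0)) * reducedDet X c ε ω := by
  rw [logFactor_eq, hω, Set.ncard_coe_finset, polyakovAlvarezDet_normalizedField hσ, reducedDet]
  rw [h.scaledField_eq c ω hω]
  exact h.integral_eq_zero _

lemma IsGFF.measurable_massVector (hX : IsGFF X P) (F : Finset DyadicSquare) (d : ℝ) :
    Measurable fun ω => fun S : F => squareMass X S ω / d :=
  measurable_pi_lambda _ fun _ => (hX.measurable_squareMass _).div_const d

lemma measurable_minEnergy (F : Finset DyadicSquare) :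
    Measurable (minEnergy σ₀ (F := F)) := by
  have h1 : Measurable fun a : F → ℝ => (gramMatrix σ₀ F)⁻¹.mulVec a :=
    (LinearMap.continuous_of_finiteDimensional
      (Matrix.mulVecLin (gramMatrix σ₀ F)⁻¹)).measurable
  exact Finset.measurable_sum _ fun S _ => (measurable_pi_apply S).mul
    ((measurable_pi_apply S).comp h1)

lemma IsMassParametrization.measurable_metric (_ : IsMassParametrization X P ε F B Rg)
    (hσ : IsSmoothSphereMetric σ₀) : Measurable fun a => normalizedMetric σ₀ F.card (Rg a) :=
  ((continuous_normalizedMetric hσ _).comp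
    (LinearMap.continuous_of_finiteDimensional Rg)).measurable

/-- The regularized field is defined by a choice, so measurability is obtained piece by piece: where
the subdivision equals F the function agrees with a measurable function of the masses, and null
pieces do not matter. -/
lemma IsGFF.aemeasurable_countEvent {β : Type*} [MeasurableSpace β] (hX : IsGFF X P)
    (hσ : IsSmoothSphereMetric σ₀)
    (hflat : ∀ᶠ z in 𝓝ˢ unitSquare, σ₀ z = 0) (hε : 0 < ε) (n : ℕ) {f : Ω → β}
    (hf : ∀ (F : Finset DyadicSquare) B Rg, IsMassParametrization X P ε F B Rg →
      ∃ g : Ω → β, Measurable g ∧ ∀ ω, subdivision X c ε ω = F → f ω = g ω) :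
    AEMeasurable f (P.restrict (countEvent X c ε n)) := by
  rw [countEvent_eq_iUnion, aemeasurable_iUnion_iff]
  intro F
  by_cases h0 : P (subdivisionEvent X c ε F) = 0
  · rw [Measure.restrict_eq_zero.2 h0]
    exact aemeasurable_zero_measure
  · obtain ⟨hA, hF⟩ := hX.isDyadic_of_ne_zero hσ hflat hε h0
    obtain ⟨B, Rg, h⟩ := exists_isMassParametrization hX hσ hflat hA hF ε
    obtain ⟨g, hg, hfg⟩ := hf F B Rg h
    exact ⟨g, hg, (ae_restrict_iff' (hX.measurableSet_subdivisionEvent _)).2 (ae_of_all _ hfg)⟩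

lemma IsGFF.aemeasurable_regMetric (hX : IsGFF X P) (hσ : IsSmoothSphereMetric σ₀)
    (hflat : ∀ᶠ z in 𝓝ˢ unitSquare, σ₀ z = 0) (hε : 0 < ε) (n : ℕ) :
    AEMeasurable (regMetric X c ε) (P.restrict (countEvent X c ε n)) :=
  hX.aemeasurable_countEvent hσ hflat hε n fun F _ _ h =>
    ⟨_, (h.measurable_metric hσ).comp (hX.measurable_massVector F (backgroundCharge c)),
      fun _ hω => h.regMetric_eq hω⟩

lemma IsGFF.aemeasurable_reducedDet (hX : IsGFF X P) (hσ : IsSmoothSphereMetric σ₀)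
    (hflat : ∀ᶠ z in 𝓝ˢ unitSquare, σ₀ z = 0) (hε : 0 < ε) (n : ℕ) :
    AEMeasurable (reducedDet X c ε) (P.restrict (countEvent X c ε n)) :=
  hX.aemeasurable_countEvent hσ hflat hε n fun F _ _ h =>
    ⟨_, Real.measurable_exp.comp (((measurable_minEnergy F).comp
      (hX.measurable_massVector F (backgroundCharge c))).const_mul _),
      fun _ hω => h.reducedDet_eq hω⟩

end LQG

end

/-! ### Comparison of two central charges on each subdivision event and on the count event. -/

noncomputable section

namespace LQG

variable {σ₀ : ℂ → ℝ} {Ω : Type*} [MeasurableSpace Ω] {P : Measure Ω} {X : H10 σ₀ → Ω → ℝ}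
  {c c' ε : ℝ}

/-! ## Change of the central charge -/

lemma backgroundCharge_pos (hc : c < 25) : 0 < backgroundCharge c :=
  Real.sqrt_pos.2 (by linarith)

lemma backgroundCharge_sq (hc : c < 25) : backgroundCharge c ^ 2 = (25 - c) / 6 :=
  Real.sq_sqrt (by linarith)

/-- The event is absorbed into the integrand as the indicator of B, leaving an expectation of a
function of the scaled Gaussian vector alone. -/
lemma IsMassParametrization.setLIntegral_eq {F : Finset DyadicSquare} {B : Set (F → ℝ)}
    {Rg : (F → ℝ) →ₗ[ℝ] C(OnePoint ℂ, ℝ)} (h : IsMassParametrization X P ε F B Rg)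
    (hX : IsGFF X P) {f : Ω → ℝ≥0∞} {φ : (F → ℝ) → ℝ≥0∞} (hf : ∀ ω, subdivision X c ε ω = F →
      f ω = φ fun S => squareMass X S ω / backgroundCharge c) :
    ∫⁻ ω in subdivisionEvent X c ε F, f ω ∂P =
      ∫⁻ ω, B.indicator φ (fun S => squareMass X S ω / backgroundCharge c) ∂P := by
  rw [← lintegral_indicator (hX.measurableSet_subdivisionEvent F)]
  refine lintegral_congr_ae ?_
  filter_upwards [h.subdivision_eq_iff c] with ω hω
  by_cases hsub : subdivision X c ε ω = F
  · rw [Set.indicator_of_mem (s := subdivisionEvent X c ε F) hsub, Set.indicator_of_mem (hω.1 hsub), hf ω hsub]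
  · rw [Set.indicator_of_notMem (s := subdivisionEvent X c ε F) hsub, Set.indicator_of_notMem (mt hω.2 hsub)]

lemma IsGFF.hasGaussianLaw_squareMass (hX : IsGFF X P) (F : Finset DyadicSquare) :
    HasGaussianLaw (fun ω => fun S : F => squareMass X S ω) P := by
  have h : IsGaussianProcess (fun (S : DyadicSquare) ω => squareMass X S ω) P :=
    (hX.gaussian.comp_right (squarePot σ₀)).smul fun _ => -(2 * Real.pi)
  exact h.hasGaussianLaw F

lemma minEnergy_eq {F : Finset DyadicSquare} (hF : IsUnit (gramMatrix σ₀ F).det) (a : F → ℝ) (b : ℝ) :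
    b * (a ⬝ᵥ ((2 * Real.pi) • gramMatrix σ₀ F)⁻¹.mulVec a) =
      b * (2 * Real.pi)⁻¹ * minEnergy σ₀ a := by
  have h : ((2 * Real.pi) • gramMatrix σ₀ F)⁻¹ = (2 * Real.pi)⁻¹ • (gramMatrix σ₀ F)⁻¹ :=
    Matrix.inv_smul' (gramMatrix σ₀ F) (Units.mk0 _ Real.two_pi_pos.ne') hF
  rw [h, Matrix.smul_mulVec, dotProduct_smul, minEnergy, smul_eq_mul, mul_assoc]

/-- Gaussian scaling with a = Q(c), b = Q(c + c') and covariance 2πG. Since a² - b² = c'/6, the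
weight is the exponential of (c'/24π) times the minimal energy, that is W^(-c'/2). -/
lemma IsGFF.setLIntegral_subdivisionEvent (hX : IsGFF X P) (hσ : IsSmoothSphereMetric σ₀)
    (hflat : ∀ᶠ z in 𝓝ˢ unitSquare, σ₀ z = 0) (hε : 0 < ε) (hc : c < 25) (hcc' : c + c' < 25)
    (F : Finset DyadicSquare) {A : Set C(OnePoint ℂ, ℝ)} (hA : MeasurableSet A) :
    ∫⁻ ω in subdivisionEvent X (c + c') ε F,
        A.indicator 1 (regMetric X (c + c') ε ω) ∂P =
      ENNReal.ofReal ((backgroundCharge (c + c') / backgroundCharge c) ^ F.card) *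
        ∫⁻ ω in subdivisionEvent X c ε F, A.indicator 1 (regMetric X c ε ω) *
          ENNReal.ofReal (reducedDet X c ε ω ^ (-c' / 2)) ∂P := by
  by_cases hF : IsDyadicAntichain F ∧ IsDyadicCover F
  swap
  -- A collection that is not an antichain and a cover has probability zero for every central
  -- charge, so both sides vanish.
  · have h0 : ∀ d, P (subdivisionEvent X d ε F) = 0 := fun d => by
      by_contra h
      exact hF (hX.isDyadic_of_ne_zero hσ hflat hε h)
    rw [Measure.restrict_eq_zero.2 (h0 c), Measure.restrict_eq_zero.2 (h0 (c + c'))]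
    simp
  obtain ⟨B, Rg, h⟩ := exists_isMassParametrization hX hσ hflat hF.1 hF.2 ε
  have hpd := posDef_gramMatrix hσ hflat hF.1.aeDisjointSquares
  have hdet : IsUnit (gramMatrix σ₀ F).det := (Matrix.isUnit_iff_isUnit_det _).1 hpd.isUnit
  set φ : (F → ℝ) → ℝ≥0∞ := fun a => A.indicator 1 (normalizedMetric σ₀ F.card (Rg a)) with hφ
  have hφm : Measurable φ := (measurable_one.indicator hA).comp (h.measurable_metric hσ)
  have hw : ∀ ω, subdivision X c ε ω = F → reducedDet X c ε ω ^ (-c' / 2) =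
      Real.exp ((backgroundCharge c ^ 2 - backgroundCharge (c + c') ^ 2) / 2 *
        ((fun S : F => squareMass X S ω / backgroundCharge c) ⬝ᵥ
          ((2 * Real.pi) • gramMatrix σ₀ F)⁻¹.mulVec
            fun S : F => squareMass X S ω / backgroundCharge c)) := by
    intro ω hω
    rw [h.reducedDet_eq hω, ← Real.exp_mul, minEnergy_eq hdet, backgroundCharge_sq hc,
      backgroundCharge_sq hcc']
    congr 1
    field_simp
    ring
  set ψ : (F → ℝ) → ℝ≥0∞ := fun a => ENNReal.ofReal (Real.exp
    ((backgroundCharge c ^ 2 - backgroundCharge (c + c') ^ 2) / 2 *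
      (a ⬝ᵥ ((2 * Real.pi) • gramMatrix σ₀ F)⁻¹.mulVec a))) with hψ
  rw [h.setLIntegral_eq hX (φ := φ) fun ω hω => by rw [h.regMetric_eq hω],
    h.setLIntegral_eq hX (φ := fun a => φ a * ψ a)
      fun ω hω => by rw [h.regMetric_eq hω, hw ω hω]]
  have hscale := lintegral_gaussian_scaling (P := P) (Y := fun S : F => squareMass X S)
    (fun S => hX.measurable_squareMass S) (hX.hasGaussianLaw_squareMass F)
    (fun S => hX.integral_squareMass S)
    (hpd.smul Real.two_pi_pos)
    (fun S T => hX.covariance_squareMass S T) (backgroundCharge_pos hc)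
    (backgroundCharge_pos hcc') (hφm.indicator h.measurableSet)
  rw [hscale, Fintype.card_coe]
  congr 2
  ext ω
  exact (Set.indicator_mul_left B φ ψ).symm

/-- The prefactor is the same for all collections of n squares, so it comes out of the sum. -/
lemma IsGFF.setLIntegral_countEvent (hX : IsGFF X P) (hσ : IsSmoothSphereMetric σ₀)
    (hflat : ∀ᶠ z in 𝓝ˢ unitSquare, σ₀ z = 0) (hε : 0 < ε) (hc : c < 25) (hcc' : c + c' < 25)
    (n : ℕ) {A : Set C(OnePoint ℂ, ℝ)} (hA : MeasurableSet A) :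
    ∫⁻ ω in countEvent X (c + c') ε n, A.indicator 1 (regMetric X (c + c') ε ω) ∂P =
      ENNReal.ofReal ((backgroundCharge (c + c') / backgroundCharge c) ^ n) *
        ∫⁻ ω in countEvent X c ε n, A.indicator 1 (regMetric X c ε ω) *
          ENNReal.ofReal (reducedDet X c ε ω ^ (-c' / 2)) ∂P := by
  simp only [countEvent_eq_iUnion]
  rw [lintegral_iUnion (fun F => hX.measurableSet_subdivisionEvent _)
      (pairwise_disjoint_subdivisionEvent n),
    lintegral_iUnion (fun F => hX.measurableSet_subdivisionEvent _)
      (pairwise_disjoint_subdivisionEvent n), ← ENNReal.tsum_mul_left]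
  refine tsum_congr fun F => ?_
  rw [hX.setLIntegral_subdivisionEvent hσ hflat hε hc hcc' F hA, F.2]

/-- If the subdivision has `n` squares with positive probability, then almost surely on that event
the determinant is a constant multiple of the reduced determinant. -/
lemma IsGFF.ae_polyakovAlvarezDet (hX : IsGFF X P) (hσ : IsSmoothSphereMetric σ₀)
    (hflat : ∀ᶠ z in 𝓝ˢ unitSquare, σ₀ z = 0) (hε : 0 < ε) (n : ℕ) :
    ∀ᵐ ω ∂(P.restrict (countEvent X c ε n)), polyakovAlvarezDet σ₀ (logFactor X c ε ω) =
      Real.exp (1 / 3 * Real.log n - Real.log (sphereArea σ₀ 0)) * reducedDet X c ε ω := by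
  rw [ae_restrict_iff' (hX.measurableSet_countEvent n)]
  filter_upwards [hX.ae_isRegularPoint hσ hflat] with ω hreg hω
  rw [countEvent_eq_iUnion, Set.mem_iUnion] at hω
  obtain ⟨⟨F, rfl⟩, hF⟩ := hω
  obtain ⟨B, Rg, h⟩ := exists_isMassParametrization hX hσ hflat
    (isDyadicAntichain_of_subdivision_eq hF) (isDyadicCover_of_subdivision_eq hreg hε hF) ε
  exact h.polyakovAlvarezDet_eq hσ hF

end LQG

end

/-! ### Conclusion: normalization of the weighted law. -/

theorem mainTheorem1 {Ω : Type*} [MeasurableSpace Ω] (P : Measure Ω) [IsProbabilityMeasure P]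
    (σ₀ : ℂ → ℝ) (hσ₀ : LQG.IsSmoothSphereMetric σ₀)
    (hflat : ∀ᶠ z in 𝓝ˢ LQG.unitSquare, σ₀ z = 0)
    (X : LQG.H10 σ₀ → Ω → ℝ) (hX : LQG.IsGFF X P)
    (ε : ℝ) (hε : 0 < ε) (n : ℕ) (hn : 0 < n)
    (c c' : ℝ) (hc : c < 25) (hcc' : c + c' < 25)
    (hpos : P (LQG.countEvent X c ε n) ≠ 0) :
    IsProbabilityMeasure (LQG.regLaw P X c ε n) ∧
    IsProbabilityMeasure (LQG.regLaw P X (c + c') ε n) ∧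
    (∃ κ : ℝ, 0 < κ ∧ ∀ᵐ ω ∂(ProbabilityTheory.cond P (LQG.countEvent X c ε n)),
      LQG.polyakovAlvarezDet σ₀ (LQG.logFactor X c ε ω) = κ * LQG.reducedDet X c ε ω) ∧
    Integrable (fun ω => LQG.reducedDet X c ε ω ^ (-c' / 2))
      (ProbabilityTheory.cond P (LQG.countEvent X c ε n)) ∧
    (LQG.weighted (ProbabilityTheory.cond P (LQG.countEvent X c ε n))
        (fun ω => LQG.reducedDet X c ε ω ^ (-c' / 2))).map (LQG.regMetric X c ε) =
      LQG.regLaw P X (c + c') ε n := by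
  set E := LQG.countEvent X c ε n with hE
  set E' := LQG.countEvent X (c + c') ε n with hE'
  set w : Ω → ℝ≥0∞ := fun ω => ENNReal.ofReal (LQG.reducedDet X c ε ω ^ (-c' / 2)) with hw
  set θ := ENNReal.ofReal ((LQG.backgroundCharge (c + c') / LQG.backgroundCharge c) ^ n) with hθ
  have hQ := LQG.backgroundCharge_pos hc
  have hQ' := LQG.backgroundCharge_pos hcc'
  have hθ0 : θ ≠ 0 := (ENNReal.ofReal_pos.2 (by positivity)).ne'
  have hθtop : θ ≠ ∞ := ENNReal.ofReal_ne_top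
  have hRm : ∀ d, AEMeasurable (LQG.regMetric X d ε) (P.restrict (LQG.countEvent X d ε n)) :=
    fun d => hX.aemeasurable_regMetric hσ₀ hflat hε n
  have hDm : AEMeasurable (fun ω => LQG.reducedDet X c ε ω ^ (-c' / 2)) (P.restrict E) :=
    (hX.aemeasurable_reducedDet hσ₀ hflat hε n).pow_const _
  have hwm : AEMeasurable w (P.restrict E) := hDm.ennreal_ofReal
  have hRcond : ∀ d, AEMeasurable (LQG.regMetric X d ε)
      (ProbabilityTheory.cond P (LQG.countEvent X d ε n)) := fun d => (hRm d).smul_measure _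
  have hDcond : AEMeasurable (fun ω => LQG.reducedDet X c ε ω ^ (-c' / 2))
      (ProbabilityTheory.cond P E) := hDm.smul_measure _
  have hkey := fun A hA => hX.setLIntegral_countEvent (A := A) hσ₀ hflat hε hc hcc' n hA
  set Z := ∫⁻ ω in E, w ω ∂P with hZ
  -- Testing against the whole space relates the new probability to the total weight. Positivity of
  -- the weight makes P E' nonzero, and P E' ≤ 1 makes Z finite, which is the integrability claim.
  have hEZ : P E' = θ * Z := by
    have := hkey Set.univ MeasurableSet.univ
    simpa using this
  have hZ0 : Z ≠ 0 := by
    rw [hZ, Ne, lintegral_eq_zero_iff' hwm]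
    intro h
    refine hpos ?_
    rw [← Measure.restrict_eq_zero, ← ae_eq_bot, ← Filter.eventually_false_iff_eq_bot]
    filter_upwards [h] with ω hω
    rw [Pi.zero_apply, hw, ENNReal.ofReal_eq_zero] at hω
    exact absurd hω (not_le.2 (Real.rpow_pos_of_pos (Real.exp_pos _) _))
  have hE'0 : P E' ≠ 0 := by
    rw [hEZ]
    exact mul_ne_zero hθ0 hZ0
  have hZtop : Z ≠ ∞ := fun h => by
    rw [h, ENNReal.mul_top hθ0] at hEZ
    exact measure_ne_top P E' hEZ
  have hp : IsProbabilityMeasure (ProbabilityTheory.cond P E) :=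
    ProbabilityTheory.cond_isProbabilityMeasure hpos
  have hp' : IsProbabilityMeasure (ProbabilityTheory.cond P E') :=
    ProbabilityTheory.cond_isProbabilityMeasure hE'0
  have hPE : P E ≠ ∞ := measure_ne_top P E
  have hcondZ : ∫⁻ ω, w ω ∂(ProbabilityTheory.cond P E) = (P E)⁻¹ * Z := by
    rw [ProbabilityTheory.cond, lintegral_smul_measure, smul_eq_mul]
  refine ⟨Measure.isProbabilityMeasure_map (hRcond c),
    Measure.isProbabilityMeasure_map (hRcond (c + c')), ⟨Real.exp (1 / 3 * Real.log n -
      Real.log (LQG.sphereArea σ₀ 0)), Real.exp_pos _, ?_⟩, ⟨?_, ?_⟩, ?_⟩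
  · exact Measure.ae_smul_measure (hX.ae_polyakovAlvarezDet hσ₀ hflat hε n) _
  · exact hDcond.aestronglyMeasurable
  · have h1 : ∫⁻ ω, ‖LQG.reducedDet X c ε ω ^ (-c' / 2)‖ₑ ∂(ProbabilityTheory.cond P E) =
        (P E)⁻¹ * Z := by
      rw [← hcondZ]
      refine lintegral_congr fun ω => ?_
      exact Real.enorm_of_nonneg (Real.rpow_nonneg (Real.exp_pos _).le _)
    rw [HasFiniteIntegral, h1]
    exact ENNReal.mul_lt_top (ENNReal.inv_lt_top.2 (pos_iff_ne_zero.2 hpos)) hZtop.lt_top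
  · have hac : LQG.weighted (ProbabilityTheory.cond P E)
        (fun ω => LQG.reducedDet X c ε ω ^ (-c' / 2)) ≪ ProbabilityTheory.cond P E :=
      Measure.AbsolutelyContinuous.smul_left (withDensity_absolutelyContinuous _ _) _
    have hmap : ∀ {μ : Measure Ω} {f : Ω → C(OnePoint ℂ, ℝ)} (_ : AEMeasurable f μ)
        {A : Set C(OnePoint ℂ, ℝ)} (_ : MeasurableSet A),
        μ.map f A = ∫⁻ ω, A.indicator 1 (f ω) ∂μ := by
      intro μ f hf A hA
      rw [← lintegral_map' (measurable_one.indicator hA).aemeasurable hf, lintegral_indicator_one hA]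
    ext A hA
    have hAm : AEMeasurable (fun ω => A.indicator (1 : C(OnePoint ℂ, ℝ) → ℝ≥0∞)
        (LQG.regMetric X c ε ω)) (ProbabilityTheory.cond P E) :=
      (measurable_one.indicator hA).comp_aemeasurable (hRcond c)
    have h1 : ∫⁻ ω, A.indicator 1 (LQG.regMetric X c ε ω)
        ∂((ProbabilityTheory.cond P E).withDensity w) =
        (P E)⁻¹ * ∫⁻ ω in E, A.indicator 1 (LQG.regMetric X c ε ω) * w ω ∂P := by
      rw [lintegral_withDensity_eq_lintegral_mul₀ hDcond.ennreal_ofReal hAm,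
        ProbabilityTheory.cond, lintegral_smul_measure, smul_eq_mul]
      simp only [Pi.mul_apply, mul_comm (A.indicator _ _), hw]
    have h2 : ∫⁻ ω, A.indicator 1 (LQG.regMetric X (c + c') ε ω) ∂(ProbabilityTheory.cond P E') =
        (P E')⁻¹ * (θ * ∫⁻ ω in E, A.indicator 1 (LQG.regMetric X c ε ω) * w ω ∂P) := by
      rw [ProbabilityTheory.cond, lintegral_smul_measure, smul_eq_mul, hkey A hA]
    -- Both sides are normalized by their total mass, so the factors 1/P E and θ drop out and Z⁻¹
    -- times the same weighted integral remains.
    have hcancel : ∀ {a b : ℝ≥0∞}, a ≠ 0 → a ≠ ∞ → (a * Z)⁻¹ * (a * b) = Z⁻¹ * b := by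
      intro a b h0 ht
      rw [ENNReal.mul_inv (Or.inl h0) (Or.inl ht), mul_mul_mul_comm, ENNReal.inv_mul_cancel h0 ht,
        one_mul]
    rw [hmap ((hRcond c).mono_ac hac) hA, LQG.regLaw, hmap (hRcond (c + c')) hA, h2, hEZ,
      LQG.weighted, lintegral_smul_measure, h1, hcondZ, smul_eq_mul,
      hcancel (ENNReal.inv_ne_zero.2 hPE) (ENNReal.inv_ne_top.2 hpos), hcancel hθ0 hθtop]
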